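/- Let $K$ be a commutative ring with unit. **Gray semigroups.** A $K$-linear 2-category $\mathfrak{C}$ is a (strict) 2-category whose 2-cells $f\Rightarrow g$ form $K$-modules such that vertical and horizontal composition are $K$-bilinear. Write $\circ$ for composition of 1-cells and horizontal composition, $\cdot$ for vertical composition. A semigroupal structure $(\otimes,a,\pi)$ on a 2-category $\mathfrak{C}$ consists of a pseudofunctor $\otimes:\mathfrak{C}\times\mathfrak{C}\to\mathfrak{C}$ with structural 2-isomorphisms $\widehat\otimes((f',g'),(f,g)):(f'\otimes g')\circ(f\otimes g)\Rightarrow(f'\circ f)\otimes(g'\circ g)$ and $\otimes_0(X,Y):id_X\otimes id_Y\Rightarrow id_{X\otimes Y}$, a pseudonatural isomorphism $a_{X,Y,Z}:X\otimes(Y\otimes Z)\to(X\otimes Y)\otimes Z$ with 2-isomorphisms $\widehat a(f,g,h):((f\otimes g)\otimes h)\circ a\Rightarrow a\circ(f\otimes(g\otimes h))$, and an invertible modification $\pi_{X,Y,Z,T}:(a_{X,Y,Z}\otimes id_T)\circ a_{X,Y\otimes Z,T}\circ(id_X\otimes a_{Y,Z,T})\Rightarrow a_{X\otimes Y,Z,T}\circ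 a_{X,Y,Z\otimes T}$ satisfying the $K_5$ (Stasheff polytope) coherence relation. A $K$-linear Gray semigroup $(\mathfrak{C},\otimes)$ is a $K$-linear 2-category with a semigroupal structure such that $\otimes$ is $K$-bilinear on 2-cells, all $\otimes_0(X,Y)$, $\widehat\otimes((f',id),(f,g))$ and $\widehat\otimes((f,g'),(id,g))$ are identities, and all $a_{X,Y,Z}$, $\widehat a(f,g,h)$, $\pi_{X,Y,Z,T}$ are identities. **Deformations.** Let $R=K[\epsilon]/(\epsilon^2)$ and let $\mathfrak{C}_R$ be the 2-category with the objects and 1-cells of $\mathfrak{C}$ and with 2-cells $R\otimes_K\mathfrak{C}(f,g)$, all compositions and $\otimes$ being extended $R$-bilinearly. A first order unitary tensorator-deformation of $(\mathfrak{C},\otimes)$ is a semigroupal structure on $\mathfrak{C}_R$ with the same tensor product of objects, 1-cells and 2-cells and the same 1-cells $a_{X,Y,Z}$, with structural 2-isomorphisms $\widehat\otimes_\epsilon,(\otimes_0)_\epsilon,\widehat a_\epsilon,\pi_\epsilon$ such that $(\otimes_0)_\epsilon,\widehat a_\epsilon,\pi_\epsilon$ are those of $(\mathfrak{C},\otimes)$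 (identities) and $\widehat\otimes_\epsilon\equiv\widehat\otimes$ modulo $\epsilon$; that is, $\widehat\otimes_\epsilon=\widehat\otimes+\widehat\otimes^{(1)}\epsilon$. Two such deformations $\otimes_\epsilon$, $\otimes'_\epsilon$ are $\psi$-equivalent if the identity 2-functor of $\mathfrak{C}_R$ admits a semigroupal structure $(\psi,\omega)$ from the first to the second (a pseudonatural isomorphism $\psi_{X,Y}:X\otimes'Y\to X\otimes Y$ with 2-isomorphisms $\widehat\psi(f,g):(f\otimes g)\circ\psi_{X,Y}\Rightarrow\psi_{X',Y'}\circ(f\otimes'g)$ and an invertible modification $\omega_{X,Y,Z}:a_{X,Y,Z}\circ\psi_{X,Y\otimes Z}\circ(id_X\otimes'\psi_{Y,Z})\Rightarrow\psi_{X\otimes Y,Z}\circ(\psi_{X,Y}\otimes'id_Z)\circ a'_{X,Y,Z}$ that satisfies the coherence relation with the two pentagonators) such that $\psi_{X,Y}=id_{X\otimes Y}$, $\widehat\psi(f,g)\equiv 1_{f\otimes g}$ modulo $\epsilon$, and $\omega_{X,Y,Z}=(\otimes'_0(X\otimes Y,Z)^{-1}\circ 1_{a_{X,Y,Z}})\cdot(1_{a_{X,Y,Z}}\circ\otimes'_0(X,Y\otimes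 Z))$. **Cohomology.** For $n=1,2$ let $X^n_s(\otimes)$ be the $K$-module of special $n$-cochains of $\otimes$: families of 2-cells $\phi(f,g):f\otimes g\Rightarrow f\otimes g$ (for $n=1$), respectively $\phi((f',g'),(f,g)):(f'\otimes g')\circ(f\otimes g)\Rightarrow(f'\circ f)\otimes(g'\circ g)$ (for $n=2$), natural with respect to 2-cells between the arguments, and zero as soon as one of the argument pairs is $(id,id)$. The horizontal differential is $$(\delta_h\phi)((f',g'),(f,g))=\widehat\otimes\cdot(1_{f'\otimes g'}\circ\phi(f,g))-\phi(f'f,g'g)\cdot\widehat\otimes+\widehat\otimes\cdot(\phi(f',g')\circ 1_{f\otimes g})$$ for $n=1$, with $\widehat\otimes=\widehat\otimes((f',g'),(f,g))$, and, for $n=2$ and $F=(f,g)$, $F'=(f',g')$, $F''=(f'',g'')$, $\otimes F=f\otimes g$, $$\begin{aligned}(\delta_h\phi)(F'',F',F)={}&\widehat\otimes(F'',F'F)\cdot(1_{\otimes F''}\circ\phi(F',F))-\phi(F''F',F)\cdot(\widehat\otimes(F'',F')\circ1_{\otimes F})\\&+\phi(F'',F'F)\cdot(1_{\otimes F''}\circ\widehat\otimes(F',F))-\widehat\otimes(F''F',F)\cdot(\phi(F'',F')\circ1_{\otimes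 F}).\end{aligned}$$ The vertical differential is $$(\delta_v\phi)(f,g,h)=1_f\otimes\phi(g,h)-\phi(f\otimes g,h)+\phi(f,g\otimes h)-\phi(f,g)\otimes 1_h$$ for $n=1$, and for $n=2$ $$\begin{aligned}(\delta_v\phi)((f',g',h'),(f,g,h))={}&(1_{f'f}\otimes\phi((g',h'),(g,h)))\cdot\widehat\otimes((f',g'\otimes h'),(f,g\otimes h))\\&-(\widehat\otimes((f',g'),(f,g))\otimes1_{h'h})\cdot\phi((f'\otimes g',h'),(f\otimes g,h))\\&+(1_{f'f}\otimes\widehat\otimes((g',h'),(g,h)))\cdot\phi((f',g'\otimes h'),(f,g\otimes h))\\&-(\phi((f',g'),(f,g))\otimes1_{h'h})\cdot\widehat\otimes((f'\otimes g',h'),(f\otimes g,h)).\end{aligned}$$ Let $X^n_{tens}(\mathfrak{C})=\ker(\delta_v)\subseteq X^n_s(\otimes)$, a complex under $\delta_h$, and $$H^2_{tens}(\mathfrak{C})=\{\phi\in X^2_{tens}(\mathfrak{C}):\delta_h\phi=0\}\,/\,\delta_h(X^1_{tens}(\mathfrak{C})).$$ **Theorem.** Let $(\mathfrak{C},\otimes)$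 be a $K$-linear Gray semigroup. Then $\psi$-equivalence is an equivalence relation on the first order unitary tensorator-deformations of $(\mathfrak{C},\otimes)$, every such deformation $\widehat\otimes_\epsilon=\widehat\otimes+\widehat\otimes^{(1)}\epsilon$ has $\widehat\otimes^{(1)}\in X^2_{tens}(\mathfrak{C})$ with $\delta_h\widehat\otimes^{(1)}=0$, and the assignment of the class of $\widehat\otimes^{(1)}$ to the class of $\widehat\otimes_\epsilon$ is a bijection from the set of $\psi$-equivalence classes onto $H^2_{tens}(\mathfrak{C})$. -/

import Mathlib

open CategoryTheory Bicategory
open scoped TensorProduct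

universe w v u

/-- `f` is an identity morphism: its source and target are the same object and `f` is the identity
of that object. This is used for 1-cells and for 2-cells. -/
inductive IsIdentity {D : Type u} [CategoryStruct.{v} D] : ∀ {X Y : D}, (X ⟶ Y) → Prop
  | id (X : D) : IsIdentity (𝟙 X)

/-- Linearity over `K` of the composition functors of a bicategory whose categories of 1-cells are
`K`-linear (bilinearity of horizontal composition, expressed through whiskering). -/
class LinearBicategory (K : Type*) [CommRing K] (C : Type u) [Bicategory.{w, v} C]
    [∀ X Y : C, Preadditive (X ⟶ Y)] [∀ X Y : C, Linear K (X ⟶ Y)] : Prop where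
  whiskerLeft_add : ∀ {X Y Z : C} (f : X ⟶ Y) {g h : Y ⟶ Z} (σ τ : g ⟶ h),
    f ◁ (σ + τ) = f ◁ σ + f ◁ τ
  whiskerLeft_smul : ∀ {X Y Z : C} (f : X ⟶ Y) {g h : Y ⟶ Z} (r : K) (τ : g ⟶ h),
    f ◁ (r • τ) = r • (f ◁ τ)
  add_whiskerRight : ∀ {X Y Z : C} {f g : X ⟶ Y} (σ τ : f ⟶ g) (h : Y ⟶ Z),
    (σ + τ) ▷ h = σ ▷ h + τ ▷ h
  smul_whiskerRight : ∀ {X Y Z : C} {f g : X ⟶ Y} (r : K) (τ : f ⟶ g) (h : Y ⟶ Z),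
    (r • τ) ▷ h = r • (τ ▷ h)

/-! ### Extension of scalars -/

section Extension

/-- Objects of the `R`-linear extension of a `K`-linear 2-category: those of `C`. -/
structure ScalarExt (K : Type*) (R : Type*) (C : Type u) where
  as : C

namespace ScalarExt

/-- 1-cells of the `R`-linear extension: those of `C`. -/
structure Hom₁ {K : Type*} {R : Type*} {C : Type u} [Bicategory.{w, v} C] (X Y : ScalarExt K R C) where
  as : X.as ⟶ Y.as

variable {K : Type*} {R : Type*} [CommRing K] [CommRing R] [Algebra K R]
  {C : Type u} [Bicategory.{w, v} C]
  [∀ X Y : C, Preadditive (X ⟶ Y)] [∀ X Y : C, Linear K (X ⟶ Y)]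

instance : CategoryStruct (ScalarExt K R C) where
  Hom X Y := Hom₁ X Y
  id X := ⟨𝟙 X.as⟩
  comp f g := ⟨f.as ≫ g.as⟩

/-- The category of 1-cells from `X` to `Y` in the `R`-linear extension. The 2-cells are the
elements of `R ⊗[K] (f ⟶ g)`, and `(r ⊗ σ) ≫ (s ⊗ τ) = (r * s) ⊗ (σ ≫ τ)`. -/
instance (priority := 100) homCategory (X Y : ScalarExt K R C) : Category (X ⟶ Y) where
  Hom f g := R ⊗[K] (f.as ⟶ g.as)
  id f := 1 ⊗ₜ 𝟙 f.as
  comp {f g h} σ τ :=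
    TensorProduct.map₂ (LinearMap.mul K R) (Linear.comp f.as g.as h.as) σ τ
  id_comp σ := by
    induction σ using TensorProduct.induction_on with
    | zero => simp
    | tmul r σ => simp
    | add σ τ hσ hτ => rw [map_add, hσ, hτ]
  comp_id σ := by
    induction σ using TensorProduct.induction_on with
    | zero => simp
    | tmul r σ => simp
    | add σ τ hσ hτ => rw [map_add, LinearMap.add_apply, hσ, hτ]
  assoc σ τ υ := by
    induction σ using TensorProduct.induction_on with
    | zero => simp
    | add σ σ' h h' => simp only [map_add, LinearMap.add_apply, h, h']
    | tmul r σ =>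
      induction τ using TensorProduct.induction_on with
      | zero => simp
      | add τ τ' h h' => simp only [map_add, LinearMap.add_apply, h, h']
      | tmul s τ =>
        induction υ using TensorProduct.induction_on with
        | zero => simp
        | add υ υ' h h' => simp only [map_add, h, h']
        | tmul t υ => simp [mul_assoc]

/-- The 2-cells of the extension form an `R`-module. -/
instance (X Y : ScalarExt K R C) (f g : X ⟶ Y) : AddCommGroup (f ⟶ g) :=
  inferInstanceAs (AddCommGroup (R ⊗[K] (f.as ⟶ g.as)))

instance (X Y : ScalarExt K R C) (f g : X ⟶ Y) : Module R (f ⟶ g) :=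
  inferInstanceAs (Module R (R ⊗[K] (f.as ⟶ g.as)))

/-- The 2-cell `r ⊗ τ` of the extension. -/
def cell {X Y : ScalarExt K R C} {f g : X ⟶ Y} (r : R) (τ : f.as ⟶ g.as) : f ⟶ g :=
  (r ⊗ₜ[K] τ : R ⊗[K] (f.as ⟶ g.as))


theorem cell_comp_cell {X Y : ScalarExt K R C} {f g h : X ⟶ Y} (r s : R) (σ : f.as ⟶ g.as)
    (τ : g.as ⟶ h.as) :
    (cell r σ : f ⟶ g) ≫ (cell s τ : g ⟶ h) = cell (r * s) (σ ≫ τ) := rfl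

theorem id_eq_cell {X Y : ScalarExt K R C} (f : X ⟶ Y) : 𝟙 f = cell (1 : R) (𝟙 f.as) := rfl

/-- The inclusion of the 2-cells of `C` into those of the extension, `τ ↦ 1 ⊗ τ`. -/
def incl {X Y : ScalarExt K R C} {f g : X ⟶ Y} (τ : f.as ⟶ g.as) : f ⟶ g := cell 1 τ

/-- The inclusion on invertible 2-cells. -/
@[simps]
def inclIso {X Y : ScalarExt K R C} {f g : X ⟶ Y} (τ : f.as ≅ g.as) : f ≅ g where
  hom := incl τ.hom
  inv := incl τ.inv
  hom_inv_id := by simp [incl, cell_comp_cell, id_eq_cell]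
  inv_hom_id := by simp [incl, cell_comp_cell, id_eq_cell]

theorem cell_induction {X Y : ScalarExt K R C} {f g : X ⟶ Y} {p : (f ⟶ g) → Prop} (τ : f ⟶ g)
    (zero : p 0) (tmul : ∀ (r : R) (τ : f.as ⟶ g.as), p (cell r τ))
    (add : ∀ σ τ, p σ → p τ → p (σ + τ)) : p τ :=
  TensorProduct.induction_on τ zero tmul add

theorem add_comp {X Y : ScalarExt K R C} {f g h : X ⟶ Y} (σ σ' : f ⟶ g) (τ : g ⟶ h) :
    (σ + σ') ≫ τ = σ ≫ τ + σ' ≫ τ :=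
  LinearMap.map_add₂ (TensorProduct.map₂ (LinearMap.mul K R) (Linear.comp f.as g.as h.as)) σ σ' τ

theorem comp_add {X Y : ScalarExt K R C} {f g h : X ⟶ Y} (σ : f ⟶ g) (τ τ' : g ⟶ h) :
    σ ≫ (τ + τ') = σ ≫ τ + σ ≫ τ' :=
  map_add (TensorProduct.map₂ (LinearMap.mul K R) (Linear.comp f.as g.as h.as) σ) τ τ'

theorem zero_comp {X Y : ScalarExt K R C} {f g h : X ⟶ Y} (τ : g ⟶ h) :
    (0 : f ⟶ g) ≫ τ = 0 :=
  LinearMap.map_zero₂ (TensorProduct.map₂ (LinearMap.mul K R) (Linear.comp f.as g.as h.as)) τ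

theorem comp_zero {X Y : ScalarExt K R C} {f g h : X ⟶ Y} (σ : f ⟶ g) :
    σ ≫ (0 : g ⟶ h) = 0 :=
  map_zero (TensorProduct.map₂ (LinearMap.mul K R) (Linear.comp f.as g.as h.as) σ)

variable [LinearBicategory K C]

/-- Whiskering on the left, as a `K`-linear map. -/
@[simps]
def whiskerLeftₗ {X Y Z : C} (f : X ⟶ Y) (g h : Y ⟶ Z) : (g ⟶ h) →ₗ[K] (f ≫ g ⟶ f ≫ h) where
  toFun τ := f ◁ τ
  map_add' := LinearBicategory.whiskerLeft_add K f
  map_smul' := LinearBicategory.whiskerLeft_smul f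

/-- Whiskering on the right, as a `K`-linear map. -/
@[simps]
def whiskerRightₗ {X Y Z : C} (f g : X ⟶ Y) (h : Y ⟶ Z) : (f ⟶ g) →ₗ[K] (f ≫ h ⟶ g ≫ h) where
  toFun τ := τ ▷ h
  map_add' σ τ := LinearBicategory.add_whiskerRight K σ τ h
  map_smul' r τ := LinearBicategory.smul_whiskerRight r τ h

/-- `f ◁ (r ⊗ τ) = r ⊗ (f ◁ τ)`. -/
def wLeft {X Y Z : ScalarExt K R C} (f : X ⟶ Y) {g h : Y ⟶ Z} (τ : g ⟶ h) :
    (f ≫ g ⟶ f ≫ h) :=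
  (whiskerLeftₗ (K := K) f.as g.as h.as).lTensor R τ

/-- `(r ⊗ τ) ▷ h = r ⊗ (τ ▷ h)`. -/
def wRight {X Y Z : ScalarExt K R C} {f g : X ⟶ Y} (τ : f ⟶ g) (h : Y ⟶ Z) :
    (f ≫ h ⟶ g ≫ h) :=
  (whiskerRightₗ (K := K) f.as g.as h.as).lTensor R τ

theorem wLeft_cell {X Y Z : ScalarExt K R C} (f : X ⟶ Y) {g h : Y ⟶ Z} (r : R)
    (τ : g.as ⟶ h.as) : wLeft f (cell r τ : g ⟶ h) = cell r (f.as ◁ τ) := rfl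

theorem cell_wRight {X Y Z : ScalarExt K R C} {f g : X ⟶ Y} (r : R)
    (τ : f.as ⟶ g.as) (h : Y ⟶ Z) : wRight (cell r τ : f ⟶ g) h = cell r (τ ▷ h.as) := rfl

theorem wLeft_add {X Y Z : ScalarExt K R C} (f : X ⟶ Y) {g h : Y ⟶ Z} (σ τ : g ⟶ h) :
    wLeft f (σ + τ) = wLeft f σ + wLeft f τ :=
  map_add ((whiskerLeftₗ (K := K) f.as g.as h.as).lTensor R) σ τ

theorem wLeft_zero {X Y Z : ScalarExt K R C} (f : X ⟶ Y) (g h : Y ⟶ Z) :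
    wLeft f (0 : g ⟶ h) = 0 :=
  map_zero ((whiskerLeftₗ (K := K) f.as g.as h.as).lTensor R)

theorem wRight_add {X Y Z : ScalarExt K R C} {f g : X ⟶ Y} (σ τ : f ⟶ g) (h : Y ⟶ Z) :
    wRight (σ + τ) h = wRight σ h + wRight τ h :=
  map_add ((whiskerRightₗ (K := K) f.as g.as h.as).lTensor R) σ τ

theorem wRight_zero {X Y Z : ScalarExt K R C} (f g : X ⟶ Y) (h : Y ⟶ Z) :
    wRight (0 : f ⟶ g) h = 0 :=
  map_zero ((whiskerRightₗ (K := K) f.as g.as h.as).lTensor R)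

/-- The `R`-linear extension of a `K`-linear 2-category. -/
instance : Bicategory (ScalarExt K R C) where
  whiskerLeft f _ _ τ := wLeft f τ
  whiskerRight τ h := wRight τ h
  associator f g h := inclIso (α_ f.as g.as h.as)
  leftUnitor f := inclIso (λ_ f.as)
  rightUnitor f := inclIso (ρ_ f.as)
  whiskerLeft_id f g := by
    rw [id_eq_cell, wLeft_cell]; simp; rfl
  whiskerLeft_comp {X Y Z} f {g h i} η θ := by
    induction η using cell_induction with
    | zero => simp only [zero_comp, wLeft_zero]
    | add σ τ hσ hτ => simp only [add_comp, wLeft_add, hσ, hτ]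
    | tmul r η =>
      induction θ using cell_induction with
      | zero => simp only [comp_zero, wLeft_zero]
      | add σ τ hσ hτ => simp only [comp_add, wLeft_add, hσ, hτ]
      | tmul s θ => simp only [cell_comp_cell, wLeft_cell, Bicategory.whiskerLeft_comp]
  id_whiskerLeft {X Y f g} η := by
    induction η using cell_induction with
    | zero => simp only [comp_zero, zero_comp, wLeft_zero]
    | add σ τ hσ hτ => simp only [comp_add, add_comp, wLeft_add, hσ, hτ]
    | tmul r η =>
      simp only [inclIso, incl, cell_comp_cell, wLeft_cell, mul_one, one_mul]
      exact congrArg (cell r) (Bicategory.id_whiskerLeft η)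
  comp_whiskerLeft {W X Y Z} f g {h i} η := by
    induction η using cell_induction with
    | zero => simp only [comp_zero, zero_comp, wLeft_zero]
    | add σ τ hσ hτ => simp only [comp_add, add_comp, wLeft_add, hσ, hτ]
    | tmul r η =>
      simp only [inclIso, incl, cell_comp_cell, wLeft_cell, mul_one, one_mul]
      exact congrArg (cell r) (Bicategory.comp_whiskerLeft f.as g.as η)
  id_whiskerRight f g := by
    rw [id_eq_cell, cell_wRight]; simp; rfl
  comp_whiskerRight {X Y Z f g h} η θ i := by
    induction η using cell_induction with
    | zero => simp only [zero_comp, wRight_zero]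
    | add σ τ hσ hτ => simp only [add_comp, wRight_add, hσ, hτ]
    | tmul r η =>
      induction θ using cell_induction with
      | zero => simp only [comp_zero, wRight_zero]
      | add σ τ hσ hτ => simp only [comp_add, wRight_add, hσ, hτ]
      | tmul s θ => simp only [cell_comp_cell, cell_wRight, Bicategory.comp_whiskerRight]
  whiskerRight_id {X Y f g} η := by
    induction η using cell_induction with
    | zero => simp only [comp_zero, zero_comp, wRight_zero]
    | add σ τ hσ hτ => simp only [comp_add, add_comp, wRight_add, hσ, hτ]
    | tmul r η =>
      simp only [inclIso, incl, cell_comp_cell, cell_wRight, mul_one, one_mul]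
      exact congrArg (cell r) (Bicategory.whiskerRight_id η)
  whiskerRight_comp {W X Y Z f f'} η g h := by
    induction η using cell_induction with
    | zero => simp only [comp_zero, zero_comp, wRight_zero]
    | add σ τ hσ hτ => simp only [comp_add, add_comp, wRight_add, hσ, hτ]
    | tmul r η =>
      simp only [inclIso, incl, cell_comp_cell, cell_wRight, mul_one, one_mul]
      exact congrArg (cell r) (Bicategory.whiskerRight_comp η g.as h.as)
  whisker_assoc {W X Y Z} f {g i} η h := by
    induction η using cell_induction with
    | zero => simp only [comp_zero, zero_comp, wLeft_zero, wRight_zero]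
    | add σ τ hσ hτ => simp only [comp_add, add_comp, wLeft_add, wRight_add, hσ, hτ]
    | tmul r η =>
      simp only [inclIso, incl, cell_comp_cell, wLeft_cell, cell_wRight, mul_one, one_mul]
      exact congrArg (cell r) (Bicategory.whisker_assoc f.as η h.as)
  whisker_exchange {X Y Z f g h i} η θ := by
    induction η using cell_induction with
    | zero => simp only [comp_zero, zero_comp, wRight_zero]
    | add σ τ hσ hτ => simp only [comp_add, add_comp, wRight_add, hσ, hτ]
    | tmul r η =>
      induction θ using cell_induction with
      | zero => simp only [comp_zero, zero_comp, wLeft_zero]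
      | add σ τ hσ hτ => simp only [comp_add, add_comp, wLeft_add, hσ, hτ]
      | tmul s θ =>
        simp only [cell_comp_cell, wLeft_cell, cell_wRight, mul_comm s r]
        exact congrArg (cell (r * s)) (Bicategory.whisker_exchange η θ)
  pentagon f g h i := by
    simp only [inclIso, incl, cell_comp_cell, wLeft_cell, cell_wRight, mul_one]
    exact congrArg (cell 1) (Bicategory.pentagon f.as g.as h.as i.as)
  triangle f g := by
    simp only [inclIso, incl, cell_comp_cell, wLeft_cell, cell_wRight, mul_one]
    exact congrArg (cell 1) (Bicategory.triangle f.as g.as)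

/-- The inclusion of a 2-cell that is an equality of 1-cells. -/
theorem inclIso_eqToIso {X Y : ScalarExt K R C} {f g : X ⟶ Y} (h : f.as = g.as) (h' : f = g) :
    (inclIso (eqToIso h) : f ≅ g) = eqToIso h' := by
  subst h'; ext; rfl

/-- The extension of a 2-category is a 2-category. -/
instance [Bicategory.Strict C] : Bicategory.Strict (ScalarExt K R C) where
  id_comp f := congrArg Hom₁.mk (Bicategory.Strict.id_comp f.as)
  comp_id f := congrArg Hom₁.mk (Bicategory.Strict.comp_id f.as)
  assoc f g h := congrArg Hom₁.mk (Bicategory.Strict.assoc f.as g.as h.as)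
  leftUnitor_eqToIso f :=
    (congrArg inclIso (Bicategory.Strict.leftUnitor_eqToIso f.as)).trans (inclIso_eqToIso _ _)
  rightUnitor_eqToIso f :=
    (congrArg inclIso (Bicategory.Strict.rightUnitor_eqToIso f.as)).trans (inclIso_eqToIso _ _)
  associator_eqToIso f g h :=
    (congrArg inclIso (Bicategory.Strict.associator_eqToIso f.as g.as h.as)).trans
      (inclIso_eqToIso _ _)

end ScalarExt

end Extension

/-! ### Semigroupal structures on a 2-category

Composition of 1-cells is written in diagrammatic order: `f ≫ g` is `g ∘ f`. The associativity and
unit 2-cells of the bicategory (identities, when it is a 2-category) are inserted by `⊗≫`. -/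

/-- The part of a semigroupal structure that lives on objects and 1-cells, together with the action
of the tensor product on 2-cells: the tensor product of objects, the functors
`⊗ : C(X, X') × C(Y, Y') ⥤ C(X ⊗ Y, X' ⊗ Y')`, and the 1-isomorphisms
`a_{X,Y,Z} : X ⊗ (Y ⊗ Z) ⟶ (X ⊗ Y) ⊗ Z`. -/
structure TensorCore (C : Type u) [Bicategory.{w, v} C] where
  obj : C → C → C
  map : ∀ {X X' Y Y' : C}, (X ⟶ X') → (Y ⟶ Y') → (obj X Y ⟶ obj X' Y')
  map₂ : ∀ {X X' Y Y' : C} {f f' : X ⟶ X'} {g g' : Y ⟶ Y'},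
    (f ⟶ f') → (g ⟶ g') → (map f g ⟶ map f' g')
  map₂_id : ∀ {X X' Y Y' : C} (f : X ⟶ X') (g : Y ⟶ Y'), map₂ (𝟙 f) (𝟙 g) = 𝟙 (map f g)
  map₂_comp : ∀ {X X' Y Y' : C} {f f' f'' : X ⟶ X'} {g g' g'' : Y ⟶ Y'}
    (τ : f ⟶ f') (τ' : f' ⟶ f'') (σ : g ⟶ g') (σ' : g' ⟶ g''),
    map₂ (τ ≫ τ') (σ ≫ σ') = map₂ τ σ ≫ map₂ τ' σ'
  a : ∀ X Y Z : C, obj X (obj Y Z) ⟶ obj (obj X Y) Z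
  a_invertible : ∀ X Y Z : C, ∃ b : obj (obj X Y) Z ⟶ obj X (obj Y Z),
    a X Y Z ≫ b = 𝟙 _ ∧ b ≫ a X Y Z = 𝟙 _

namespace TensorCore

variable {C : Type u} [Bicategory.{w, v} C] (P : TensorCore C)

/-- The tensor product of invertible 2-cells. -/
@[simps]
def map₂Iso {X X' Y Y' : C} {f f' : X ⟶ X'} {g g' : Y ⟶ Y'} (τ : f ≅ f') (σ : g ≅ g') :
    P.map f g ≅ P.map f' g' where
  hom := P.map₂ τ.hom σ.hom
  inv := P.map₂ τ.inv σ.inv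
  hom_inv_id := by rw [← P.map₂_comp, τ.hom_inv_id, σ.hom_inv_id, P.map₂_id]
  inv_hom_id := by rw [← P.map₂_comp, τ.inv_hom_id, σ.inv_hom_id, P.map₂_id]

end TensorCore

/-- The horizontal composite of two 2-cells. -/
def hcomp {C : Type u} [Bicategory.{w, v} C] {X Y Z : C} {f f' : X ⟶ Y} {g g' : Y ⟶ Z}
    (τ : f ⟶ f') (σ : g ⟶ g') : f ≫ g ⟶ f' ≫ g' :=
  τ ▷ g ≫ f' ◁ σ

/-- The 2-cell `𝟙 ≫ f ≅ f ≫ 𝟙`, an identity in a 2-category. -/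
def idComm {C : Type u} [Bicategory.{w, v} C] {X Y : C} (f : X ⟶ Y) : 𝟙 X ≫ f ≅ f ≫ 𝟙 Y :=
  λ_ f ≪≫ (ρ_ f).symm

/-- A pseudofunctorial structure on the tensor product: invertible 2-cells
`⊗̂((f', g'), (f, g)) : (f' ⊗ g') ∘ (f ⊗ g) ⟹ (f' ∘ f) ⊗ (g' ∘ g)` and
`⊗₀(X, Y) : id_X ⊗ id_Y ⟹ id_{X ⊗ Y}` satisfying the axioms of a pseudofunctor. -/
structure TensorPseudofunctor {C : Type u} [Bicategory.{w, v} C] (P : TensorCore C) where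
  tensorator : ∀ {X X' X'' Y Y' Y'' : C} (f : X ⟶ X') (g : Y ⟶ Y') (f' : X' ⟶ X'')
    (g' : Y' ⟶ Y''), P.map f g ≫ P.map f' g' ≅ P.map (f ≫ f') (g ≫ g')
  unit : ∀ X Y : C, P.map (𝟙 X) (𝟙 Y) ≅ 𝟙 (P.obj X Y)
  tensorator_natural : ∀ {X X' X'' Y Y' Y'' : C} {f₁ f₂ : X ⟶ X'} {g₁ g₂ : Y ⟶ Y'}
    {f'₁ f'₂ : X' ⟶ X''} {g'₁ g'₂ : Y' ⟶ Y''} (τ : f₁ ⟶ f₂) (σ : g₁ ⟶ g₂)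
    (τ' : f'₁ ⟶ f'₂) (σ' : g'₁ ⟶ g'₂),
    (tensorator f₁ g₁ f'₁ g'₁).hom ≫ P.map₂ (hcomp τ τ') (hcomp σ σ') =
      hcomp (P.map₂ τ σ) (P.map₂ τ' σ') ≫ (tensorator f₂ g₂ f'₂ g'₂).hom
  tensorator_assoc : ∀ {X X' X'' X''' Y Y' Y'' Y''' : C} (f : X ⟶ X') (g : Y ⟶ Y')
    (f' : X' ⟶ X'') (g' : Y' ⟶ Y'') (f'' : X'' ⟶ X''') (g'' : Y'' ⟶ Y'''),
    (tensorator f g f' g').hom ▷ P.map f'' g'' ≫ (tensorator (f ≫ f') (g ≫ g') f'' g'').hom ≫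
        P.map₂ (α_ f f' f'').hom (α_ g g' g'').hom =
      (α_ _ _ _).hom ≫ P.map f g ◁ (tensorator f' g' f'' g'').hom ≫
        (tensorator f g (f' ≫ f'') (g' ≫ g'')).hom
  tensorator_id_left : ∀ {X X' Y Y' : C} (f : X ⟶ X') (g : Y ⟶ Y'),
    (tensorator (𝟙 X) (𝟙 Y) f g).hom ≫ P.map₂ (λ_ f).hom (λ_ g).hom =
      (unit X Y).hom ▷ P.map f g ≫ (λ_ _).hom
  tensorator_id_right : ∀ {X X' Y Y' : C} (f : X ⟶ X') (g : Y ⟶ Y'),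
    (tensorator f g (𝟙 X') (𝟙 Y')).hom ≫ P.map₂ (ρ_ f).hom (ρ_ g).hom =
      P.map f g ◁ (unit X' Y').hom ≫ (ρ_ _).hom

namespace TensorPseudofunctor

variable {C : Type u} [Bicategory.{w, v} C] {P : TensorCore C} (T : TensorPseudofunctor P)

/-- The tensor product of two squares, pasted with the 2-cells `⊗̂` so that it again is a square. -/
def square {X X₁ X₂ X' Y Y₁ Y₂ Y' : C} {p : X ⟶ X₁} {f' : X₁ ⟶ X'} {f : X ⟶ X₂} {q : X₂ ⟶ X'}
    {r : Y ⟶ Y₁} {g' : Y₁ ⟶ Y'} {g : Y ⟶ Y₂} {s : Y₂ ⟶ Y'}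
    (τ : p ≫ f' ⟶ f ≫ q) (σ : r ≫ g' ⟶ g ≫ s) :
    P.map p r ≫ P.map f' g' ⟶ P.map f g ≫ P.map q s :=
  (T.tensorator p r f' g').hom ≫ P.map₂ τ σ ≫ (T.tensorator f g q s).inv

/-- `(id_X ⊗ g') ∘ (id_X ⊗ g) ≅ id_X ⊗ (g' ∘ g)`. -/
def compL (X : C) {Y Y' Y'' : C} (g : Y ⟶ Y') (g' : Y' ⟶ Y'') :
    P.map (𝟙 X) g ≫ P.map (𝟙 X) g' ≅ P.map (𝟙 X) (g ≫ g') :=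
  T.tensorator (𝟙 X) g (𝟙 X) g' ≪≫ P.map₂Iso (λ_ (𝟙 X)) (Iso.refl _)

/-- The analogue of `compL` for three factors. -/
def compL₃ (X : C) {Y Y' Y'' Y''' : C} (g : Y ⟶ Y') (g' : Y' ⟶ Y'') (g'' : Y'' ⟶ Y''') :
    P.map (𝟙 X) g ≫ P.map (𝟙 X) g' ≫ P.map (𝟙 X) g'' ≅ P.map (𝟙 X) (g ≫ g' ≫ g'') :=
  whiskerLeftIso _ (T.compL X g' g'') ≪≫ T.compL X g (g' ≫ g'')

/-- `(f' ⊗ id_Y) ∘ (f ⊗ id_Y) ≅ (f' ∘ f) ⊗ id_Y`. -/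
def compR {X X' X'' : C} (f : X ⟶ X') (f' : X' ⟶ X'') (Y : C) :
    P.map f (𝟙 Y) ≫ P.map f' (𝟙 Y) ≅ P.map (f ≫ f') (𝟙 Y) :=
  T.tensorator f (𝟙 Y) f' (𝟙 Y) ≪≫ P.map₂Iso (Iso.refl _) (λ_ (𝟙 Y))

/-- The analogue of `compR` for three factors. -/
def compR₃ {X X' X'' X''' : C} (f : X ⟶ X') (f' : X' ⟶ X'') (f'' : X'' ⟶ X''') (Y : C) :
    P.map f (𝟙 Y) ≫ P.map f' (𝟙 Y) ≫ P.map f'' (𝟙 Y) ≅ P.map (f ≫ f' ≫ f'') (𝟙 Y) :=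
  whiskerLeftIso _ (T.compR f' f'' Y) ≪≫ T.compR f (f' ≫ f'') Y

end TensorPseudofunctor

/-- A semigroupal structure `(⊗, a, π)` with given tensor product functors and given 1-isomorphisms
`a_{X,Y,Z}`: a pseudofunctorial structure on `⊗`, the 2-cells
`â(f, g, h) : ((f ⊗ g) ⊗ h) ∘ a ⟹ a ∘ (f ⊗ (g ⊗ h))` making `a` a pseudonatural isomorphism, and
the pentagonator `π`, an invertible modification that satisfies the `K₅` coherence relation. -/
structure SemigroupalStructure {C : Type u} [Bicategory.{w, v} C] (P : TensorCore C)
    extends TensorPseudofunctor P where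
  aNat : ∀ {X X' Y Y' Z Z' : C} (f : X ⟶ X') (g : Y ⟶ Y') (h : Z ⟶ Z'),
    P.a X Y Z ≫ P.map (P.map f g) h ≅ P.map f (P.map g h) ≫ P.a X' Y' Z'
  pent : ∀ X Y Z T : C,
    P.map (𝟙 X) (P.a Y Z T) ≫ P.a X (P.obj Y Z) T ≫ P.map (P.a X Y Z) (𝟙 T) ≅
      P.a X Y (P.obj Z T) ≫ P.a (P.obj X Y) Z T
  aNat_natural : ∀ {X X' Y Y' Z Z' : C} {f₁ f₂ : X ⟶ X'} {g₁ g₂ : Y ⟶ Y'} {h₁ h₂ : Z ⟶ Z'}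
    (τ : f₁ ⟶ f₂) (σ : g₁ ⟶ g₂) (η : h₁ ⟶ h₂),
    (aNat f₁ g₁ h₁).hom ≫ P.map₂ τ (P.map₂ σ η) ▷ P.a X' Y' Z' =
      P.a X Y Z ◁ P.map₂ (P.map₂ τ σ) η ≫ (aNat f₂ g₂ h₂).hom
  aNat_comp : ∀ {X X' X'' Y Y' Y'' Z Z' Z'' : C} (f : X ⟶ X') (g : Y ⟶ Y') (h : Z ⟶ Z')
    (f' : X' ⟶ X'') (g' : Y' ⟶ Y'') (h' : Z' ⟶ Z''),
    P.a X Y Z ◁ (tensorator (P.map f g) h (P.map f' g') h').hom ≫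
        P.a X Y Z ◁ P.map₂ (tensorator f g f' g').hom (𝟙 (h ≫ h')) ≫
        (aNat (f ≫ f') (g ≫ g') (h ≫ h')).hom =
      (α_ _ _ _).inv ≫ (aNat f g h).hom ▷ P.map (P.map f' g') h' ≫ (α_ _ _ _).hom ≫
        P.map f (P.map g h) ◁ (aNat f' g' h').hom ≫ (α_ _ _ _).inv ≫
        (tensorator f (P.map g h) f' (P.map g' h')).hom ▷ P.a X'' Y'' Z'' ≫
        P.map₂ (𝟙 (f ≫ f')) (tensorator g h g' h').hom ▷ P.a X'' Y'' Z''
  aNat_id : ∀ X Y Z : C,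
    (aNat (𝟙 X) (𝟙 Y) (𝟙 Z)).hom ≫
        (P.map₂ (𝟙 (𝟙 X)) (unit Y Z).hom ≫ (unit X (P.obj Y Z)).hom) ▷ P.a X Y Z ≫ (λ_ _).hom =
      P.a X Y Z ◁ (P.map₂ (unit X Y).hom (𝟙 (𝟙 Z)) ≫ (unit (P.obj X Y) Z).hom) ≫ (ρ_ _).hom
  /-- `π` is a modification. -/
  pent_natural : ∀ {X X' Y Y' Z Z' T T' : C} (f : X ⟶ X') (g : Y ⟶ Y') (h : Z ⟶ Z') (k : T ⟶ T'),
    (pent X Y Z T).hom ▷ P.map (P.map (P.map f g) h) k ⊗≫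
        P.a X Y (P.obj Z T) ◁ (aNat (P.map f g) h k).hom ⊗≫
        (aNat f g (P.map h k)).hom ▷ P.a (P.obj X' Y') Z' T' ⊗≫ 𝟙 _ =
      𝟙 _ ⊗≫
        (P.map (𝟙 X) (P.a Y Z T) ≫ P.a X (P.obj Y Z) T) ◁
          toTensorPseudofunctor.square (aNat f g h).hom (idComm k).hom ⊗≫
        P.map (𝟙 X) (P.a Y Z T) ◁
          ((aNat f (P.map g h) k).hom ▷ P.map (P.a X' Y' Z') (𝟙 T')) ⊗≫
        toTensorPseudofunctor.square (idComm f).hom (aNat g h k).hom ▷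
          (P.a X' (P.obj Y' Z') T' ≫ P.map (P.a X' Y' Z') (𝟙 T')) ⊗≫
        P.map f (P.map g (P.map h k)) ◁ (pent X' Y' Z' T').hom
  /-- The `K₅` coherence relation. -/
  pent_coherence : ∀ X Y Z T U : C,
    𝟙 _ ⊗≫
        (P.map (𝟙 X) (P.map (𝟙 Y) (P.a Z T U)) ≫ P.map (𝟙 X) (P.a Y (P.obj Z T) U) ≫
          P.a X (P.obj Y (P.obj Z T)) U) ◁
            ((toTensorPseudofunctor.compR₃ _ _ _ U).hom ≫
              P.map₂ (pent X Y Z T).hom (𝟙 (𝟙 U)) ≫ (toTensorPseudofunctor.compR _ _ U).inv) ⊗≫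
        P.map (𝟙 X) (P.map (𝟙 Y) (P.a Z T U)) ◁
          ((pent X Y (P.obj Z T) U).hom ▷ P.map (P.a (P.obj X Y) Z T) (𝟙 U)) ⊗≫
        (aNat (𝟙 X) (𝟙 Y) (P.a Z T U)).inv ▷
          (P.a (P.obj X Y) (P.obj Z T) U ≫ P.map (P.a (P.obj X Y) Z T) (𝟙 U)) ⊗≫
        P.a X Y (P.obj Z (P.obj T U)) ◁ (P.map₂ (unit X Y).hom (𝟙 (P.a Z T U)) ▷
          (P.a (P.obj X Y) (P.obj Z T) U ≫ P.map (P.a (P.obj X Y) Z T) (𝟙 U))) ⊗≫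
        P.a X Y (P.obj Z (P.obj T U)) ◁ (pent (P.obj X Y) Z T U).hom =
      𝟙 (P.map (𝟙 X) (P.map (𝟙 Y) (P.a Z T U)) ≫ P.map (𝟙 X) (P.a Y (P.obj Z T) U) ≫
          P.a X (P.obj Y (P.obj Z T)) U ≫ P.map (P.map (𝟙 X) (P.a Y Z T)) (𝟙 U) ≫
          P.map (P.a X (P.obj Y Z) T) (𝟙 U) ≫ P.map (P.map (P.a X Y Z) (𝟙 T)) (𝟙 U)) ⊗≫
        (P.map (𝟙 X) (P.map (𝟙 Y) (P.a Z T U)) ≫ P.map (𝟙 X) (P.a Y (P.obj Z T) U)) ◁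
          ((aNat (𝟙 X) (P.a Y Z T) (𝟙 U)).hom ▷
            (P.map (P.a X (P.obj Y Z) T) (𝟙 U) ≫ P.map (P.map (P.a X Y Z) (𝟙 T)) (𝟙 U))) ⊗≫
        ((toTensorPseudofunctor.compL₃ X _ _ _).hom ≫ P.map₂ (𝟙 (𝟙 X)) (pent Y Z T U).hom ≫
            (toTensorPseudofunctor.compL X _ _).inv) ▷
          (P.a X (P.obj (P.obj Y Z) T) U ≫
            P.map (P.a X (P.obj Y Z) T) (𝟙 U) ≫ P.map (P.map (P.a X Y Z) (𝟙 T)) (𝟙 U)) ⊗≫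
        P.map (𝟙 X) (P.a Y Z (P.obj T U)) ◁
          ((pent X (P.obj Y Z) T U).hom ▷ P.map (P.map (P.a X Y Z) (𝟙 T)) (𝟙 U)) ⊗≫
        (P.map (𝟙 X) (P.a Y Z (P.obj T U)) ≫ P.a X (P.obj Y Z) (P.obj T U)) ◁
          ((aNat (P.a X Y Z) (𝟙 T) (𝟙 U)).hom ≫
            P.map₂ (𝟙 (P.a X Y Z)) (unit T U).hom ▷ P.a (P.obj (P.obj X Y) Z) T U) ⊗≫
        (pent X Y Z (P.obj T U)).hom ▷ P.a (P.obj (P.obj X Y) Z) T U ⊗≫ 𝟙 _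

/-- A semigroupal structure `(ψ, ω)` on the identity 2-functor of `C`, from the semigroupal structure
`S = (⊗, a, π)` to the semigroupal structure `S' = (⊗', a', π')`, with given 1-isomorphisms
`ψ_{X,Y} : X ⊗' Y ⟶ X ⊗ Y`: invertible 2-cells
`ψ̂(f, g) : (f ⊗ g) ∘ ψ_{X,Y} ⟹ ψ_{X',Y'} ∘ (f ⊗' g)` making `ψ` a pseudonatural isomorphism, and an
invertible modification `ω` satisfying the coherence relation with the pentagonators. -/
structure IdSemigroupalStructure {C : Type u} [Bicategory.{w, v} C] {P P' : TensorCore C}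
    (S : SemigroupalStructure P) (S' : SemigroupalStructure P')
    (ψ : ∀ X Y : C, P'.obj X Y ⟶ P.obj X Y) where
  ψ_invertible : ∀ X Y : C, ∃ b : P.obj X Y ⟶ P'.obj X Y, ψ X Y ≫ b = 𝟙 _ ∧ b ≫ ψ X Y = 𝟙 _
  ψNat : ∀ {X X' Y Y' : C} (f : X ⟶ X') (g : Y ⟶ Y'),
    ψ X Y ≫ P.map f g ≅ P'.map f g ≫ ψ X' Y'
  ω : ∀ X Y Z : C,
    P'.map (𝟙 X) (ψ Y Z) ≫ ψ X (P.obj Y Z) ≫ P.a X Y Z ≅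
      P'.a X Y Z ≫ P'.map (ψ X Y) (𝟙 Z) ≫ ψ (P.obj X Y) Z
  ψNat_natural : ∀ {X X' Y Y' : C} {f₁ f₂ : X ⟶ X'} {g₁ g₂ : Y ⟶ Y'} (τ : f₁ ⟶ f₂) (σ : g₁ ⟶ g₂),
    (ψNat f₁ g₁).hom ≫ P'.map₂ τ σ ▷ ψ X' Y' = ψ X Y ◁ P.map₂ τ σ ≫ (ψNat f₂ g₂).hom
  ψNat_comp : ∀ {X X' X'' Y Y' Y'' : C} (f : X ⟶ X') (g : Y ⟶ Y') (f' : X' ⟶ X'') (g' : Y' ⟶ Y''),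
    ψ X Y ◁ (S.tensorator f g f' g').hom ≫ (ψNat (f ≫ f') (g ≫ g')).hom =
      (α_ _ _ _).inv ≫ (ψNat f g).hom ▷ P.map f' g' ≫ (α_ _ _ _).hom ≫
        P'.map f g ◁ (ψNat f' g').hom ≫ (α_ _ _ _).inv ≫
        (S'.tensorator f g f' g').hom ▷ ψ X'' Y''
  ψNat_id : ∀ X Y : C,
    (ψNat (𝟙 X) (𝟙 Y)).hom ≫ (S'.unit X Y).hom ▷ ψ X Y ≫ (λ_ _).hom =
      ψ X Y ◁ (S.unit X Y).hom ≫ (ρ_ _).hom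
  /-- `ω` is a modification. -/
  ω_natural : ∀ {X X' Y Y' Z Z' : C} (f : X ⟶ X') (g : Y ⟶ Y') (h : Z ⟶ Z'),
    𝟙 _ ⊗≫
        (P'.map (𝟙 X) (ψ Y Z) ≫ ψ X (P.obj Y Z)) ◁ (S.aNat f g h).hom ⊗≫
        P'.map (𝟙 X) (ψ Y Z) ◁ ((ψNat f (P.map g h)).hom ▷ P.a X' Y' Z') ⊗≫
        S'.square (idComm f).hom (ψNat g h).hom ▷ (ψ X' (P.obj Y' Z') ≫ P.a X' Y' Z') ⊗≫
        P'.map f (P'.map g h) ◁ (ω X' Y' Z').hom =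
      (ω X Y Z).hom ▷ P.map (P.map f g) h ⊗≫
        (P'.a X Y Z ≫ P'.map (ψ X Y) (𝟙 Z)) ◁ (ψNat (P.map f g) h).hom ⊗≫
        P'.a X Y Z ◁ (S'.square (ψNat f g).hom (idComm h).hom ▷ ψ (P.obj X' Y') Z') ⊗≫
        (S'.aNat f g h).hom ▷ (P'.map (ψ X' Y') (𝟙 Z') ≫ ψ (P.obj X' Y') Z') ⊗≫ 𝟙 _
  /-- The coherence relation between `ω`, `π` and `π'`. -/
  ω_coherence : ∀ X Y Z T : C,
    𝟙 _ ⊗≫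
        (P'.map (𝟙 X) (P'.map (𝟙 Y) (ψ Z T)) ≫ P'.map (𝟙 X) (ψ Y (P.obj Z T)) ≫
          ψ X (P.obj Y (P.obj Z T))) ◁ (S.pent X Y Z T).hom ⊗≫
        P'.map (𝟙 X) (P'.map (𝟙 Y) (ψ Z T)) ◁
          ((ω X Y (P.obj Z T)).hom ▷ P.a (P.obj X Y) Z T) ⊗≫
        (S'.aNat (𝟙 X) (𝟙 Y) (ψ Z T)).inv ▷
          (P'.map (ψ X Y) (𝟙 (P.obj Z T)) ≫ ψ (P.obj X Y) (P.obj Z T) ≫ P.a (P.obj X Y) Z T) ⊗≫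
        P'.a X Y (P'.obj Z T) ◁
          (S'.square ((ψNat (𝟙 X) (𝟙 Y)).inv ≫ ψ X Y ◁ (S.unit X Y).hom)
              (ψ Z T ◁ (S.unit Z T).inv ≫ (ψNat (𝟙 Z) (𝟙 T)).hom) ▷
            (ψ (P.obj X Y) (P.obj Z T) ≫ P.a (P.obj X Y) Z T)) ⊗≫
        (P'.a X Y (P'.obj Z T) ≫ P'.map (ψ X Y) (P'.map (𝟙 Z) (𝟙 T))) ◁
          (ω (P.obj X Y) Z T).hom ⊗≫
        P'.a X Y (P'.obj Z T) ◁
          ((S'.aNat (ψ X Y) (𝟙 Z) (𝟙 T)).inv ▷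
            (P'.map (ψ (P.obj X Y) Z) (𝟙 T) ≫ ψ (P.obj (P.obj X Y) Z) T)) =
      𝟙 (P'.map (𝟙 X) (P'.map (𝟙 Y) (ψ Z T)) ≫ P'.map (𝟙 X) (ψ Y (P.obj Z T)) ≫
          ψ X (P.obj Y (P.obj Z T)) ≫ P.map (𝟙 X) (P.a Y Z T) ≫ P.a X (P.obj Y Z) T ≫
          P.map (P.a X Y Z) (𝟙 T)) ⊗≫
        (P'.map (𝟙 X) (P'.map (𝟙 Y) (ψ Z T)) ≫ P'.map (𝟙 X) (ψ Y (P.obj Z T))) ◁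
          ((ψNat (𝟙 X) (P.a Y Z T)).hom ▷ (P.a X (P.obj Y Z) T ≫ P.map (P.a X Y Z) (𝟙 T))) ⊗≫
        ((S'.compL₃ X _ _ _).hom ≫ P'.map₂ (𝟙 (𝟙 X)) (ω Y Z T).hom ≫ (S'.compL₃ X _ _ _).inv) ▷
          (ψ X (P.obj (P.obj Y Z) T) ≫ P.a X (P.obj Y Z) T ≫ P.map (P.a X Y Z) (𝟙 T)) ⊗≫
        (P'.map (𝟙 X) (P'.a Y Z T) ≫ P'.map (𝟙 X) (P'.map (ψ Y Z) (𝟙 T))) ◁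
          ((ω X (P.obj Y Z) T).hom ▷ P.map (P.a X Y Z) (𝟙 T)) ⊗≫
        P'.map (𝟙 X) (P'.a Y Z T) ◁
          ((S'.aNat (𝟙 X) (ψ Y Z) (𝟙 T)).inv ▷
            (P'.map (ψ X (P.obj Y Z)) (𝟙 T) ≫ ψ (P.obj X (P.obj Y Z)) T ≫
              P.map (P.a X Y Z) (𝟙 T))) ⊗≫
        (P'.map (𝟙 X) (P'.a Y Z T) ≫ P'.a X (P'.obj Y Z) T ≫
            P'.map (P'.map (𝟙 X) (ψ Y Z)) (𝟙 T) ≫ P'.map (ψ X (P.obj Y Z)) (𝟙 T)) ◁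
          (ψNat (P.a X Y Z) (𝟙 T)).hom ⊗≫
        (P'.map (𝟙 X) (P'.a Y Z T) ≫ P'.a X (P'.obj Y Z) T) ◁
          (((S'.compR₃ _ _ _ T).hom ≫ P'.map₂ (ω X Y Z).hom (𝟙 (𝟙 T)) ≫
              (S'.compR₃ _ _ _ T).inv) ▷ ψ (P.obj (P.obj X Y) Z) T) ⊗≫
        (S'.pent X Y Z T).hom ▷
          (P'.map (P'.map (ψ X Y) (𝟙 Z)) (𝟙 T) ≫ P'.map (ψ (P.obj X Y) Z) (𝟙 T) ≫
            ψ (P.obj (P.obj X Y) Z) T) ⊗≫ 𝟙 _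

/-! ### Linear tensor products and Gray semigroups -/

/-- `⊗` is `K`-bilinear on 2-cells. -/
class TensorCore.IsLinear (K : Type*) [CommRing K] {C : Type u} [Bicategory.{w, v} C]
    [∀ X Y : C, Preadditive (X ⟶ Y)] [∀ X Y : C, Linear K (X ⟶ Y)] (P : TensorCore C) : Prop where
  map₂_add_left : ∀ {X X' Y Y' : C} {f f' : X ⟶ X'} {g g' : Y ⟶ Y'} (τ τ' : f ⟶ f') (σ : g ⟶ g'),
    P.map₂ (τ + τ') σ = P.map₂ τ σ + P.map₂ τ' σ
  map₂_smul_left : ∀ {X X' Y Y' : C} {f f' : X ⟶ X'} {g g' : Y ⟶ Y'} (r : K) (τ : f ⟶ f')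
    (σ : g ⟶ g'), P.map₂ (r • τ) σ = r • P.map₂ τ σ
  map₂_add_right : ∀ {X X' Y Y' : C} {f f' : X ⟶ X'} {g g' : Y ⟶ Y'} (τ : f ⟶ f') (σ σ' : g ⟶ g'),
    P.map₂ τ (σ + σ') = P.map₂ τ σ + P.map₂ τ σ'
  map₂_smul_right : ∀ {X X' Y Y' : C} {f f' : X ⟶ X'} {g g' : Y ⟶ Y'} (r : K) (τ : f ⟶ f')
    (σ : g ⟶ g'), P.map₂ τ (r • σ) = r • P.map₂ τ σ

namespace TensorCore

variable {K : Type*} [CommRing K] {C : Type u} [Bicategory.{w, v} C]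
  [∀ X Y : C, Preadditive (X ⟶ Y)] [∀ X Y : C, Linear K (X ⟶ Y)] (P : TensorCore C) [P.IsLinear K]

/-- `⊗` on 2-cells, as a bilinear map. -/
def map₂ₗ {X X' Y Y' : C} (f f' : X ⟶ X') (g g' : Y ⟶ Y') :
    (f ⟶ f') →ₗ[K] (g ⟶ g') →ₗ[K] (P.map f g ⟶ P.map f' g') :=
  LinearMap.mk₂ K (fun τ σ => P.map₂ τ σ) (IsLinear.map₂_add_left K) IsLinear.map₂_smul_left
    (fun τ σ σ' => IsLinear.map₂_add_right K τ σ σ') IsLinear.map₂_smul_right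

variable [LinearBicategory K C]

open ScalarExt

/-- The `R`-bilinear extension of `⊗` on 2-cells: `(r ⊗ τ) ⊗ (s ⊗ σ) = (r * s) ⊗ (τ ⊗ σ)`. -/
def extMap₂ (R : Type*) [CommRing R] [Algebra K R] {X X' Y Y' : ScalarExt K R C} {f f' : X ⟶ X'}
    {g g' : Y ⟶ Y'} (τ : f ⟶ f') (σ : g ⟶ g') :
    R ⊗[K] (P.map f.as g.as ⟶ P.map f'.as g'.as) :=
  TensorProduct.map₂ (LinearMap.mul K R) (P.map₂ₗ f.as f'.as g.as g'.as) τ σ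

section

variable {R : Type*} [CommRing R] [Algebra K R] {X X' Y Y' : ScalarExt K R C} {f f' f'' : X ⟶ X'}
  {g g' g'' : Y ⟶ Y'}

theorem extMap₂_cell (r s : R) (τ : f.as ⟶ f'.as) (σ : g.as ⟶ g'.as) :
    P.extMap₂ R (cell r τ : f ⟶ f') (cell s σ : g ⟶ g') = (r * s) ⊗ₜ[K] P.map₂ τ σ := rfl

theorem extMap₂_add_left (τ τ' : f ⟶ f') (σ : g ⟶ g') :
    P.extMap₂ R (τ + τ') σ = P.extMap₂ R τ σ + P.extMap₂ R τ' σ :=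
  LinearMap.map_add₂ (TensorProduct.map₂ (LinearMap.mul K R) (P.map₂ₗ f.as f'.as g.as g'.as)) τ τ' σ

theorem extMap₂_add_right (τ : f ⟶ f') (σ σ' : g ⟶ g') :
    P.extMap₂ R τ (σ + σ') = P.extMap₂ R τ σ + P.extMap₂ R τ σ' :=
  map_add (TensorProduct.map₂ (LinearMap.mul K R) (P.map₂ₗ f.as f'.as g.as g'.as) τ) σ σ'

theorem extMap₂_zero_left (σ : g ⟶ g') : P.extMap₂ R (0 : f ⟶ f') σ = 0 :=
  LinearMap.map_zero₂ (TensorProduct.map₂ (LinearMap.mul K R) (P.map₂ₗ f.as f'.as g.as g'.as)) σ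

theorem extMap₂_zero_right (τ : f ⟶ f') : P.extMap₂ R τ (0 : g ⟶ g') = 0 :=
  map_zero (TensorProduct.map₂ (LinearMap.mul K R) (P.map₂ₗ f.as f'.as g.as g'.as) τ)

end

/-- The `R`-linear extension of the tensor product: `⊗` is unchanged on objects and 1-cells, and it
is extended `R`-bilinearly on 2-cells. -/
def ext (K : Type*) [CommRing K] [∀ X Y : C, Linear K (X ⟶ Y)] [P.IsLinear K]
    [LinearBicategory K C] (R : Type*) [CommRing R] [Algebra K R] :
    TensorCore (ScalarExt K R C) where
  obj X Y := ⟨P.obj X.as Y.as⟩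
  map f g := ⟨P.map f.as g.as⟩
  map₂ τ σ := P.extMap₂ R τ σ
  map₂_id f g := by
    rw [id_eq_cell, id_eq_cell, extMap₂_cell, P.map₂_id, mul_one]; rfl
  map₂_comp {X X' Y Y' f f' f'' g g' g''} τ τ' σ σ' := by
    induction τ using cell_induction with
    | zero =>
      simp only [ScalarExt.zero_comp, extMap₂_zero_left]
    | add τ₁ τ₂ h₁ h₂ =>
      simp only [ScalarExt.add_comp, extMap₂_add_left, h₁, h₂]
      exact (ScalarExt.add_comp (f := ⟨P.map f.as g.as⟩) (g := ⟨P.map f'.as g'.as⟩) _ _ _).symm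
    | tmul r τ =>
    induction σ using cell_induction with
    | zero =>
      simp only [ScalarExt.zero_comp, extMap₂_zero_right]
    | add σ₁ σ₂ h₁ h₂ =>
      simp only [ScalarExt.add_comp, extMap₂_add_right, h₁, h₂]
      exact (ScalarExt.add_comp (f := ⟨P.map f.as g.as⟩) (g := ⟨P.map f'.as g'.as⟩) _ _ _).symm
    | tmul s σ =>
    induction τ' using cell_induction with
    | zero =>
      simp only [ScalarExt.comp_zero, extMap₂_zero_left]
    | add τ₁ τ₂ h₁ h₂ =>
      simp only [ScalarExt.comp_add, extMap₂_add_left, h₁, h₂]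
      exact (ScalarExt.comp_add (g := ⟨P.map f'.as g'.as⟩) (h := ⟨P.map f''.as g''.as⟩) _ _ _).symm
    | tmul r' τ' =>
    induction σ' using cell_induction with
    | zero =>
      simp only [ScalarExt.comp_zero, extMap₂_zero_right]
    | add σ₁ σ₂ h₁ h₂ =>
      simp only [ScalarExt.comp_add, extMap₂_add_right, h₁, h₂]
      exact (ScalarExt.comp_add (g := ⟨P.map f'.as g'.as⟩) (h := ⟨P.map f''.as g''.as⟩) _ _ _).symm
    | tmul s' σ' =>
      simp only [cell_comp_cell, extMap₂_cell, P.map₂_comp, mul_mul_mul_comm r r' s s']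
      rfl
  a X Y Z := ⟨P.a X.as Y.as Z.as⟩
  a_invertible X Y Z := by
    obtain ⟨b, h, h'⟩ := P.a_invertible X.as Y.as Z.as
    exact ⟨⟨b⟩, congrArg Hom₁.mk h, congrArg Hom₁.mk h'⟩

end TensorCore

/-- A semigroupal structure is that of a Gray semigroup: `⊗` is a cubical pseudofunctor, and all
the 1- and 2-cells in the associator and the pentagonator are identities. -/
structure SemigroupalStructure.IsGray {C : Type u} [Bicategory.{w, v} C] {P : TensorCore C}
    (S : SemigroupalStructure P) : Prop where
  unit : ∀ X Y : C, IsIdentity (S.unit X Y).hom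
  tensorator_left : ∀ {X X' X'' Y Y' : C} (f : X ⟶ X') (g : Y ⟶ Y') (f' : X' ⟶ X''),
    IsIdentity (S.tensorator f g f' (𝟙 Y')).hom
  tensorator_right : ∀ {X X' Y Y' Y'' : C} (g : Y ⟶ Y') (f : X ⟶ X') (g' : Y' ⟶ Y''),
    IsIdentity (S.tensorator (𝟙 X) g f g').hom
  a : ∀ X Y Z : C, IsIdentity (P.a X Y Z)
  aNat : ∀ {X X' Y Y' Z Z' : C} (f : X ⟶ X') (g : Y ⟶ Y') (h : Z ⟶ Z'),
    IsIdentity (S.aNat f g h).hom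
  pent : ∀ X Y Z T : C, IsIdentity (S.pent X Y Z T).hom

/-! ### Unitary tensorator-deformations and their `ψ`-equivalence -/

section Deformations

variable {K : Type*} [CommRing K] {C : Type u} [Bicategory.{w, v} C]
  [∀ X Y : C, Preadditive (X ⟶ Y)] [∀ X Y : C, Linear K (X ⟶ Y)] [LinearBicategory K C]
  {P : TensorCore C} [P.IsLinear K]

/-- A unitary tensorator-deformation over `R` of a Gray semigroup: a semigroupal structure on the
`R`-linear extension, with the same tensor product functors and the same 1-cells `a_{X,Y,Z}`, whose
tensorator agrees modulo `I` with that of the Gray semigroup, and whose other 2-cells are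
undeformed. -/
structure UnitaryTensoratorDeformation (S : SemigroupalStructure P) (R : Type*) [CommRing R]
    [Algebra K R] (I : Ideal R) extends SemigroupalStructure (P.ext K R) where
  tensorator_mod : ∀ {X X' X'' Y Y' Y'' : ScalarExt K R C} (f : X ⟶ X') (g : Y ⟶ Y')
    (f' : X' ⟶ X'') (g' : Y' ⟶ Y''),
    (tensorator f g f' g').hom - ScalarExt.incl (S.tensorator f.as g.as f'.as g'.as).hom ∈
      I • (⊤ : Submodule R _)
  unit_eq : ∀ X Y : ScalarExt K R C,
    (unit X Y).hom = ScalarExt.incl (S.unit X.as Y.as).hom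
  aNat_eq : ∀ {X X' Y Y' Z Z' : ScalarExt K R C} (f : X ⟶ X') (g : Y ⟶ Y') (h : Z ⟶ Z'),
    (aNat f g h).hom = ScalarExt.incl (S.aNat f.as g.as h.as).hom
  pent_eq : ∀ X Y Z T : ScalarExt K R C,
    (pent X Y Z T).hom = ScalarExt.incl (S.pent X.as Y.as Z.as T.as).hom

/-- `ψ`-equivalence of deformations: the identity 2-functor admits a semigroupal structure
`(ψ, ω)` from `D` to `D'` with `ψ_{X,Y} = id`, with `ψ̂(f, g)` equal to the identity 2-cell of
`f ⊗ g` modulo `I`, and with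
`ω_{X,Y,Z} = (⊗₀(X ⊗ Y, Z)⁻¹ ∘ 1_a) · (1_a ∘ ⊗₀(X, Y ⊗ Z))`. -/
def PsiEquivalent {S : SemigroupalStructure P} {R : Type*} [CommRing R] [Algebra K R] {I : Ideal R}
    (D D' : UnitaryTensoratorDeformation (K := K) S R I) : Prop :=
  ∃ E : IdSemigroupalStructure D.toSemigroupalStructure D'.toSemigroupalStructure
      (fun X Y => 𝟙 ((P.ext K R).obj X Y)),
    (∀ {X X' Y Y' : ScalarExt K R C} (f : X ⟶ X') (g : Y ⟶ Y'),
      (E.ψNat f g).hom - (idComm ((P.ext K R).map f g)).hom ∈ I • (⊤ : Submodule R _)) ∧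
    ∀ X Y Z : ScalarExt K R C,
      (E.ω X Y Z).hom =
        (D'.unit X ((P.ext K R).obj Y Z)).hom ▷ (𝟙 _ ≫ (P.ext K R).a X Y Z) ⊗≫
          (P.ext K R).a X Y Z ◁ ((D'.unit ((P.ext K R).obj X Y) Z).inv ▷ 𝟙 _)

/-- First order deformations: `R = K[ε]/(ε²)`, with the ideal `(ε)`. -/
abbrev FirstOrderDeformation (K : Type*) [CommRing K] [∀ X Y : C, Linear K (X ⟶ Y)]
    [LinearBicategory K C] [P.IsLinear K] (S : SemigroupalStructure P) :=
  UnitaryTensoratorDeformation (K := K) S (DualNumber K) (Ideal.span {DualNumber.eps})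

end Deformations

/-! ### The cochain complex and its second cohomology

The differential `δ_h` is that of the deformation complex `X(⊗)` of the pseudofunctor `⊗`, and
`δ_v` is the alternating sum obtained by tensoring two neighbouring arguments. The structural 2-cells
of `⊗`, and the 2-cells `â` (identities in a Gray semigroup), are inserted to make the sources and the
targets of the summands agree. -/

section Cohomology

variable {C : Type u} [Bicategory.{w, v} C]

/-- 1-cochains: 2-cells `φ(f, g) : f ⊗ g ⟹ f ⊗ g`. -/
abbrev Cochain₁ (P : TensorCore C) :=
  ∀ (X X' Y Y' : C) (f : X ⟶ X') (g : Y ⟶ Y'), P.map f g ⟶ P.map f g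

/-- 2-cochains: 2-cells `φ((f', g'), (f, g)) : (f' ⊗ g') ∘ (f ⊗ g) ⟹ (f' ∘ f) ⊗ (g' ∘ g)`. -/
abbrev Cochain₂ (P : TensorCore C) :=
  ∀ (X X' X'' Y Y' Y'' : C) (f : X ⟶ X') (g : Y ⟶ Y') (f' : X' ⟶ X'') (g' : Y' ⟶ Y''),
    P.map f g ≫ P.map f' g' ⟶ P.map (f ≫ f') (g ≫ g')

/-- 3-cochains: 2-cells
`(f'' ⊗ g'') ∘ (f' ⊗ g') ∘ (f ⊗ g) ⟹ (f'' ∘ f' ∘ f) ⊗ (g'' ∘ g' ∘ g)`. -/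
abbrev Cochain₃ (P : TensorCore C) :=
  ∀ (X X' X'' X''' Y Y' Y'' Y''' : C) (f : X ⟶ X') (g : Y ⟶ Y') (f' : X' ⟶ X'') (g' : Y' ⟶ Y'')
    (f'' : X'' ⟶ X''') (g'' : Y'' ⟶ Y'''),
    P.map f g ≫ P.map f' g' ≫ P.map f'' g'' ⟶ P.map (f ≫ f' ≫ f'') (g ≫ g' ≫ g'')

/-- Values of `δ_v` on 1-cochains: 2-cells `((f ⊗ g) ⊗ h) ∘ a ⟹ a ∘ (f ⊗ (g ⊗ h))`. -/
abbrev CochainV₁ (P : TensorCore C) :=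
  ∀ (X X' Y Y' Z Z' : C) (f : X ⟶ X') (g : Y ⟶ Y') (h : Z ⟶ Z'),
    P.a X Y Z ≫ P.map (P.map f g) h ⟶ P.map f (P.map g h) ≫ P.a X' Y' Z'

/-- Values of `δ_v` on 2-cochains: 2-cells
`((f' ⊗ g') ⊗ h') ∘ ((f ⊗ g) ⊗ h) ∘ a ⟹ a ∘ ((f' ∘ f) ⊗ ((g' ∘ g) ⊗ (h' ∘ h)))`. -/
abbrev CochainV₂ (P : TensorCore C) :=
  ∀ (X X' X'' Y Y' Y'' Z Z' Z'' : C) (f : X ⟶ X') (g : Y ⟶ Y') (h : Z ⟶ Z')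
    (f' : X' ⟶ X'') (g' : Y' ⟶ Y'') (h' : Z' ⟶ Z''),
    P.a X Y Z ≫ P.map (P.map f g) h ≫ P.map (P.map f' g') h' ⟶
      P.map (f ≫ f') (P.map (g ≫ g') (h ≫ h')) ≫ P.a X'' Y'' Z''

namespace SemigroupalStructure

variable (K : Type*) [CommRing K] [∀ X Y : C, Preadditive (X ⟶ Y)] [∀ X Y : C, Linear K (X ⟶ Y)]
  [LinearBicategory K C] {P : TensorCore C} [P.IsLinear K] (S : SemigroupalStructure P)

/-- `δ_h` on 1-cochains:
`(δ_h φ)((f',g'),(f,g)) = ⊗̂·(1 ∘ φ(f,g)) - φ(f'f, g'g)·⊗̂ + ⊗̂·(φ(f',g') ∘ 1)`. -/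
def deltaH₁ : Cochain₁ P →ₗ[K] Cochain₂ P where
  toFun φ X X' X'' Y Y' Y'' f g f' g' :=
    φ X X' Y Y' f g ▷ P.map f' g' ≫ (S.tensorator f g f' g').hom -
      (S.tensorator f g f' g').hom ≫ φ X X'' Y Y'' (f ≫ f') (g ≫ g') +
      P.map f g ◁ φ X' X'' Y' Y'' f' g' ≫ (S.tensorator f g f' g').hom
  map_add' φ φ' := by
    funext X X' X'' Y Y' Y'' f g f' g'
    simp only [Pi.add_apply, LinearBicategory.add_whiskerRight K, LinearBicategory.whiskerLeft_add K,
      Preadditive.add_comp, Preadditive.comp_add]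
    abel
  map_smul' r φ := by
    funext X X' X'' Y Y' Y'' f g f' g'
    simp only [Pi.smul_apply, LinearBicategory.smul_whiskerRight, LinearBicategory.whiskerLeft_smul,
      Linear.smul_comp, Linear.comp_smul, RingHom.id_apply, smul_add, smul_sub]

/-- `δ_h` on 2-cochains. -/
def deltaH₂ : Cochain₂ P →ₗ[K] Cochain₃ P where
  toFun φ X X' X'' X''' Y Y' Y'' Y''' f g f' g' f'' g'' :=
    (α_ _ _ _).inv ≫ φ X X' X'' Y Y' Y'' f g f' g' ▷ P.map f'' g'' ≫
        (S.tensorator (f ≫ f') (g ≫ g') f'' g'').hom ≫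
        P.map₂ (α_ f f' f'').hom (α_ g g' g'').hom -
      P.map f g ◁ (S.tensorator f' g' f'' g'').hom ≫
        φ X X' X''' Y Y' Y''' f g (f' ≫ f'') (g' ≫ g'') +
      (α_ _ _ _).inv ≫ (S.tensorator f g f' g').hom ▷ P.map f'' g'' ≫
        φ X X'' X''' Y Y'' Y''' (f ≫ f') (g ≫ g') f'' g'' ≫
        P.map₂ (α_ f f' f'').hom (α_ g g' g'').hom -
      P.map f g ◁ φ X' X'' X''' Y' Y'' Y''' f' g' f'' g'' ≫
        (S.tensorator f g (f' ≫ f'') (g' ≫ g'')).hom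
  map_add' φ φ' := by
    funext X X' X'' X''' Y Y' Y'' Y''' f g f' g' f'' g''
    simp only [Pi.add_apply, LinearBicategory.add_whiskerRight K, LinearBicategory.whiskerLeft_add K,
      Preadditive.add_comp, Preadditive.comp_add]
    abel
  map_smul' r φ := by
    funext X X' X'' X''' Y Y' Y'' Y''' f g f' g' f'' g''
    simp only [Pi.smul_apply, LinearBicategory.smul_whiskerRight, LinearBicategory.whiskerLeft_smul,
      Linear.smul_comp, Linear.comp_smul, RingHom.id_apply, smul_add, smul_sub]

/-- `δ_v` on 1-cochains:
`(δ_v φ)(f,g,h) = 1_f ⊗ φ(g,h) - φ(f ⊗ g, h) + φ(f, g ⊗ h) - φ(f,g) ⊗ 1_h`. -/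
def deltaV₁ : Cochain₁ P →ₗ[K] CochainV₁ P where
  toFun φ X X' Y Y' Z Z' f g h :=
    (S.aNat f g h).hom ≫ P.map₂ (𝟙 f) (φ Y Y' Z Z' g h) ▷ P.a X' Y' Z' -
      P.a X Y Z ◁ φ _ _ Z Z' (P.map f g) h ≫ (S.aNat f g h).hom +
      (S.aNat f g h).hom ≫ φ X X' _ _ f (P.map g h) ▷ P.a X' Y' Z' -
      P.a X Y Z ◁ P.map₂ (φ X X' Y Y' f g) (𝟙 h) ≫ (S.aNat f g h).hom
  map_add' φ φ' := by
    funext X X' Y Y' Z Z' f g h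
    simp only [Pi.add_apply, LinearBicategory.add_whiskerRight K, LinearBicategory.whiskerLeft_add K,
      Preadditive.add_comp, Preadditive.comp_add, TensorCore.IsLinear.map₂_add_left K,
      TensorCore.IsLinear.map₂_add_right K]
    abel
  map_smul' r φ := by
    funext X X' Y Y' Z Z' f g h
    simp only [Pi.smul_apply, LinearBicategory.smul_whiskerRight, LinearBicategory.whiskerLeft_smul,
      Linear.smul_comp, Linear.comp_smul, RingHom.id_apply, smul_add, smul_sub,
      TensorCore.IsLinear.map₂_smul_left, TensorCore.IsLinear.map₂_smul_right]

/-- The 2-cell `((f' ⊗ g') ⊗ h') ∘ ((f ⊗ g) ⊗ h) ∘ a ≅ a ∘ (f' ⊗ (g' ⊗ h')) ∘ (f ⊗ (g ⊗ h))`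
obtained from `â`. -/
def aNat₂ {X X' X'' Y Y' Y'' Z Z' Z'' : C} (f : X ⟶ X') (g : Y ⟶ Y') (h : Z ⟶ Z')
    (f' : X' ⟶ X'') (g' : Y' ⟶ Y'') (h' : Z' ⟶ Z'') :
    P.a X Y Z ≫ P.map (P.map f g) h ≫ P.map (P.map f' g') h' ⟶
      (P.map f (P.map g h) ≫ P.map f' (P.map g' h')) ≫ P.a X'' Y'' Z'' :=
  (α_ _ _ _).inv ≫ (S.aNat f g h).hom ▷ P.map (P.map f' g') h' ≫ (α_ _ _ _).hom ≫
    P.map f (P.map g h) ◁ (S.aNat f' g' h').hom ≫ (α_ _ _ _).inv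

/-- `δ_v` on 2-cochains: the alternating sum of
`1_{f'f} ⊗ φ((g',h'),(g,h))`, `φ((f' ⊗ g',h'),(f ⊗ g,h))`, `φ((f',g' ⊗ h'),(f,g ⊗ h))` and
`φ((f',g'),(f,g)) ⊗ 1_{h'h}`, each completed by the 2-cell `⊗̂` in the remaining arguments. -/
def deltaV₂ : Cochain₂ P →ₗ[K] CochainV₂ P where
  toFun φ X X' X'' Y Y' Y'' Z Z' Z'' f g h f' g' h' :=
    S.aNat₂ f g h f' g' h' ≫ (S.tensorator f (P.map g h) f' (P.map g' h')).hom ▷ P.a X'' Y'' Z'' ≫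
        P.map₂ (𝟙 (f ≫ f')) (φ Y Y' Y'' Z Z' Z'' g h g' h') ▷ P.a X'' Y'' Z'' -
      P.a X Y Z ◁ φ _ _ _ Z Z' Z'' (P.map f g) h (P.map f' g') h' ≫
        P.a X Y Z ◁ P.map₂ (S.tensorator f g f' g').hom (𝟙 (h ≫ h')) ≫
        (S.aNat (f ≫ f') (g ≫ g') (h ≫ h')).hom +
      S.aNat₂ f g h f' g' h' ≫ φ X X' X'' _ _ _ f (P.map g h) f' (P.map g' h') ▷ P.a X'' Y'' Z'' ≫
        P.map₂ (𝟙 (f ≫ f')) (S.tensorator g h g' h').hom ▷ P.a X'' Y'' Z'' -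
      P.a X Y Z ◁ (S.tensorator (P.map f g) h (P.map f' g') h').hom ≫
        P.a X Y Z ◁ P.map₂ (φ X X' X'' Y Y' Y'' f g f' g') (𝟙 (h ≫ h')) ≫
        (S.aNat (f ≫ f') (g ≫ g') (h ≫ h')).hom
  map_add' φ φ' := by
    funext X X' X'' Y Y' Y'' Z Z' Z'' f g h f' g' h'
    simp only [Pi.add_apply, LinearBicategory.add_whiskerRight K, LinearBicategory.whiskerLeft_add K,
      Preadditive.add_comp, Preadditive.comp_add, TensorCore.IsLinear.map₂_add_left K,
      TensorCore.IsLinear.map₂_add_right K]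
    abel
  map_smul' r φ := by
    funext X X' X'' Y Y' Y'' Z Z' Z'' f g h f' g' h'
    simp only [Pi.smul_apply, LinearBicategory.smul_whiskerRight, LinearBicategory.whiskerLeft_smul,
      Linear.smul_comp, Linear.comp_smul, RingHom.id_apply, smul_add, smul_sub,
      TensorCore.IsLinear.map₂_smul_left, TensorCore.IsLinear.map₂_smul_right]

/-- `X_s¹(⊗)`: 1-cochains that are natural in `(f, g)` and special, i.e. zero on pairs of identity
1-cells. -/
def special₁ (P : TensorCore C) : Submodule K (Cochain₁ P) where
  carrier := {φ |
    (∀ {X X' Y Y' : C} {f₁ f₂ : X ⟶ X'} {g₁ g₂ : Y ⟶ Y'} (τ : f₁ ⟶ f₂) (σ : g₁ ⟶ g₂),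
      φ X X' Y Y' f₁ g₁ ≫ P.map₂ τ σ = P.map₂ τ σ ≫ φ X X' Y Y' f₂ g₂) ∧
    ∀ X Y : C, φ X X Y Y (𝟙 X) (𝟙 Y) = 0}
  zero_mem' := by simp
  add_mem' {φ φ'} h h' := by
    refine ⟨fun τ σ => ?_, fun X Y => ?_⟩
    · simp only [Pi.add_apply, Preadditive.add_comp, Preadditive.comp_add, h.1, h'.1]
    · simp only [Pi.add_apply, h.2, h'.2, add_zero]
  smul_mem' r φ h := by
    refine ⟨fun τ σ => ?_, fun X Y => ?_⟩
    · simp only [Pi.smul_apply, Linear.smul_comp, Linear.comp_smul, h.1]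
    · simp only [Pi.smul_apply, h.2, smul_zero]

/-- `X_s²(⊗)`: 2-cochains that are natural in `((f', g'), (f, g))` and special, i.e. zero when
`(f, g)` or `(f', g')` is a pair of identity 1-cells. -/
def special₂ (P : TensorCore C) : Submodule K (Cochain₂ P) where
  carrier := {φ |
    (∀ {X X' X'' Y Y' Y'' : C} {f₁ f₂ : X ⟶ X'} {g₁ g₂ : Y ⟶ Y'} {f'₁ f'₂ : X' ⟶ X''}
      {g'₁ g'₂ : Y' ⟶ Y''} (τ : f₁ ⟶ f₂) (σ : g₁ ⟶ g₂) (τ' : f'₁ ⟶ f'₂) (σ' : g'₁ ⟶ g'₂),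
      φ X X' X'' Y Y' Y'' f₁ g₁ f'₁ g'₁ ≫ P.map₂ (hcomp τ τ') (hcomp σ σ') =
        hcomp (P.map₂ τ σ) (P.map₂ τ' σ') ≫ φ X X' X'' Y Y' Y'' f₂ g₂ f'₂ g'₂) ∧
    ∀ {X X' Y Y' : C} (f : X ⟶ X') (g : Y ⟶ Y'),
      φ X X X' Y Y Y' (𝟙 X) (𝟙 Y) f g = 0 ∧ φ X X' X' Y Y' Y' f g (𝟙 X') (𝟙 Y') = 0}
  zero_mem' := by simp
  add_mem' {φ φ'} h h' := by
    refine ⟨fun τ σ τ' σ' => ?_, fun f g => ?_⟩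
    · simp only [Pi.add_apply, Preadditive.add_comp, Preadditive.comp_add, h.1, h'.1]
    · simp only [Pi.add_apply, h.2, h'.2, add_zero, and_self]
  smul_mem' r φ h := by
    refine ⟨fun τ σ τ' σ' => ?_, fun f g => ?_⟩
    · simp only [Pi.smul_apply, Linear.smul_comp, Linear.comp_smul, h.1]
    · simp only [Pi.smul_apply, h.2, smul_zero, and_self]

/-- The 1-cochains of the unitary tensorator-deformation complex: the kernel of `δ_v` on
`X_s¹(⊗)`. -/
def Xtens₁ : Submodule K (Cochain₁ P) := special₁ K P ⊓ (S.deltaV₁ K).ker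

/-- The 2-cochains of the unitary tensorator-deformation complex: the kernel of `δ_v` on
`X_s²(⊗)`. -/
def Xtens₂ : Submodule K (Cochain₂ P) := special₂ K P ⊓ (S.deltaV₂ K).ker

/-- The 2-cocycles of the unitary tensorator-deformation complex. -/
def Z2tens : Submodule K (Cochain₂ P) := S.Xtens₂ K ⊓ (S.deltaH₂ K).ker

/-- The 2-coboundaries of the unitary tensorator-deformation complex. -/
def B2tens : Submodule K (Cochain₂ P) := (S.Xtens₁ K).map (S.deltaH₁ K)

/-- `H²_tens`, the second cohomology module of the unitary tensorator-deformation complex. -/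
abbrev H2tens := S.Z2tens K ⧸ (S.B2tens K).submoduleOf (S.Z2tens K)

end SemigroupalStructure

end Cohomology

/-! ### Identity 2-cells -/

namespace IsIdentity

section Category

variable {D : Type u} [Category.{v} D]

/-! Over the dual numbers every 2-cell is uniquely of the form a + bε with a and b 2-cells of `C`
(`exists_dualCell`, `dualCell_inj`), and composition, whiskering and ⊗ obey a Leibniz rule because
ε² = 0. An equation between deformed cells therefore splits into its reduction modulo ε, which is
the same axiom for the undeformed structure, and one linear condition on the coefficients of ε.

Apply this to a tensorator ⊗̂ + φε with all other cells undeformed. Naturality becomes naturality of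
φ, associativity becomes δ_h φ = 0, the unit axioms become vanishing of φ on pairs of identities,
and compatibility of â with composition becomes δ_v φ = 0 (`tensorator_natural_iff`,
`tensorator_assoc_iff`, `tensorator_id_left_iff`, `tensorator_id_right_iff`, `aNat_comp_iff`). These
are equivalences, so a deformation yields a cocycle (`cocycle_mem`) and a cocycle yields a
deformation (`ofCocycle`). Naturality of â follows from multilinearity (`aNat_natural_ext`). The
other axioms, namely the unit axiom of â, the modification property of π and the K₅ relation, impose
nothing: the tensorators in them have a pair of identities as an argument, where ⊗̂ is an identity
and φ is zero. Both sides are thus pasted from identities, and parallel identities are equal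
(`IsIdentity.unique`).

In the same way a ψ-equivalence is 1 + χε up to unitors. Naturality makes χ natural, the unit axiom
makes χ vanish on pairs of identities, the composition axiom reads δ_h χ = φ - φ', the modification
property of ω reads δ_v χ = 0, and the coherence of ω is automatic. So two deformations are
ψ-equivalent exactly when their cocycles differ by a coboundary (`psiEquivalent_iff`). The
equivalence relation and the bijection follow formally.

In a strict 2-category the boundaries of the cells to be compared are often equal only
propositionally. `CellEq` is an equality of 2-cells that ignores this, and identity cells can be
stripped under it. -/

theorem obj_eq {D : Type u} [CategoryStruct.{v} D] {X Y : D} {f : X ⟶ Y} (h : IsIdentity f) :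
    X = Y := by
  cases h; rfl

theorem heq_id {D : Type u} [CategoryStruct.{v} D] {X Y : D} {f : X ⟶ Y} (h : IsIdentity f) :
    HEq f (𝟙 X) := by
  cases h; rfl

/-- The boundary leaves no freedom to an identity. This settles every coherence relation whose two
sides are pasted from identities. -/
theorem unique {D : Type u} [CategoryStruct.{v} D] {X Y : D} {f g : X ⟶ Y} (hf : IsIdentity f)
    (hg : IsIdentity g) : f = g :=
  eq_of_heq (hf.heq_id.trans hg.heq_id.symm)

theorem comp {X Y Z : D} {f : X ⟶ Y} {g : Y ⟶ Z} (hf : IsIdentity f) (hg : IsIdentity g) :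
    IsIdentity (f ≫ g) := by
  cases hf; rwa [Category.id_comp]

theorem of_hom_inv {X Y : D} {f : X ⟶ Y} {g : Y ⟶ X} (hf : IsIdentity f) (h : f ≫ g = 𝟙 X) :
    IsIdentity g := by
  cases hf; rw [Category.id_comp] at h; subst h; exact .id X

theorem inv {X Y : D} {e : X ≅ Y} (he : IsIdentity e.hom) : IsIdentity e.inv :=
  he.of_hom_inv e.hom_inv_id

theorem eqToHom {X Y : D} (h : X = Y) : IsIdentity (CategoryTheory.eqToHom h) := by
  subst h; exact .id X

end Category

section Bicategory

variable {C : Type u} [Bicategory.{w, v} C]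

theorem whiskerLeft {X Y Z : C} (f : X ⟶ Y) {g h : Y ⟶ Z} {η : g ⟶ h} (hη : IsIdentity η) :
    IsIdentity (f ◁ η) := by
  cases hη; rw [Bicategory.whiskerLeft_id]; exact .id _

theorem whiskerRight {X Y Z : C} {f g : X ⟶ Y} {η : f ⟶ g} (hη : IsIdentity η) (h : Y ⟶ Z) :
    IsIdentity (η ▷ h) := by
  cases hη; rw [Bicategory.id_whiskerRight]; exact .id _

theorem map₂ (P : TensorCore C) {X X' Y Y' : C} {f f' : X ⟶ X'} {g g' : Y ⟶ Y'}
    {τ : f ⟶ f'} {σ : g ⟶ g'} (hτ : IsIdentity τ) (hσ : IsIdentity σ) :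
    IsIdentity (P.map₂ τ σ) := by
  cases hτ; cases hσ; rw [P.map₂_id]; exact .id _

variable [Bicategory.Strict C]

theorem associator_hom {W X Y Z : C} (f : W ⟶ X) (g : X ⟶ Y) (h : Y ⟶ Z) :
    IsIdentity (α_ f g h).hom := by
  rw [Bicategory.Strict.associator_eqToIso]; exact eqToHom (Bicategory.Strict.assoc f g h)

theorem leftUnitor_hom {X Y : C} (f : X ⟶ Y) : IsIdentity (λ_ f).hom := by
  rw [Bicategory.Strict.leftUnitor_eqToIso]; exact eqToHom (Bicategory.Strict.id_comp f)

theorem rightUnitor_hom {X Y : C} (f : X ⟶ Y) : IsIdentity (ρ_ f).hom := by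
  rw [Bicategory.Strict.rightUnitor_eqToIso]; exact eqToHom (Bicategory.Strict.comp_id f)

theorem idComm_hom {X Y : C} (f : X ⟶ Y) : IsIdentity (idComm f).hom :=
  (leftUnitor_hom f).comp (rightUnitor_hom f).inv

theorem comp₁ {X Y Z : C} {f : X ⟶ Y} {g : Y ⟶ Z} (hf : IsIdentity f) (hg : IsIdentity g) :
    IsIdentity (f ≫ g) := by
  cases hf; rwa [Bicategory.Strict.id_comp]

end Bicategory

end IsIdentity

/-- The structural 2-cell chosen by `⊗≫` is an identity. -/
class IsIdentityCoherence {C : Type u} [Bicategory.{w, v} C] {X Y : C} (f g : X ⟶ Y)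
    [BicategoricalCoherence f g] : Prop where
  hom : IsIdentity (BicategoricalCoherence.iso : f ≅ g).hom

namespace IsIdentityCoherence

variable {C : Type u} [Bicategory.{w, v} C] {W X Y Z : C}

/-- These instances follow the recursive shape of those of `BicategoricalCoherence`: the isomorphism
chosen by `⊗≫` is assembled from whiskerings, unitors and associators, and the last two are
identities in a strict bicategory. -/
instance refl (f : X ⟶ Y) : IsIdentityCoherence f f := ⟨.id f⟩

instance whiskerLeft (f : X ⟶ Y) (g h : Y ⟶ Z) [BicategoricalCoherence g h]
    [IsIdentityCoherence g h] : IsIdentityCoherence (f ≫ g) (f ≫ h) :=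
  ⟨.whiskerLeft f hom⟩

instance whiskerRight (f g : X ⟶ Y) (h : Y ⟶ Z) [BicategoricalCoherence f g]
    [IsIdentityCoherence f g] : IsIdentityCoherence (f ≫ h) (g ≫ h) :=
  ⟨.whiskerRight hom h⟩

variable [Bicategory.Strict C]

instance tensorRight (f : X ⟶ Y) (g : Y ⟶ Y) [BicategoricalCoherence (𝟙 Y) g]
    [IsIdentityCoherence (𝟙 Y) g] : IsIdentityCoherence f (f ≫ g) :=
  ⟨(IsIdentity.rightUnitor_hom f).inv.comp (.whiskerLeft f hom)⟩

instance left (f g : X ⟶ Y) [BicategoricalCoherence f g] [IsIdentityCoherence f g] :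
    IsIdentityCoherence (𝟙 X ≫ f) g :=
  ⟨.comp (.leftUnitor_hom f) hom⟩

instance left' (f g : X ⟶ Y) [BicategoricalCoherence f g] [IsIdentityCoherence f g] :
    IsIdentityCoherence f (𝟙 X ≫ g) :=
  ⟨.comp hom (IsIdentity.leftUnitor_hom g).inv⟩

instance assoc (f : W ⟶ X) (g : X ⟶ Y) (h : Y ⟶ Z) (i : W ⟶ Z)
    [BicategoricalCoherence (f ≫ g ≫ h) i] [IsIdentityCoherence (f ≫ g ≫ h) i] :
    IsIdentityCoherence ((f ≫ g) ≫ h) i :=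
  ⟨.comp (.associator_hom f g h) hom⟩

instance assoc' (f : W ⟶ X) (g : X ⟶ Y) (h : Y ⟶ Z) (i : W ⟶ Z)
    [BicategoricalCoherence i (f ≫ g ≫ h)] [IsIdentityCoherence i (f ≫ g ≫ h)] :
    IsIdentityCoherence i ((f ≫ g) ≫ h) :=
  ⟨.comp hom (IsIdentity.associator_hom f g h).inv⟩

end IsIdentityCoherence

theorem IsIdentity.bicategoricalComp {C : Type u} [Bicategory.{w, v} C] {X Y : C}
    {f g h i : X ⟶ Y} [BicategoricalCoherence g h] [IsIdentityCoherence g h] {η : f ⟶ g}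
    {θ : h ⟶ i} (hη : IsIdentity η) (hθ : IsIdentity θ) : IsIdentity (η ⊗≫ θ) :=
  hη.comp (IsIdentityCoherence.hom.comp hθ)

/-! ### Equality of 2-cells with possibly different boundaries -/

/-- Equality of 2-cells that are not syntactically parallel. -/
inductive CellEq {C : Type u} [Bicategory.{w, v} C] :
    ∀ {X Y X' Y' : C} {f g : X ⟶ Y} {f' g' : X' ⟶ Y'}, (f ⟶ g) → (f' ⟶ g') → Prop
  | refl {X Y : C} {f g : X ⟶ Y} (η : f ⟶ g) : CellEq η η

namespace CellEq

section

variable {C : Type u} [Bicategory.{w, v} C] {X Y X' Y' X'' Y'' : C} {f g h : X ⟶ Y}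
  {f' g' h' : X' ⟶ Y'} {f'' g'' : X'' ⟶ Y''}

theorem symm {η : f ⟶ g} {η' : f' ⟶ g'} (e : CellEq η η') : CellEq η' η := by
  cases e; exact .refl _

theorem trans {η : f ⟶ g} {η' : f' ⟶ g'} {η'' : f'' ⟶ g''} (e : CellEq η η')
    (e' : CellEq η' η'') : CellEq η η'' := by
  cases e; exact e'

theorem eq {η θ : f ⟶ g} (e : CellEq η θ) : η = θ := by
  cases e; rfl

theorem of_eq {η θ : f ⟶ g} (e : η = θ) : CellEq η θ := by
  subst e; exact .refl _

/-- Trades an equation between pasted cells for the equation between their stripped forms. -/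
theorem eq_iff {η θ : f ⟶ g} {η' θ' : f' ⟶ g'} (e : CellEq η η') (e' : CellEq θ θ') :
    η = θ ↔ η' = θ' :=
  ⟨fun h => ((e.symm.trans (.of_eq h)).trans e').eq, fun h => ((e.trans (.of_eq h)).trans e'.symm).eq⟩

theorem comp {η : f ⟶ g} {θ : g ⟶ h} {η' : f' ⟶ g'} {θ' : g' ⟶ h'} (e : CellEq η η')
    (e' : CellEq θ θ') : CellEq (η ≫ θ) (η' ≫ θ') := by
  cases e; cases e'; exact .refl _

theorem of_comp_left {ι : f ⟶ g} {η : g ⟶ h} {η' : f' ⟶ g'} (hι : IsIdentity ι)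
    (e : CellEq η η') : CellEq (ι ≫ η) η' := by
  cases hι; rwa [Category.id_comp]

theorem of_comp_right {ι : g ⟶ h} {η : f ⟶ g} {η' : f' ⟶ g'} (hι : IsIdentity ι)
    (e : CellEq η η') : CellEq (η ≫ ι) η' := by
  cases hι; rwa [Category.comp_id]

theorem of_isIdentity {ι : f ⟶ g} (hι : IsIdentity ι) : CellEq ι (𝟙 f) := by
  cases hι; exact .refl _

theorem of_isIdentity' {ι : f ⟶ g} (hι : IsIdentity ι) : CellEq ι (𝟙 g) := by
  cases hι; exact .refl _

theorem whiskerLeft {Z : C} (k : Z ⟶ X) {f' g' : X ⟶ Y} {η : f ⟶ g} {η' : f' ⟶ g'}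
    (e : CellEq η η') : CellEq (k ◁ η) (k ◁ η') := by
  cases e; exact .refl _

theorem whiskerRight {Z : C} {f' g' : X ⟶ Y} {η : f ⟶ g} {η' : f' ⟶ g'}
    (e : CellEq η η') (k : Y ⟶ Z) : CellEq (η ▷ k) (η' ▷ k) := by
  cases e; exact .refl _

theorem map₂ (P : TensorCore C) {X X' Y Y' : C} {f f' h h' : X ⟶ X'} {g g' k k' : Y ⟶ Y'}
    {τ : f ⟶ f'} {σ : g ⟶ g'} {τ' : h ⟶ h'} {σ' : k ⟶ k'} (e : CellEq τ τ')
    (e' : CellEq σ σ') : CellEq (P.map₂ τ σ) (P.map₂ τ' σ') := by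
  cases e; cases e'; exact .refl _

/-- Whiskering with an identity 1-cell conjugates by left unitors, and these are identities by
strictness. -/
theorem of_whiskerLeft [Bicategory.Strict C] {k : X' ⟶ X} (hk : IsIdentity k) {η : f ⟶ g}
    {η' : f'' ⟶ g''} (e : CellEq η η') : CellEq (k ◁ η) η' := by
  cases hk
  rw [Bicategory.id_whiskerLeft]
  exact of_comp_left (.leftUnitor_hom f) (of_comp_right (IsIdentity.leftUnitor_hom g).inv e)

theorem of_whiskerRight [Bicategory.Strict C] {k : Y ⟶ X'} (hk : IsIdentity k) {η : f ⟶ g}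
    {η' : f'' ⟶ g''} (e : CellEq η η') : CellEq (η ▷ k) η' := by
  cases hk
  rw [Bicategory.whiskerRight_id]
  exact of_comp_left (.rightUnitor_hom f) (of_comp_right (IsIdentity.rightUnitor_hom g).inv e)

section

variable {i : X ⟶ Y} [BicategoricalCoherence g h] [IsIdentityCoherence g h]

theorem bicategoricalComp {η : f ⟶ g} {θ : h ⟶ i} {η' : f' ⟶ g'} {θ' : g' ⟶ h'}
    (e : CellEq η η') (e' : CellEq θ θ') : CellEq (η ⊗≫ θ) (η' ≫ θ') :=
  e.comp (of_comp_left IsIdentityCoherence.hom e')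

theorem of_bicategoricalComp_left {ι : f ⟶ g} {η : h ⟶ i} {η' : f' ⟶ g'} (hι : IsIdentity ι)
    (e : CellEq η η') : CellEq (ι ⊗≫ η) η' :=
  of_comp_left hι (of_comp_left IsIdentityCoherence.hom e)

theorem of_bicategoricalComp_right {ι : h ⟶ i} {η : f ⟶ g} {η' : f' ⟶ g'} (hι : IsIdentity ι)
    (e : CellEq η η') : CellEq (η ⊗≫ ι) η' :=
  of_comp_right (IsIdentityCoherence.hom.comp hι) e

end

end

section

variable {C : Type u} [Bicategory.{w, v} C] [∀ X Y : C, Preadditive (X ⟶ Y)]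
  {X Y X' Y' : C} {f g : X ⟶ Y} {f' g' : X' ⟶ Y'}

theorem add {η θ : f ⟶ g} {η' θ' : f' ⟶ g'} (e : CellEq η η') (e' : CellEq θ θ') :
    CellEq (η + θ) (η' + θ') := by
  cases e; cases e'; exact .refl _

end

end CellEq

/-! ### 2-cells over the dual numbers -/

namespace ScalarExt

section

variable {K : Type*} [CommRing K] {C : Type u} [Bicategory.{w, v} C]
  [∀ X Y : C, Preadditive (X ⟶ Y)] [∀ X Y : C, Linear K (X ⟶ Y)]
  {X Y : ScalarExt K (DualNumber K) C} {f g h : X ⟶ Y}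

/-- The 2-cell `a + b ε`. -/
def dualCell {X Y : ScalarExt K (DualNumber K) C} {f g : X ⟶ Y} (a b : f.as ⟶ g.as) : f ⟶ g :=
  cell 1 a + cell DualNumber.eps b

theorem cell_zero {R : Type*} [CommRing R] [Algebra K R] {X Y : ScalarExt K R C} {f g : X ⟶ Y}
    (r : R) : (cell r 0 : f ⟶ g) = 0 :=
  TensorProduct.tmul_zero _ r

theorem cell_add {R : Type*} [CommRing R] [Algebra K R] {X Y : ScalarExt K R C} {f g : X ⟶ Y}
    (r : R) (a b : f.as ⟶ g.as) : (cell r (a + b) : f ⟶ g) = cell r a + cell r b :=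
  TensorProduct.tmul_add r a b

theorem zero_cell {R : Type*} [CommRing R] [Algebra K R] {X Y : ScalarExt K R C} {f g : X ⟶ Y}
    (a : f.as ⟶ g.as) : (cell (0 : R) a : f ⟶ g) = 0 :=
  TensorProduct.zero_tmul _ a

theorem incl_eq_dualCell (a : f.as ⟶ g.as) : (incl a : f ⟶ g) = dualCell a 0 := by
  rw [dualCell, cell_zero, add_zero, incl]

theorem id_eq_dualCell (f : X ⟶ Y) : 𝟙 f = dualCell (𝟙 f.as) 0 :=
  incl_eq_dualCell _

theorem dualCell_add (a b a' b' : f.as ⟶ g.as) :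
    (dualCell a b : f ⟶ g) + dualCell a' b' = dualCell (a + a') (b + b') := by
  simp only [dualCell, cell_add]; abel

theorem dualCell_comp (a b : f.as ⟶ g.as) (c d : g.as ⟶ h.as) :
    (dualCell a b : f ⟶ g) ≫ (dualCell c d : g ⟶ h) =
      dualCell (a ≫ c) (a ≫ d + b ≫ c) := by
  simp only [dualCell, add_comp, comp_add, cell_comp_cell, mul_one, one_mul,
    DualNumber.eps_mul_eps, zero_cell, cell_add, add_zero]
  abel

theorem dualCell_zero_comp (a : f.as ⟶ g.as) (c d : g.as ⟶ h.as) :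
    (dualCell a 0 : f ⟶ g) ≫ (dualCell c d : g ⟶ h) = dualCell (a ≫ c) (a ≫ d) := by
  rw [dualCell_comp, Limits.zero_comp, _root_.add_zero]

theorem dualCell_comp_zero (a b : f.as ⟶ g.as) (c : g.as ⟶ h.as) :
    (dualCell a b : f ⟶ g) ≫ (dualCell c 0 : g ⟶ h) = dualCell (a ≫ c) (b ≫ c) := by
  rw [dualCell_comp, Limits.comp_zero, _root_.zero_add]

/-- The coefficient of `1` or of `ε` in a 2-cell over the dual numbers. -/
def coeff (p : DualNumber K →ₗ[K] K) (τ : f ⟶ g) : f.as ⟶ g.as :=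
  TensorProduct.lid K (f.as ⟶ g.as) (p.rTensor (f.as ⟶ g.as) τ)

theorem coeff_add (p : DualNumber K →ₗ[K] K) (σ τ : f ⟶ g) :
    coeff p (σ + τ) = coeff p σ + coeff p τ :=
  map_add ((TensorProduct.lid K (f.as ⟶ g.as)).toLinearMap ∘ₗ p.rTensor (f.as ⟶ g.as)) σ τ

theorem coeff_cell (p : DualNumber K →ₗ[K] K) (r : DualNumber K) (a : f.as ⟶ g.as) :
    coeff p (cell r a : f ⟶ g) = p r • a := by
  simp [coeff, cell]

theorem coeff_fst_dualCell (a b : f.as ⟶ g.as) :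
    coeff (TrivSqZeroExt.fstHom K K K).toLinearMap (dualCell a b : f ⟶ g) = a := by
  rw [dualCell, coeff_add, coeff_cell, coeff_cell]; simp

theorem coeff_snd_dualCell (a b : f.as ⟶ g.as) :
    coeff (TrivSqZeroExt.sndHom K K) (dualCell a b : f ⟶ g) = b := by
  rw [dualCell, coeff_add, coeff_cell, coeff_cell]; simp

/-- The two coordinate projections of K[ε] are K-linear, so after tensoring with the module of
2-cells they recover both coefficients. No freeness or flatness of that module is needed. -/
theorem dualCell_inj {a b a' b' : f.as ⟶ g.as} :
    (dualCell a b : f ⟶ g) = dualCell a' b' ↔ a = a' ∧ b = b' := by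
  refine ⟨fun h => ⟨?_, ?_⟩, fun h => by rw [h.1, h.2]⟩
  · rw [← coeff_fst_dualCell (f := f) (g := g) a b, h, coeff_fst_dualCell]
  · rw [← coeff_snd_dualCell (f := f) (g := g) a b, h, coeff_snd_dualCell]

theorem cell_smul {R : Type*} [CommRing R] [Algebra K R] {X Y : ScalarExt K R C}
    {f g : X ⟶ Y} (r : R) (k : K) (a : f.as ⟶ g.as) :
    (cell r (k • a) : f ⟶ g) = cell (k • r) a :=
  (TensorProduct.smul_tmul k r a).symm

/-- A scalar r is `r.fst + r.snd ε`, and its two components in K move across the tensor sign onto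
the 2-cell. -/
theorem exists_dualCell (τ : f ⟶ g) : ∃ a b : f.as ⟶ g.as, τ = dualCell a b := by
  induction τ using cell_induction with
  | zero => exact ⟨0, 0, by rw [dualCell, cell_zero, cell_zero, add_zero]⟩
  | tmul r a =>
    refine ⟨r.fst • a, r.snd • a, ?_⟩
    rw [dualCell, cell_smul, cell_smul]
    refine (congrArg (fun s => cell s a) ?_).trans (TensorProduct.add_tmul _ _ _)
    ext <;> simp
  | add σ τ hσ hτ =>
    obtain ⟨a, b, rfl⟩ := hσ
    obtain ⟨c, d, rfl⟩ := hτ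
    exact ⟨_, _, dualCell_add a b c d⟩

theorem smul_cell {R : Type*} [CommRing R] [Algebra K R] {X Y : ScalarExt K R C}
    {f g : X ⟶ Y} (s r : R) (a : f.as ⟶ g.as) : s • (cell r a : f ⟶ g) = cell (s * r) a :=
  TensorProduct.smul_tmul' s r a

/-- Since ε(c + dε) = cε, the elements of the submodule generated by ε are exactly the cells bε. -/
theorem sub_incl_mem_iff {τ : f ⟶ g} {a : f.as ⟶ g.as} :
    τ - incl a ∈ Ideal.span {(DualNumber.eps : DualNumber K)} • (⊤ : Submodule (DualNumber K) (f ⟶ g)) ↔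
      ∃ b, τ = dualCell a b := by
  rw [Submodule.ideal_span_singleton_smul, Submodule.mem_smul_pointwise_iff_exists]
  constructor
  · rintro ⟨σ, -, h⟩
    obtain ⟨c, d, rfl⟩ := exists_dualCell σ
    refine ⟨c, ?_⟩
    rw [sub_eq_iff_eq_add'.1 h.symm, dualCell, dualCell, smul_add, smul_cell, smul_cell,
      DualNumber.eps_mul_eps, zero_cell, mul_one, add_zero, incl]
  · rintro ⟨b, rfl⟩
    refine ⟨cell 1 b, trivial, ?_⟩
    rw [smul_cell, mul_one, dualCell, incl, add_sub_cancel_left]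

/-- An invertible 2-cell whose reduction modulo `ε` is a given invertible 2-cell. -/
def dualIso (e : f.as ≅ g.as) (b : f.as ⟶ g.as) : f ≅ g where
  hom := dualCell e.hom b
  -- First order inverse of e + bε, exact because ε² = 0.
  inv := dualCell e.inv (-(e.inv ≫ b ≫ e.inv))
  hom_inv_id := by
    rw [dualCell_comp, id_eq_dualCell]
    simp
  inv_hom_id := by
    rw [dualCell_comp, id_eq_dualCell]
    simp

variable [LinearBicategory K C] {Z : ScalarExt K (DualNumber K) C}

theorem whiskerLeft_dualCell (k : Z ⟶ X) (a b : f.as ⟶ g.as) :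
    k ◁ (dualCell a b : f ⟶ g) = dualCell (f := k ≫ f) (g := k ≫ g) (k.as ◁ a) (k.as ◁ b) :=
  wLeft_add k _ _

theorem dualCell_whiskerRight (a b : f.as ⟶ g.as) (k : Y ⟶ Z) :
    (dualCell a b : f ⟶ g) ▷ k = dualCell (f := f ≫ k) (g := g ≫ k) (a ▷ k.as) (b ▷ k.as) :=
  wRight_add _ _ k

/-- Leibniz rule for ⊗: the product of the two ε-terms vanishes. -/
theorem map₂_dualCell (P : TensorCore C) [P.IsLinear K] {X' Y' : ScalarExt K (DualNumber K) C}
    {f' g' : X' ⟶ Y'} (a b : f.as ⟶ g.as) (a' b' : f'.as ⟶ g'.as) :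
    (P.ext K (DualNumber K)).map₂ (dualCell a b : f ⟶ g) (dualCell a' b' : f' ⟶ g') =
      dualCell (f := (P.ext K (DualNumber K)).map f f') (g := (P.ext K (DualNumber K)).map g g')
        (P.map₂ a a') (P.map₂ a b' + P.map₂ b a') := by
  change P.extMap₂ _ _ _ = _
  simp only [dualCell, TensorCore.extMap₂_add_left, TensorCore.extMap₂_add_right,
    TensorCore.extMap₂_cell, mul_one, one_mul, DualNumber.eps_mul_eps, TensorProduct.zero_tmul,
    add_zero]
  refine Eq.trans ?_ (congrArg (fun x => 1 ⊗ₜ[K] P.map₂ a a' + x)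
    (TensorProduct.tmul_add DualNumber.eps (P.map₂ a b') (P.map₂ b a')).symm)
  rw [_root_.add_assoc, _root_.add_comm (DualNumber.eps ⊗ₜ[K] P.map₂ b a')]

end

section

variable {K R : Type*} [CommRing K] [CommRing R] [Algebra K R] {C : Type u} [Bicategory.{w, v} C]
  [∀ X Y : C, Preadditive (X ⟶ Y)] [∀ X Y : C, Linear K (X ⟶ Y)]

theorem isIdentity_incl {X Y : ScalarExt K R C} {f g : X ⟶ Y} {a : f.as ⟶ g.as}
    (ha : IsIdentity a) : IsIdentity (incl a : f ⟶ g) := by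
  -- Unwrapping the 1-cells turns the boundary of `a` into variables, which case analysis on the
  -- identity requires.
  obtain ⟨f⟩ := f
  obtain ⟨g⟩ := g
  change f ⟶ g at a
  change IsIdentity a at ha
  cases ha
  exact .id _

end

theorem isIdentity_mk {K R : Type*} {C : Type u} [Bicategory.{w, v} C] {X Y : ScalarExt K R C} {f : X ⟶ Y} (hf : IsIdentity f.as) :
    IsIdentity f := by
  obtain ⟨X⟩ := X
  obtain ⟨Y⟩ := Y
  obtain ⟨f⟩ := f
  change X ⟶ Y at f
  change IsIdentity f at hf
  cases hf
  exact .id _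

end ScalarExt

/-- Agreement of the leading coefficients already identifies the two boundaries. What remains is a
comparison of ε-coefficients. -/
theorem CellEq.dualCell_iff {K : Type*} [CommRing K] {C : Type u} [Bicategory.{w, v} C]
    [∀ X Y : C, Preadditive (X ⟶ Y)] [∀ X Y : C, Linear K (X ⟶ Y)] [LinearBicategory K C]
    {X Y X' Y' : ScalarExt K (DualNumber K) C} {f g : X ⟶ Y} {f' g' : X' ⟶ Y'}
    {a b : f.as ⟶ g.as} {a' b' : f'.as ⟶ g'.as} (ha : CellEq a a') :
    CellEq (ScalarExt.dualCell a b : f ⟶ g) (ScalarExt.dualCell a' b' : f' ⟶ g') ↔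
      CellEq b b' := by
  obtain ⟨X⟩ := X
  obtain ⟨Y⟩ := Y
  obtain ⟨X'⟩ := X'
  obtain ⟨Y'⟩ := Y'
  obtain ⟨f⟩ := f
  obtain ⟨g⟩ := g
  obtain ⟨f'⟩ := f'
  obtain ⟨g'⟩ := g'
  change f ⟶ g at a b
  change f' ⟶ g' at a' b'
  change CellEq a a' at ha
  change _ ↔ CellEq b b'
  cases ha
  constructor
  · intro h
    exact .of_eq (ScalarExt.dualCell_inj.1 h.eq).2
  · intro h
    rw [h.eq]
    exact .refl _

/-! ### Unitary pseudofunctorial structures -/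

/-- The structural 2-cells of `⊗` are identities as soon as one of the argument pairs is a pair of
identity 1-cells. -/
structure TensorPseudofunctor.IsUnitary {C : Type u} [Bicategory.{w, v} C] {P : TensorCore C}
    (T : TensorPseudofunctor P) : Prop where
  unit : ∀ X Y : C, IsIdentity (T.unit X Y).hom
  left : ∀ {X X' X'' Y Y' Y'' : C} {f : X ⟶ X'} {g : Y ⟶ Y'} (f' : X' ⟶ X'') (g' : Y' ⟶ Y''),
    IsIdentity f → IsIdentity g → IsIdentity (T.tensorator f g f' g').hom
  right : ∀ {X X' X'' Y Y' Y'' : C} (f : X ⟶ X') (g : Y ⟶ Y') {f' : X' ⟶ X''} {g' : Y' ⟶ Y''},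
    IsIdentity f' → IsIdentity g' → IsIdentity (T.tensorator f g f' g').hom

namespace TensorPseudofunctor.IsUnitary

variable {C : Type u} [Bicategory.{w, v} C] {P : TensorCore C} {T : TensorPseudofunctor P}
  (hT : T.IsUnitary)

include hT

/-- That ⊗₀ is an identity 2-cell forces its source id ⊗ id to be the identity 1-cell. -/
theorem map {X X' Y Y' : C} {f : X ⟶ X'} {g : Y ⟶ Y'} (hf : IsIdentity f) (hg : IsIdentity g) :
    IsIdentity (P.map f g) := by
  cases hf; cases hg
  rw [(hT.unit X Y).obj_eq]; exact .id _

theorem square {X X₁ X₂ X' Y Y₁ Y₂ Y' : C} {p : X ⟶ X₁} {f' : X₁ ⟶ X'} {f : X ⟶ X₂} {q : X₂ ⟶ X'}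
    {r : Y ⟶ Y₁} {g' : Y₁ ⟶ Y'} {g : Y ⟶ Y₂} {s : Y₂ ⟶ Y'}
    {τ : p ≫ f' ⟶ f ≫ q} {σ : r ≫ g' ⟶ g ≫ s} (hp : IsIdentity p) (hr : IsIdentity r)
    (hq : IsIdentity q) (hs : IsIdentity s) (hτ : IsIdentity τ) (hσ : IsIdentity σ) :
    IsIdentity (T.square τ σ) :=
  (hT.left f' g' hp hr).comp ((IsIdentity.map₂ P hτ hσ).comp (hT.right f g hq hs).inv)

/-- With identity sides, one tensorator of the pasted square has an identity pair as first argument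
and the other has one as second argument, so both drop out. -/
theorem cellEq_square {X X₁ X₂ X' Y Y₁ Y₂ Y' : C} {p : X ⟶ X₁} {f' : X₁ ⟶ X'} {f : X ⟶ X₂}
    {q : X₂ ⟶ X'} {r : Y ⟶ Y₁} {g' : Y₁ ⟶ Y'} {g : Y ⟶ Y₂} {s : Y₂ ⟶ Y'}
    {τ : p ≫ f' ⟶ f ≫ q} {σ : r ≫ g' ⟶ g ≫ s} (hp : IsIdentity p) (hr : IsIdentity r)
    (hq : IsIdentity q) (hs : IsIdentity s) {h h' : X ⟶ X'} {k k' : Y ⟶ Y'} {τ' : h ⟶ h'}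
    {σ' : k ⟶ k'} (hτ : CellEq τ τ') (hσ : CellEq σ σ') :
    CellEq (T.square τ σ) (P.map₂ τ' σ') :=
  .of_comp_left (hT.left f' g' hp hr) (.of_comp_right (hT.right f g hq hs).inv (.map₂ P hτ hσ))

variable [Bicategory.Strict C]

theorem compL (X : C) {Y Y' Y'' : C} {g : Y ⟶ Y'} (g' : Y' ⟶ Y'') (hg : IsIdentity g) :
    IsIdentity (T.compL X g g').hom :=
  (hT.left _ _ (.id X) hg).comp (.map₂ P (.leftUnitor_hom _) (.id _))

theorem compL₃ (X : C) {Y Y' Y'' Y''' : C} {g : Y ⟶ Y'} {g' : Y' ⟶ Y''} (g'' : Y'' ⟶ Y''')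
    (hg : IsIdentity g) (hg' : IsIdentity g') : IsIdentity (T.compL₃ X g g' g'').hom :=
  (IsIdentity.whiskerLeft _ (hT.compL X g'' hg')).comp (hT.compL X _ hg)

theorem compR {X X' X'' : C} {f : X ⟶ X'} (f' : X' ⟶ X'') (Y : C) (hf : IsIdentity f) :
    IsIdentity (T.compR f f' Y).hom :=
  (hT.left _ _ hf (.id Y)).comp (.map₂ P (.id _) (.leftUnitor_hom _))

theorem compR₃ {X X' X'' X''' : C} {f : X ⟶ X'} {f' : X' ⟶ X''} (f'' : X'' ⟶ X''') (Y : C)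
    (hf : IsIdentity f) (hf' : IsIdentity f') : IsIdentity (T.compR₃ f f' f'' Y).hom :=
  (IsIdentity.whiskerLeft _ (hT.compR f'' Y hf')).comp (hT.compR _ Y hf)

omit hT in
/-- A semigroupal structure all of whose structural cells, except for the tensorator, are
identities. -/
def semigroupalStructure (T : TensorPseudofunctor P) (hT : T.IsUnitary)
    (ha : ∀ X Y Z : C, IsIdentity (P.a X Y Z))
    (aNat : ∀ {X X' Y Y' Z Z' : C} (f : X ⟶ X') (g : Y ⟶ Y') (h : Z ⟶ Z'),
      P.a X Y Z ≫ P.map (P.map f g) h ≅ P.map f (P.map g h) ≫ P.a X' Y' Z')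
    (haNat : ∀ {X X' Y Y' Z Z' : C} (f : X ⟶ X') (g : Y ⟶ Y') (h : Z ⟶ Z'),
      IsIdentity (aNat f g h).hom)
    (pent : ∀ X Y Z T : C,
      P.map (𝟙 X) (P.a Y Z T) ≫ P.a X (P.obj Y Z) T ≫ P.map (P.a X Y Z) (𝟙 T) ≅
        P.a X Y (P.obj Z T) ≫ P.a (P.obj X Y) Z T)
    (hpent : ∀ X Y Z T : C, IsIdentity (pent X Y Z T).hom)
    (aNat_natural : ∀ {X X' Y Y' Z Z' : C} {f₁ f₂ : X ⟶ X'} {g₁ g₂ : Y ⟶ Y'} {h₁ h₂ : Z ⟶ Z'}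
      (τ : f₁ ⟶ f₂) (σ : g₁ ⟶ g₂) (η : h₁ ⟶ h₂),
      (aNat f₁ g₁ h₁).hom ≫ P.map₂ τ (P.map₂ σ η) ▷ P.a X' Y' Z' =
        P.a X Y Z ◁ P.map₂ (P.map₂ τ σ) η ≫ (aNat f₂ g₂ h₂).hom)
    (aNat_comp : ∀ {X X' X'' Y Y' Y'' Z Z' Z'' : C} (f : X ⟶ X') (g : Y ⟶ Y') (h : Z ⟶ Z')
      (f' : X' ⟶ X'') (g' : Y' ⟶ Y'') (h' : Z' ⟶ Z''),
      P.a X Y Z ◁ (T.tensorator (P.map f g) h (P.map f' g') h').hom ≫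
          P.a X Y Z ◁ P.map₂ (T.tensorator f g f' g').hom (𝟙 (h ≫ h')) ≫
          (aNat (f ≫ f') (g ≫ g') (h ≫ h')).hom =
        (α_ _ _ _).inv ≫ (aNat f g h).hom ▷ P.map (P.map f' g') h' ≫ (α_ _ _ _).hom ≫
          P.map f (P.map g h) ◁ (aNat f' g' h').hom ≫ (α_ _ _ _).inv ≫
          (T.tensorator f (P.map g h) f' (P.map g' h')).hom ▷ P.a X'' Y'' Z'' ≫
          P.map₂ (𝟙 (f ≫ f')) (T.tensorator g h g' h').hom ▷ P.a X'' Y'' Z'') :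
    SemigroupalStructure P where
  toTensorPseudofunctor := T
  aNat := aNat
  pent := pent
  aNat_natural := aNat_natural
  aNat_comp := aNat_comp
  aNat_id X Y Z := by
    apply IsIdentity.unique
    all_goals repeat' first
      | exact haNat _ _ _
      | exact hT.unit _ _
      | exact .leftUnitor_hom _
      | exact .rightUnitor_hom _
      | exact .id _
      | apply IsIdentity.whiskerLeft
      | apply IsIdentity.whiskerRight
      | apply IsIdentity.map₂
      | apply IsIdentity.comp
  pent_natural f g h k := by
    -- Tensorators occur here only in the squares, whose sides a and id are identities, so unitarity
    -- suffices even though the tensorator at the arbitrary 1-cells f, g, h, k may be deformed.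
    apply IsIdentity.unique
    all_goals repeat' first
      | exact haNat _ _ _
      | exact hpent _ _ _ _
      | exact ha _ _ _
      | exact .id _
      | exact .idComm_hom _
      | apply hT.square
      | apply IsIdentity.bicategoricalComp
      | apply IsIdentity.whiskerLeft
      | apply IsIdentity.whiskerRight
  pent_coherence X Y Z W U := by
    -- In K₅ the tensorators enter only through `compL`, `compR`, `compL₃` and `compR₃`, at 1-cells
    -- built from a and identities. Deforming them elsewhere leaves the relation untouched.
    apply IsIdentity.unique
    all_goals repeat' first
      | exact haNat _ _ _
      | exact hpent _ _ _ _
      | exact ha _ _ _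
      | exact .id _
      | exact hT.unit _ _
      | apply IsIdentity.inv
      | apply hT.compL
      | apply hT.compR
      | apply hT.compL₃
      | apply hT.compR₃
      | apply hT.map
      | apply IsIdentity.map₂
      | apply IsIdentity.bicategoricalComp
      | apply IsIdentity.whiskerLeft
      | apply IsIdentity.whiskerRight
      | apply IsIdentity.comp

end TensorPseudofunctor.IsUnitary

/-! ### Expansions over the dual numbers -/

section Expansions

open ScalarExt

variable {K : Type*} [CommRing K] {C : Type u} [Bicategory.{w, v} C]
  [∀ X Y : C, Preadditive (X ⟶ Y)] [∀ X Y : C, Linear K (X ⟶ Y)]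

/-- `τ = a + b ε`. -/
def IsDual {X Y : ScalarExt K (DualNumber K) C} {f g : X ⟶ Y} (τ : f ⟶ g) (a b : f.as ⟶ g.as) :
    Prop :=
  τ = dualCell a b

namespace IsDual

variable {X Y Z : ScalarExt K (DualNumber K) C} {f g h : X ⟶ Y}

theorem eq_iff {σ τ : f ⟶ g} {a b c d : f.as ⟶ g.as} (hσ : IsDual σ a b) (hτ : IsDual τ c d) :
    σ = τ ↔ a = c ∧ b = d := by
  rw [hσ, hτ, dualCell_inj]

theorem incl (a : f.as ⟶ g.as) : IsDual (ScalarExt.incl a : f ⟶ g) a 0 :=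
  incl_eq_dualCell a

theorem id (f : X ⟶ Y) : IsDual (𝟙 f) (𝟙 f.as) 0 :=
  id_eq_dualCell f

/-- The variants that follow drop the terms killed by an undeformed factor, so that the
ε-coefficients of the axioms match the summands of the differentials without further simplification.
-/
theorem comp {σ : f ⟶ g} {τ : g ⟶ h} {a b : f.as ⟶ g.as} {c d : g.as ⟶ h.as}
    (hσ : IsDual σ a b) (hτ : IsDual τ c d) : IsDual (σ ≫ τ) (a ≫ c) (a ≫ d + b ≫ c) := by
  rw [IsDual, hσ, hτ, dualCell_comp]

theorem comp_left {σ : f ⟶ g} {τ : g ⟶ h} {a : f.as ⟶ g.as} {c d : g.as ⟶ h.as}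
    (hσ : IsDual σ a 0) (hτ : IsDual τ c d) : IsDual (σ ≫ τ) (a ≫ c) (a ≫ d) := by
  rw [IsDual, hσ, hτ, dualCell_zero_comp]

theorem comp_right {σ : f ⟶ g} {τ : g ⟶ h} {a b : f.as ⟶ g.as} {c : g.as ⟶ h.as}
    (hσ : IsDual σ a b) (hτ : IsDual τ c 0) : IsDual (σ ≫ τ) (a ≫ c) (b ≫ c) := by
  rw [IsDual, hσ, hτ, dualCell_comp_zero]

theorem comp_zero {σ : f ⟶ g} {τ : g ⟶ h} {a : f.as ⟶ g.as} {c : g.as ⟶ h.as}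
    (hσ : IsDual σ a 0) (hτ : IsDual τ c 0) : IsDual (σ ≫ τ) (a ≫ c) 0 := by
  rw [IsDual, hσ, hτ, dualCell_comp_zero, Limits.zero_comp]

variable [LinearBicategory K C]

theorem whiskerLeft (k : Z ⟶ X) {τ : f ⟶ g} {a b : f.as ⟶ g.as} (hτ : IsDual τ a b) :
    IsDual (k ◁ τ) (k.as ◁ a) (k.as ◁ b) := by
  rw [IsDual, hτ, whiskerLeft_dualCell]

theorem whiskerLeft_zero (k : Z ⟶ X) {τ : f ⟶ g} {a : f.as ⟶ g.as} (hτ : IsDual τ a 0) :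
    IsDual (k ◁ τ) (k.as ◁ a) 0 := by
  have h := hτ.whiskerLeft k
  rwa [show k.as ◁ (0 : f.as ⟶ g.as) = 0 from map_zero (whiskerLeftₗ (K := K) k.as f.as g.as)] at h

theorem whiskerRight {τ : f ⟶ g} {a b : f.as ⟶ g.as} (hτ : IsDual τ a b) (k : Y ⟶ Z) :
    IsDual (τ ▷ k) (a ▷ k.as) (b ▷ k.as) := by
  rw [IsDual, hτ, dualCell_whiskerRight]

theorem whiskerRight_zero {τ : f ⟶ g} {a : f.as ⟶ g.as} (hτ : IsDual τ a 0) (k : Y ⟶ Z) :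
    IsDual (τ ▷ k) (a ▷ k.as) 0 := by
  have h := hτ.whiskerRight k
  rwa [show (0 : f.as ⟶ g.as) ▷ k.as = 0 from map_zero (whiskerRightₗ (K := K) f.as g.as k.as)] at h

theorem associator_hom {W : ScalarExt K (DualNumber K) C} (f : W ⟶ X) (g : X ⟶ Y) (h : Y ⟶ Z) :
    IsDual (α_ f g h).hom (α_ f.as g.as h.as).hom 0 :=
  incl _

theorem associator_inv {W : ScalarExt K (DualNumber K) C} (f : W ⟶ X) (g : X ⟶ Y) (h : Y ⟶ Z) :
    IsDual (α_ f g h).inv (α_ f.as g.as h.as).inv 0 :=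
  incl _

theorem leftUnitor_hom (f : X ⟶ Y) : IsDual (λ_ f).hom (λ_ f.as).hom 0 :=
  incl _

theorem leftUnitor_inv (f : X ⟶ Y) : IsDual (λ_ f).inv (λ_ f.as).inv 0 :=
  incl _

theorem rightUnitor_hom (f : X ⟶ Y) : IsDual (ρ_ f).hom (ρ_ f.as).hom 0 :=
  incl _

theorem rightUnitor_inv (f : X ⟶ Y) : IsDual (ρ_ f).inv (ρ_ f.as).inv 0 :=
  incl _

theorem hcomp {f f' : X ⟶ Y} {g g' : Y ⟶ Z} {σ : f ⟶ f'} {τ : g ⟶ g'} {a b : f.as ⟶ f'.as}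
    {c d : g.as ⟶ g'.as} (hσ : IsDual σ a b) (hτ : IsDual τ c d) :
    IsDual (_root_.hcomp σ τ) (_root_.hcomp a c) (_root_.hcomp a d + _root_.hcomp b c) :=
  (hσ.whiskerRight g).comp (hτ.whiskerLeft f')

variable (P : TensorCore C) [P.IsLinear K] {X' Y' : ScalarExt K (DualNumber K) C}
  {f' g' : X' ⟶ Y'}

theorem map₂ {σ : f ⟶ g} {τ : f' ⟶ g'} {a b : f.as ⟶ g.as} {c d : f'.as ⟶ g'.as}
    (hσ : IsDual σ a b) (hτ : IsDual τ c d) :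
    IsDual ((P.ext K (DualNumber K)).map₂ σ τ) (P.map₂ a c) (P.map₂ a d + P.map₂ b c) := by
  cases hσ
  cases hτ
  exact map₂_dualCell P a b c d

theorem map₂_left {σ : f ⟶ g} {τ : f' ⟶ g'} {a : f.as ⟶ g.as} {c d : f'.as ⟶ g'.as}
    (hσ : IsDual σ a 0) (hτ : IsDual τ c d) :
    IsDual ((P.ext K (DualNumber K)).map₂ σ τ) (P.map₂ a c) (P.map₂ a d) := by
  have h := map₂ P hσ hτ
  rwa [show P.map₂ (0 : f.as ⟶ g.as) c = 0 from
    LinearMap.map_zero₂ (P.map₂ₗ (K := K) f.as g.as f'.as g'.as) c, _root_.add_zero] at h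

theorem map₂_right {σ : f ⟶ g} {τ : f' ⟶ g'} {a b : f.as ⟶ g.as} {c : f'.as ⟶ g'.as}
    (hσ : IsDual σ a b) (hτ : IsDual τ c 0) :
    IsDual ((P.ext K (DualNumber K)).map₂ σ τ) (P.map₂ a c) (P.map₂ b c) := by
  have h := map₂ P hσ hτ
  rwa [show P.map₂ a (0 : f'.as ⟶ g'.as) = 0 from
    map_zero (P.map₂ₗ (K := K) f.as g.as f'.as g'.as a), _root_.zero_add] at h

theorem map₂_zero {σ : f ⟶ g} {τ : f' ⟶ g'} {a : f.as ⟶ g.as} {c : f'.as ⟶ g'.as}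
    (hσ : IsDual σ a 0) (hτ : IsDual τ c 0) :
    IsDual ((P.ext K (DualNumber K)).map₂ σ τ) (P.map₂ a c) 0 := by
  have h := map₂_left P hσ hτ
  rwa [show P.map₂ a (0 : f'.as ⟶ g'.as) = 0 from
    map_zero (P.map₂ₗ (K := K) f.as g.as f'.as g'.as a)] at h

end IsDual

include K in
theorem hcomp_add_left [LinearBicategory K C] {X Y Z : C} {f f' : X ⟶ Y} {g g' : Y ⟶ Z}
    (τ τ' : f ⟶ f') (σ : g ⟶ g') : hcomp (τ + τ') σ = hcomp τ σ + hcomp τ' σ := by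
  simp only [hcomp, LinearBicategory.add_whiskerRight K, Preadditive.add_comp]

include K in
theorem hcomp_add_right [LinearBicategory K C] {X Y Z : C} {f f' : X ⟶ Y} {g g' : Y ⟶ Z}
    (τ : f ⟶ f') (σ σ' : g ⟶ g') : hcomp τ (σ + σ') = hcomp τ σ + hcomp τ σ' := by
  simp only [hcomp, LinearBicategory.whiskerLeft_add K, Preadditive.comp_add]

end Expansions

/-! ### Deformations and cocycles -/

section Cocycles

open ScalarExt

/-- With e an associator, the right side has the order and signs of δ_h on 2-cochains. -/
theorem CategoryTheory.Preadditive.add_eq_hom_comp_add_iff {D : Type u} [Category.{v} D]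
    [Preadditive D] {X Y Z : D} (e : X ≅ Y) (a b : X ⟶ Z) (c d : Y ⟶ Z) :
    a + b = e.hom ≫ (c + d) ↔ e.inv ≫ b - c + e.inv ≫ a - d = 0 := by
  rw [← Iso.inv_comp_eq, Preadditive.comp_add, ← sub_eq_zero]
  refine Eq.congr_left ?_
  abel

/-- With u the 2-cell `aNat₂`, the right side has the order and signs of δ_v on 2-cochains. -/
theorem CategoryTheory.Preadditive.add_eq_comp_add_iff {D : Type u} [Category.{v} D]
    [Preadditive D] {X Y Z : D} (u : X ⟶ Y) {a b : X ⟶ Z} {c d : Y ⟶ Z} {r : X ⟶ Z}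
    (hr : r = u ≫ (c + d)) :
    a + b = r ↔ u ≫ c - b + u ≫ d - a = 0 := by
  rw [hr, Preadditive.comp_add, eq_comm, ← sub_eq_zero]
  refine Eq.congr_left ?_
  abel

theorem CategoryTheory.Category.comp_comp_comp_comp_assoc {D : Type u} [Category.{v} D]
    {X₀ X₁ X₂ X₃ X₄ X₅ X₆ : D} (f₁ : X₀ ⟶ X₁) (f₂ : X₁ ⟶ X₂) (f₃ : X₂ ⟶ X₃) (f₄ : X₃ ⟶ X₄)
    (f₅ : X₄ ⟶ X₅) (g : X₅ ⟶ X₆) :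
    f₁ ≫ f₂ ≫ f₃ ≫ f₄ ≫ f₅ ≫ g = (f₁ ≫ f₂ ≫ f₃ ≫ f₄ ≫ f₅) ≫ g := by
  simp only [Category.assoc]

/-- Cubicality gives more: a single identity 1-cell, in the appropriate slot, is enough. Only the
weaker form with pairs of identities is kept, because special cochains vanish only on such pairs and
a deformation need not stay cubical. -/
theorem SemigroupalStructure.IsGray.isUnitary {C : Type u} [Bicategory.{w, v} C]
    {P : TensorCore C} {S : SemigroupalStructure P} (hS : S.IsGray) :
    S.toTensorPseudofunctor.IsUnitary where
  unit := hS.unit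
  left _ _ hf _ := by cases hf; exact hS.tensorator_right _ _ _
  right _ _ _ _ _ hg := by cases hg; exact hS.tensorator_left _ _ _

variable {K : Type*} [CommRing K] {C : Type u} [Bicategory.{w, v} C]
  [∀ X Y : C, Preadditive (X ⟶ Y)] [∀ X Y : C, Linear K (X ⟶ Y)]

namespace SemigroupalStructure

theorem special₂_left {P : TensorCore C} {φ : Cochain₂ P} (hφ : φ ∈ special₂ K P)
    {X X' X'' Y Y' Y'' : C}
    {f : X ⟶ X'} {g : Y ⟶ Y'} (f' : X' ⟶ X'') (g' : Y' ⟶ Y'') (hf : IsIdentity f)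
    (hg : IsIdentity g) : φ X X' X'' Y Y' Y'' f g f' g' = 0 := by
  cases hf; cases hg; exact (hφ.2 f' g').1

theorem special₂_right {P : TensorCore C} {φ : Cochain₂ P} (hφ : φ ∈ special₂ K P)
    {X X' X'' Y Y' Y'' : C}
    (f : X ⟶ X') (g : Y ⟶ Y') {f' : X' ⟶ X''} {g' : Y' ⟶ Y''} (hf : IsIdentity f')
    (hg : IsIdentity g') : φ X X' X'' Y Y' Y'' f g f' g' = 0 := by
  cases hf; cases hg; exact (hφ.2 f g).2

end SemigroupalStructure

theorem IsDual.isIdentity {X Y : ScalarExt K (DualNumber K) C} {f g : X ⟶ Y} {τ : f ⟶ g}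
    {a b : f.as ⟶ g.as} (h : IsDual τ a b) (hb : b = 0) (ha : IsIdentity a) : IsIdentity τ := by
  rw [h, hb, ← incl_eq_dualCell]; exact isIdentity_incl ha

variable [LinearBicategory K C] {P : TensorCore C} [P.IsLinear K] (S : SemigroupalStructure P)

section

variable {φ : Cochain₂ P}
  (T : ∀ {X X' X'' Y Y' Y'' : ScalarExt K (DualNumber K) C} (f : X ⟶ X') (g : Y ⟶ Y')
    (f' : X' ⟶ X'') (g' : Y' ⟶ Y''),
    (P.ext K (DualNumber K)).map f g ≫ (P.ext K (DualNumber K)).map f' g' ⟶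
      (P.ext K (DualNumber K)).map (f ≫ f') (g ≫ g'))
  (hT : ∀ {X X' X'' Y Y' Y'' : ScalarExt K (DualNumber K) C} (f : X ⟶ X') (g : Y ⟶ Y')
    (f' : X' ⟶ X'') (g' : Y' ⟶ Y''), IsDual (T f g f' g')
      (S.tensorator f.as g.as f'.as g'.as).hom (φ _ _ _ _ _ _ f.as g.as f'.as g'.as))

include hT

/-- The ε-parts of the four arguments contribute equally to both sides, by naturality of the
undeformed tensorator. Hence naturality against 2-cells with coefficients in K[ε] amounts to
naturality of φ against their reductions. -/
theorem tensorator_natural_iff {X X' X'' Y Y' Y'' : ScalarExt K (DualNumber K) C}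
    {f₁ f₂ : X ⟶ X'} {g₁ g₂ : Y ⟶ Y'} {f'₁ f'₂ : X' ⟶ X''} {g'₁ g'₂ : Y' ⟶ Y''}
    {τ : f₁ ⟶ f₂} {σ : g₁ ⟶ g₂} {τ' : f'₁ ⟶ f'₂} {σ' : g'₁ ⟶ g'₂}
    {a a' : f₁.as ⟶ f₂.as} {b b' : g₁.as ⟶ g₂.as} {c c' : f'₁.as ⟶ f'₂.as}
    {d d' : g'₁.as ⟶ g'₂.as} (hτ : IsDual τ a a') (hσ : IsDual σ b b') (hτ' : IsDual τ' c c')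
    (hσ' : IsDual σ' d d') :
    T f₁ g₁ f'₁ g'₁ ≫ (P.ext K (DualNumber K)).map₂ (hcomp τ τ') (hcomp σ σ') =
        hcomp ((P.ext K (DualNumber K)).map₂ τ σ) ((P.ext K (DualNumber K)).map₂ τ' σ') ≫
          T f₂ g₂ f'₂ g'₂ ↔
      φ _ _ _ _ _ _ f₁.as g₁.as f'₁.as g'₁.as ≫ P.map₂ (hcomp a c) (hcomp b d) =
        hcomp (P.map₂ a b) (P.map₂ c d) ≫ φ _ _ _ _ _ _ f₂.as g₂.as f'₂.as g'₂.as := by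
  have hL := (hT f₁ g₁ f'₁ g'₁).comp (.map₂ P (hτ.hcomp hτ') (hσ.hcomp hσ'))
  have hR := ((IsDual.map₂ P hτ hσ).hcomp (.map₂ P hτ' hσ')).comp (hT f₂ g₂ f'₂ g'₂)
  refine (hL.eq_iff hR).trans ((and_iff_right (S.tensorator_natural a b c d)).trans ?_)
  change (S.tensorator f₁.as g₁.as f'₁.as g'₁.as).hom ≫
          (P.map₂ (hcomp a c) (hcomp b d' + hcomp b' d) +
            P.map₂ (hcomp a c' + hcomp a' c) (hcomp b d)) +
        φ _ _ _ _ _ _ f₁.as g₁.as f'₁.as g'₁.as ≫ P.map₂ (hcomp a c) (hcomp b d) =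
      hcomp (P.map₂ a b) (P.map₂ c d) ≫ φ _ _ _ _ _ _ f₂.as g₂.as f'₂.as g'₂.as +
        (hcomp (P.map₂ a b) (P.map₂ c d' + P.map₂ c' d) +
            hcomp (P.map₂ a b' + P.map₂ a' b) (P.map₂ c d)) ≫
          (S.tensorator f₂.as g₂.as f'₂.as g'₂.as).hom ↔ _
  simp only [TensorCore.IsLinear.map₂_add_left K, TensorCore.IsLinear.map₂_add_right K,
    hcomp_add_left (K := K), hcomp_add_right (K := K), Preadditive.comp_add, Preadditive.add_comp,
    S.tensorator_natural]
  -- Each side now carries the same four terms, linear in `a'`, `b'`, `c'`, `d'`; only the middle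
  -- two are in a different order.
  rw [add_comm, show ∀ x y z w : P.map f₁.as g₁.as ≫ P.map f'₁.as g'₁.as ⟶
      P.map (f₂.as ≫ f'₂.as) (g₂.as ≫ g'₂.as), x + y + (z + w) = x + z + (y + w) from
      fun _ _ _ _ => add_add_add_comm _ _ _ _, add_left_inj]

/-- Each side is a product of two deformed tensorators and hence has two ε-terms. Together they are
the four terms of δ_h, once the associator is moved to the other side. -/
theorem tensorator_assoc_iff {X X' X'' X''' Y Y' Y'' Y''' : ScalarExt K (DualNumber K) C}
    (f : X ⟶ X') (g : Y ⟶ Y') (f' : X' ⟶ X'') (g' : Y' ⟶ Y'') (f'' : X'' ⟶ X''')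
    (g'' : Y'' ⟶ Y''') :
    T f g f' g' ▷ (P.ext K (DualNumber K)).map f'' g'' ≫ T (f ≫ f') (g ≫ g') f'' g'' ≫
          (P.ext K (DualNumber K)).map₂ (α_ f f' f'').hom (α_ g g' g'').hom =
        (α_ _ _ _).hom ≫ (P.ext K (DualNumber K)).map f g ◁ T f' g' f'' g'' ≫
          T f g (f' ≫ f'') (g' ≫ g'') ↔
      S.deltaH₂ K φ _ _ _ _ _ _ _ _ f.as g.as f'.as g'.as f''.as g''.as = 0 := by
  have hL := ((hT f g f' g').whiskerRight ((P.ext K (DualNumber K)).map f'' g'')).comp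
    ((hT (f ≫ f') (g ≫ g') f'' g'').comp_right
      (.map₂_zero P (.associator_hom f f' f'') (.associator_hom g g' g'')))
  have hR := (IsDual.associator_hom ((P.ext K (DualNumber K)).map f g)
      ((P.ext K (DualNumber K)).map f' g') ((P.ext K (DualNumber K)).map f'' g'')).comp_left
    (((hT f' g' f'' g'').whiskerLeft ((P.ext K (DualNumber K)).map f g)).comp
      (hT f g (f' ≫ f'') (g' ≫ g'')))
  refine (hL.eq_iff hR).trans ((and_iff_right (S.tensorator_assoc _ _ _ _ _ _)).trans ?_)
  exact Preadditive.add_eq_hom_comp_add_iff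
    (α_ (P.map f.as g.as) (P.map f'.as g'.as) (P.map f''.as g''.as)) _ _ _ _

/-- With ⊗₀ undeformed, the right side has no ε-term, while the left one has φ followed by an
invertible cell, which can be cancelled. -/
theorem tensorator_id_left_iff {X X' Y Y' : ScalarExt K (DualNumber K) C} (f : X ⟶ X')
    (g : Y ⟶ Y') {u : (P.ext K (DualNumber K)).map (𝟙 X) (𝟙 Y) ⟶ 𝟙 _}
    (hu : IsDual u (S.unit X.as Y.as).hom 0) :
    T (𝟙 X) (𝟙 Y) f g ≫ (P.ext K (DualNumber K)).map₂ (λ_ f).hom (λ_ g).hom =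
        u ▷ (P.ext K (DualNumber K)).map f g ≫ (λ_ _).hom ↔
      φ _ _ _ _ _ _ (𝟙 X.as) (𝟙 Y.as) f.as g.as = 0 := by
  have hL := (hT (𝟙 X) (𝟙 Y) f g).comp_right
    (.map₂_zero P (.leftUnitor_hom f) (.leftUnitor_hom g))
  have hR := (hu.whiskerRight_zero ((P.ext K (DualNumber K)).map f g)).comp_zero
    (.leftUnitor_hom _)
  refine (hL.eq_iff hR).trans ((and_iff_right (S.tensorator_id_left _ _)).trans ?_)
  exact Preadditive.IsIso.comp_right_eq_zero _ (P.map₂Iso (λ_ f.as) (λ_ g.as)).hom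

theorem tensorator_id_right_iff {X X' Y Y' : ScalarExt K (DualNumber K) C} (f : X ⟶ X')
    (g : Y ⟶ Y') {u : (P.ext K (DualNumber K)).map (𝟙 X') (𝟙 Y') ⟶ 𝟙 _}
    (hu : IsDual u (S.unit X'.as Y'.as).hom 0) :
    T f g (𝟙 X') (𝟙 Y') ≫ (P.ext K (DualNumber K)).map₂ (ρ_ f).hom (ρ_ g).hom =
        (P.ext K (DualNumber K)).map f g ◁ u ≫ (ρ_ _).hom ↔
      φ _ _ _ _ _ _ f.as g.as (𝟙 X'.as) (𝟙 Y'.as) = 0 := by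
  have hL := (hT f g (𝟙 X') (𝟙 Y')).comp_right
    (.map₂_zero P (.rightUnitor_hom f) (.rightUnitor_hom g))
  have hR := (hu.whiskerLeft_zero ((P.ext K (DualNumber K)).map f g)).comp_zero
    (.rightUnitor_hom _)
  refine (hL.eq_iff hR).trans ((and_iff_right (S.tensorator_id_right _ _)).trans ?_)
  exact Preadditive.IsIso.comp_right_eq_zero _ (P.map₂Iso (ρ_ f.as) (ρ_ g.as)).hom

/-- Four deformed tensorators occur, two on each side, and â is undeformed. Deforming them one at a
time gives the four terms of δ_v. -/
theorem aNat_comp_iff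
    (aN : ∀ {X X' Y Y' Z Z' : ScalarExt K (DualNumber K) C} (f : X ⟶ X') (g : Y ⟶ Y')
      (h : Z ⟶ Z'),
      (P.ext K (DualNumber K)).a X Y Z ≫
          (P.ext K (DualNumber K)).map ((P.ext K (DualNumber K)).map f g) h ⟶
        (P.ext K (DualNumber K)).map f ((P.ext K (DualNumber K)).map g h) ≫
          (P.ext K (DualNumber K)).a X' Y' Z')
    (haN : ∀ {X X' Y Y' Z Z' : ScalarExt K (DualNumber K) C} (f : X ⟶ X') (g : Y ⟶ Y')
      (h : Z ⟶ Z'), IsDual (aN f g h) (S.aNat f.as g.as h.as).hom 0)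
    {X X' X'' Y Y' Y'' Z Z' Z'' : ScalarExt K (DualNumber K) C} (f : X ⟶ X') (g : Y ⟶ Y')
    (h : Z ⟶ Z') (f' : X' ⟶ X'') (g' : Y' ⟶ Y'') (h' : Z' ⟶ Z'') :
    (P.ext K (DualNumber K)).a X Y Z ◁ T ((P.ext K (DualNumber K)).map f g) h
            ((P.ext K (DualNumber K)).map f' g') h' ≫
          (P.ext K (DualNumber K)).a X Y Z ◁
            (P.ext K (DualNumber K)).map₂ (T f g f' g') (𝟙 (h ≫ h')) ≫
          aN (f ≫ f') (g ≫ g') (h ≫ h') =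
        (α_ _ _ _).inv ≫ aN f g h ▷
            (P.ext K (DualNumber K)).map ((P.ext K (DualNumber K)).map f' g') h' ≫
          (α_ _ _ _).hom ≫
          (P.ext K (DualNumber K)).map f ((P.ext K (DualNumber K)).map g h) ◁ aN f' g' h' ≫
          (α_ _ _ _).inv ≫
          T f ((P.ext K (DualNumber K)).map g h) f' ((P.ext K (DualNumber K)).map g' h') ▷
            (P.ext K (DualNumber K)).a X'' Y'' Z'' ≫
          (P.ext K (DualNumber K)).map₂ (𝟙 (f ≫ f')) (T g h g' h') ▷
            (P.ext K (DualNumber K)).a X'' Y'' Z'' ↔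
      S.deltaV₂ K φ _ _ _ _ _ _ _ _ _ f.as g.as h.as f'.as g'.as h'.as = 0 := by
  have hL := ((hT ((P.ext K (DualNumber K)).map f g) h
      ((P.ext K (DualNumber K)).map f' g') h').whiskerLeft
        ((P.ext K (DualNumber K)).a X Y Z)).comp
    (((IsDual.map₂_right P (hT f g f' g') (.id (h ≫ h'))).whiskerLeft
      ((P.ext K (DualNumber K)).a X Y Z)).comp_right (haN (f ≫ f') (g ≫ g') (h ≫ h')))
  have hR := (IsDual.associator_inv ((P.ext K (DualNumber K)).a X Y Z)
      ((P.ext K (DualNumber K)).map ((P.ext K (DualNumber K)).map f g) h)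
      ((P.ext K (DualNumber K)).map ((P.ext K (DualNumber K)).map f' g') h')).comp_left
    (((haN f g h).whiskerRight_zero
      ((P.ext K (DualNumber K)).map ((P.ext K (DualNumber K)).map f' g') h')).comp_left
    ((IsDual.associator_hom ((P.ext K (DualNumber K)).map f ((P.ext K (DualNumber K)).map g h))
      ((P.ext K (DualNumber K)).a X' Y' Z')
      ((P.ext K (DualNumber K)).map ((P.ext K (DualNumber K)).map f' g') h')).comp_left
    (((haN f' g' h').whiskerLeft_zero
      ((P.ext K (DualNumber K)).map f ((P.ext K (DualNumber K)).map g h))).comp_left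
    ((IsDual.associator_inv ((P.ext K (DualNumber K)).map f ((P.ext K (DualNumber K)).map g h))
      ((P.ext K (DualNumber K)).map f' ((P.ext K (DualNumber K)).map g' h'))
      ((P.ext K (DualNumber K)).a X'' Y'' Z'')).comp_left
    (((hT f ((P.ext K (DualNumber K)).map g h) f'
      ((P.ext K (DualNumber K)).map g' h')).whiskerRight
        ((P.ext K (DualNumber K)).a X'' Y'' Z'')).comp
      ((IsDual.map₂_left P (.id (f ≫ f')) (hT g h g' h')).whiskerRight
        ((P.ext K (DualNumber K)).a X'' Y'' Z'')))))))
  refine (hL.eq_iff hR).trans ((and_iff_right (S.aNat_comp _ _ _ _ _ _)).trans ?_)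
  -- The five undeformed cells at the front of the right side compose to `aNat₂`; only the
  -- bracketing has to be changed.
  exact Preadditive.add_eq_comp_add_iff (S.aNat₂ f.as g.as h.as f'.as g'.as h'.as)
    (Category.comp_comp_comp_comp_assoc _ _ _ _ _ _)

end

end Cocycles

/-! ### The cocycle of a deformation and the pseudofunctor of a cocycle -/

section Classification

open ScalarExt

variable {K : Type*} [CommRing K] {C : Type u} [Bicategory.{w, v} C]
  [∀ X Y : C, Preadditive (X ⟶ Y)] [∀ X Y : C, Linear K (X ⟶ Y)]
  [LinearBicategory K C] {P : TensorCore C} [P.IsLinear K] {S : SemigroupalStructure P}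

namespace FirstOrderDeformation

/-- The coefficient of `ε` in the tensorator of a first order deformation. -/
def cocycle (D : FirstOrderDeformation K S) : Cochain₂ P :=
  fun X X' X'' Y Y' Y'' f g f' g' =>
    coeff (TrivSqZeroExt.sndHom K K) (D.tensorator (X := ⟨X⟩) (X' := ⟨X'⟩) (X'' := ⟨X''⟩)
      (Y := ⟨Y⟩) (Y' := ⟨Y'⟩) (Y'' := ⟨Y''⟩) ⟨f⟩ ⟨g⟩ ⟨f'⟩ ⟨g'⟩).hom

theorem isDual_tensorator (D : FirstOrderDeformation K S)
    {X X' X'' Y Y' Y'' : ScalarExt K (DualNumber K) C} (f : X ⟶ X') (g : Y ⟶ Y')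
    (f' : X' ⟶ X'') (g' : Y' ⟶ Y'') :
    IsDual (D.tensorator f g f' g').hom (S.tensorator f.as g.as f'.as g'.as).hom
      (cocycle D _ _ _ _ _ _ f.as g.as f'.as g'.as) := by
  obtain ⟨b, hb⟩ := sub_incl_mem_iff.1 (D.tensorator_mod f g f' g')
  have h : cocycle D _ _ _ _ _ _ f.as g.as f'.as g'.as = b :=
    (congrArg (coeff (TrivSqZeroExt.sndHom K K)) hb).trans (coeff_snd_dualCell _ _)
  rw [h]
  exact hb

theorem isDual_unit (D : FirstOrderDeformation K S) (X Y : ScalarExt K (DualNumber K) C) :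
    IsDual (D.unit X Y).hom (S.unit X.as Y.as).hom 0 := by
  rw [D.unit_eq]; exact .incl _

theorem isDual_aNat (D : FirstOrderDeformation K S)
    {X X' Y Y' Z Z' : ScalarExt K (DualNumber K) C} (f : X ⟶ X') (g : Y ⟶ Y') (h : Z ⟶ Z') :
    IsDual (D.aNat f g h).hom (S.aNat f.as g.as h.as).hom 0 := by
  rw [D.aNat_eq]; exact .incl _

/-- Each condition defining a cocycle is read off from an axiom of the deformation, evaluated on
undeformed 1-cells and 2-cells. -/
theorem cocycle_mem (D : FirstOrderDeformation K S) : cocycle D ∈ S.Z2tens K := by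
  refine ⟨⟨⟨fun {X X' X'' Y Y' Y'' f₁ f₂ g₁ g₂ f'₁ f'₂ g'₁ g'₂} τ σ τ' σ' => ?_,
    fun {X X' Y Y'} f g => ⟨?_, ?_⟩⟩, ?_⟩, ?_⟩
  · exact (tensorator_natural_iff S _ (isDual_tensorator D) (f₁ := ⟨f₁⟩) (f₂ := ⟨f₂⟩)
      (g₁ := ⟨g₁⟩) (g₂ := ⟨g₂⟩) (f'₁ := ⟨f'₁⟩) (f'₂ := ⟨f'₂⟩) (g'₁ := ⟨g'₁⟩) (g'₂ := ⟨g'₂⟩)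
      (.incl τ) (.incl σ) (.incl τ') (.incl σ')).1 (D.tensorator_natural _ _ _ _)
  · exact (tensorator_id_left_iff S _ (isDual_tensorator D) (X := ⟨X⟩) (X' := ⟨X'⟩) (Y := ⟨Y⟩)
      (Y' := ⟨Y'⟩) ⟨f⟩ ⟨g⟩ (isDual_unit D _ _)).1 (D.tensorator_id_left _ _)
  · exact (tensorator_id_right_iff S _ (isDual_tensorator D) (X := ⟨X⟩) (X' := ⟨X'⟩) (Y := ⟨Y⟩)
      (Y' := ⟨Y'⟩) ⟨f⟩ ⟨g⟩ (isDual_unit D _ _)).1 (D.tensorator_id_right _ _)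
  · refine LinearMap.mem_ker.2 ?_
    funext X X' X'' Y Y' Y'' Z Z' Z'' f g h f' g' h'
    exact (aNat_comp_iff S _ (isDual_tensorator D) (fun f g h => (D.aNat f g h).hom)
      (isDual_aNat D) (X := ⟨X⟩) (X' := ⟨X'⟩) (X'' := ⟨X''⟩) (Y := ⟨Y⟩) (Y' := ⟨Y'⟩)
      (Y'' := ⟨Y''⟩) (Z := ⟨Z⟩) (Z' := ⟨Z'⟩) (Z'' := ⟨Z''⟩) ⟨f⟩ ⟨g⟩ ⟨h⟩ ⟨f'⟩ ⟨g'⟩ ⟨h'⟩).1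
      (D.aNat_comp _ _ _ _ _ _)
  · refine LinearMap.mem_ker.2 ?_
    funext X X' X'' X''' Y Y' Y'' Y''' f g f' g' f'' g''
    exact (tensorator_assoc_iff S _ (isDual_tensorator D) (X := ⟨X⟩) (X' := ⟨X'⟩) (X'' := ⟨X''⟩)
      (X''' := ⟨X'''⟩) (Y := ⟨Y⟩) (Y' := ⟨Y'⟩) (Y'' := ⟨Y''⟩) (Y''' := ⟨Y'''⟩) ⟨f⟩ ⟨g⟩ ⟨f'⟩ ⟨g'⟩
      ⟨f''⟩ ⟨g''⟩).1 (D.tensorator_assoc _ _ _ _ _ _)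

end FirstOrderDeformation

section OfCocycle

variable (S) {φ : Cochain₂ P} (hφ : φ ∈ S.Z2tens K)

/-- Both sides are trilinear in the 2-cells. Each ε-term is naturality of the undeformed â with one
argument replaced by its ε-coefficient. -/
theorem aNat_natural_ext {X X' Y Y' Z Z' : ScalarExt K (DualNumber K) C} {f₁ f₂ : X ⟶ X'}
    {g₁ g₂ : Y ⟶ Y'} {h₁ h₂ : Z ⟶ Z'} (τ : f₁ ⟶ f₂) (σ : g₁ ⟶ g₂) (η : h₁ ⟶ h₂)
    {α₁ : (P.ext K (DualNumber K)).a X Y Z ≫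
          (P.ext K (DualNumber K)).map ((P.ext K (DualNumber K)).map f₁ g₁) h₁ ⟶
        (P.ext K (DualNumber K)).map f₁ ((P.ext K (DualNumber K)).map g₁ h₁) ≫
          (P.ext K (DualNumber K)).a X' Y' Z'}
    {α₂ : (P.ext K (DualNumber K)).a X Y Z ≫
          (P.ext K (DualNumber K)).map ((P.ext K (DualNumber K)).map f₂ g₂) h₂ ⟶
        (P.ext K (DualNumber K)).map f₂ ((P.ext K (DualNumber K)).map g₂ h₂) ≫
          (P.ext K (DualNumber K)).a X' Y' Z'}
    (hα₁ : IsDual α₁ (S.aNat f₁.as g₁.as h₁.as).hom 0)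
    (hα₂ : IsDual α₂ (S.aNat f₂.as g₂.as h₂.as).hom 0) :
    α₁ ≫ (P.ext K (DualNumber K)).map₂ τ ((P.ext K (DualNumber K)).map₂ σ η) ▷
          (P.ext K (DualNumber K)).a X' Y' Z' =
      (P.ext K (DualNumber K)).a X Y Z ◁
          (P.ext K (DualNumber K)).map₂ ((P.ext K (DualNumber K)).map₂ τ σ) η ≫ α₂ := by
  obtain ⟨a, a', hτ⟩ := exists_dualCell τ
  obtain ⟨b, b', hσ⟩ := exists_dualCell σ
  obtain ⟨c, c', hη⟩ := exists_dualCell η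
  change IsDual τ a a' at hτ
  change IsDual σ b b' at hσ
  change IsDual η c c' at hη
  have hL := hα₁.comp_left ((IsDual.map₂ P hτ (.map₂ P hσ hη)).whiskerRight
    ((P.ext K (DualNumber K)).a X' Y' Z'))
  have hR := ((IsDual.map₂ P (.map₂ P hτ hσ) hη).whiskerLeft
    ((P.ext K (DualNumber K)).a X Y Z)).comp_right hα₂
  refine (hL.eq_iff hR).2 ⟨S.aNat_natural a b c, ?_⟩
  change (S.aNat f₁.as g₁.as h₁.as).hom ≫
      (P.map₂ a (P.map₂ b c' + P.map₂ b' c) + P.map₂ a' (P.map₂ b c)) ▷ P.a X'.as Y'.as Z'.as =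
    P.a X.as Y.as Z.as ◁ (P.map₂ (P.map₂ a b) c' + P.map₂ (P.map₂ a b' + P.map₂ a' b) c) ≫
      (S.aNat f₂.as g₂.as h₂.as).hom
  simp only [TensorCore.IsLinear.map₂_add_left K, TensorCore.IsLinear.map₂_add_right K,
    LinearBicategory.add_whiskerRight K, LinearBicategory.whiskerLeft_add K,
    Preadditive.comp_add, Preadditive.add_comp, S.aNat_natural, add_assoc]

include hφ

/-- The pseudofunctorial structure `⊗̂ + φ ε`. -/
def dualPseudofunctor : TensorPseudofunctor (P.ext K (DualNumber K)) where
  tensorator f g f' g' := dualIso (f := (P.ext K (DualNumber K)).map f g ≫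
      (P.ext K (DualNumber K)).map f' g') (g := (P.ext K (DualNumber K)).map (f ≫ f') (g ≫ g'))
    (S.tensorator f.as g.as f'.as g'.as) (φ _ _ _ _ _ _ f.as g.as f'.as g'.as)
  unit X Y := inclIso (f := (P.ext K (DualNumber K)).map (𝟙 X) (𝟙 Y))
    (g := 𝟙 ((P.ext K (DualNumber K)).obj X Y)) (S.unit X.as Y.as)
  tensorator_natural τ σ τ' σ' := by
    obtain ⟨a, a', hτ⟩ := exists_dualCell τ
    obtain ⟨b, b', hσ⟩ := exists_dualCell σ
    obtain ⟨c, c', hτ'⟩ := exists_dualCell τ'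
    obtain ⟨d, d', hσ'⟩ := exists_dualCell σ'
    exact (tensorator_natural_iff S _ (fun _ _ _ _ => rfl) hτ hσ hτ' hσ').2 (hφ.1.1.1 a b c d)
  tensorator_assoc f g f' g' f'' g'' := by
    refine (tensorator_assoc_iff S _ (fun _ _ _ _ => rfl) f g f' g' f'' g'').2 ?_
    rw [LinearMap.mem_ker.1 hφ.2]; rfl
  tensorator_id_left f g :=
    (tensorator_id_left_iff S _ (fun _ _ _ _ => rfl) f g (.incl _)).2 (hφ.1.1.2 f.as g.as).1
  tensorator_id_right f g :=
    (tensorator_id_right_iff S _ (fun _ _ _ _ => rfl) f g (.incl _)).2 (hφ.1.1.2 f.as g.as).2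

end OfCocycle

end Classification

/-! ### Semigroupal structures on the identity with identity 1-cells -/

/-- Unlike in `CellEq.eq_iff`, the stripped cells may have different boundaries. This is needed to
compare cells on f ⊗ (g ⊗ h) with cells on (f ⊗ g) ⊗ h. -/
theorem CellEq.eq_iff_cellEq {C : Type u} [Bicategory.{w, v} C] {X Y X' Y' X'' Y'' : C}
    {f g : X ⟶ Y} {f' g' : X' ⟶ Y'} {f'' g'' : X'' ⟶ Y''} {η θ : f ⟶ g} {η' : f' ⟶ g'}
    {θ' : f'' ⟶ g''} (e : CellEq η η') (e' : CellEq θ θ') : η = θ ↔ CellEq η' θ' :=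
  ⟨fun h => (e.symm.trans (.of_eq h)).trans e', fun h => ((e.trans h).trans e'.symm).eq⟩

section IdentityPsi

variable {C : Type u} [Bicategory.{w, v} C] [Bicategory.Strict C] {P : TensorCore C}

theorem IsIdentity.exists_inverse {X Y : C} {f : X ⟶ Y} (hf : IsIdentity f) :
    ∃ b : Y ⟶ X, f ≫ b = 𝟙 X ∧ b ≫ f = 𝟙 Y := by
  cases hf
  exact ⟨𝟙 X, Bicategory.Strict.comp_id _, Bicategory.Strict.comp_id _⟩

variable {S S' : SemigroupalStructure P} (hS' : S'.toTensorPseudofunctor.IsUnitary)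
  (ha : ∀ X Y Z : C, IsIdentity (P.a X Y Z))
  (haN : ∀ {X X' Y Y' Z Z' : C} (f : X ⟶ X') (g : Y ⟶ Y') (h : Z ⟶ Z'),
    IsIdentity (S.aNat f g h).hom)
  (haN' : ∀ {X X' Y Y' Z Z' : C} (f : X ⟶ X') (g : Y ⟶ Y') (h : Z ⟶ Z'),
    IsIdentity (S'.aNat f g h).hom)
  {ψ : ∀ X Y : C, P.obj X Y ⟶ P.obj X Y} (hψ : ∀ X Y : C, IsIdentity (ψ X Y))
  (ψNat : ∀ {X X' Y Y' : C} (f : X ⟶ X') (g : Y ⟶ Y'),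
    ψ X Y ≫ P.map f g ≅ P.map f g ≫ ψ X' Y')
  {ψBar : ∀ {X X' Y Y' : C} (f : X ⟶ X') (g : Y ⟶ Y'), P.map f g ⟶ P.map f g}
  (hψNat : ∀ {X X' Y Y' : C} (f : X ⟶ X') (g : Y ⟶ Y'), CellEq (ψNat f g).hom (ψBar f g))
  (ω : ∀ X Y Z : C,
    P.map (𝟙 X) (ψ Y Z) ≫ ψ X (P.obj Y Z) ≫ P.a X Y Z ≅
      P.a X Y Z ≫ P.map (ψ X Y) (𝟙 Z) ≫ ψ (P.obj X Y) Z)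
  (hω : ∀ X Y Z : C, IsIdentity (ω X Y Z).hom)

include hS' ha haN haN' hψ hψNat hω

/-- Apart from ψ̂, every pasted cell is an identity, and the squares reduce to plain tensor products
because their sides are identities. Two occurrences of ψ̂ survive on each side. -/
theorem omega_natural_iff {X X' Y Y' Z Z' : C} (f : X ⟶ X') (g : Y ⟶ Y') (h : Z ⟶ Z') :
    (𝟙 _ ⊗≫
        (P.map (𝟙 X) (ψ Y Z) ≫ ψ X (P.obj Y Z)) ◁ (S.aNat f g h).hom ⊗≫
        P.map (𝟙 X) (ψ Y Z) ◁ ((ψNat f (P.map g h)).hom ▷ P.a X' Y' Z') ⊗≫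
        S'.square (idComm f).hom (ψNat g h).hom ▷ (ψ X' (P.obj Y' Z') ≫ P.a X' Y' Z') ⊗≫
        P.map f (P.map g h) ◁ (ω X' Y' Z').hom =
      (ω X Y Z).hom ▷ P.map (P.map f g) h ⊗≫
        (P.a X Y Z ≫ P.map (ψ X Y) (𝟙 Z)) ◁ (ψNat (P.map f g) h).hom ⊗≫
        P.a X Y Z ◁ (S'.square (ψNat f g).hom (idComm h).hom ▷ ψ (P.obj X' Y') Z') ⊗≫
        (S'.aNat f g h).hom ▷ (P.map (ψ X' Y') (𝟙 Z') ≫ ψ (P.obj X' Y') Z') ⊗≫ 𝟙 _) ↔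
      CellEq (ψBar f (P.map g h) ≫ P.map₂ (𝟙 f) (ψBar g h))
        (ψBar (P.map f g) h ≫ P.map₂ (ψBar f g) (𝟙 h)) := by
  have hid : ∀ {X X' : C} (f : X ⟶ X'), CellEq (idComm f).hom (𝟙 f) := fun f =>
    .of_comp_left (.leftUnitor_hom f) (.of_isIdentity (IsIdentity.rightUnitor_hom f).inv)
  refine CellEq.eq_iff_cellEq ?_ ?_
  · exact .of_bicategoricalComp_left (.id _) (.of_bicategoricalComp_left
      (.whiskerLeft _ (haN f g h)) (.bicategoricalComp
        (.of_whiskerLeft (hS'.map (.id X) (hψ Y Z))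
          (.of_whiskerRight (ha X' Y' Z') (hψNat f (P.map g h))))
        (.of_bicategoricalComp_right (.whiskerLeft _ (hω X' Y' Z'))
          (.of_whiskerRight ((hψ _ _).comp₁ (ha _ _ _))
            (hS'.cellEq_square (.id X) (hψ Y Z) (.id X') (hψ Y' Z') (hid f) (hψNat g h))))))
  · exact .of_bicategoricalComp_left (.whiskerRight (hω X Y Z) _) (.bicategoricalComp
      (.of_whiskerLeft ((ha X Y Z).comp₁ (hS'.map (hψ X Y) (.id Z))) (hψNat (P.map f g) h))
      (.of_bicategoricalComp_right
        (.bicategoricalComp (.whiskerRight (haN' f g h) _) (.id _))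
        (.of_whiskerLeft (ha X Y Z) (.of_whiskerRight (hψ _ _)
          (hS'.cellEq_square (hψ X Y) (.id Z) (hψ X' Y') (.id Z') (hψNat f g) (hid h))))))

variable (hS : S.toTensorPseudofunctor.IsUnitary)
  (hp : ∀ X Y Z T : C, IsIdentity (S.pent X Y Z T).hom)
  (hp' : ∀ X Y Z T : C, IsIdentity (S'.pent X Y Z T).hom)

include hS hp hp'

/-- A semigroupal structure on the identity 2-functor with identity 1-cells `ψ_{X,Y}` and identity
2-cells `ω_{X,Y,Z}`. -/
def idSemigroupalStructure
    (hψid : ∀ {X X' Y Y' : C} (f : X ⟶ X') (g : Y ⟶ Y'), IsIdentity f → IsIdentity g →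
      IsIdentity (ψNat f g).hom)
    (ψNat_natural : ∀ {X X' Y Y' : C} {f₁ f₂ : X ⟶ X'} {g₁ g₂ : Y ⟶ Y'} (τ : f₁ ⟶ f₂)
      (σ : g₁ ⟶ g₂),
      (ψNat f₁ g₁).hom ≫ P.map₂ τ σ ▷ ψ X' Y' = ψ X Y ◁ P.map₂ τ σ ≫ (ψNat f₂ g₂).hom)
    (ψNat_comp : ∀ {X X' X'' Y Y' Y'' : C} (f : X ⟶ X') (g : Y ⟶ Y') (f' : X' ⟶ X'')
      (g' : Y' ⟶ Y''),
      ψ X Y ◁ (S.tensorator f g f' g').hom ≫ (ψNat (f ≫ f') (g ≫ g')).hom =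
        (α_ _ _ _).inv ≫ (ψNat f g).hom ▷ P.map f' g' ≫ (α_ _ _ _).hom ≫
          P.map f g ◁ (ψNat f' g').hom ≫ (α_ _ _ _).inv ≫
          (S'.tensorator f g f' g').hom ▷ ψ X'' Y'')
    (hBar : ∀ {X X' Y Y' Z Z' : C} (f : X ⟶ X') (g : Y ⟶ Y') (h : Z ⟶ Z'),
      CellEq (ψBar f (P.map g h) ≫ P.map₂ (𝟙 f) (ψBar g h))
        (ψBar (P.map f g) h ≫ P.map₂ (ψBar f g) (𝟙 h))) :
    IdSemigroupalStructure S S' ψ where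
  ψ_invertible X Y := (hψ X Y).exists_inverse
  ψNat := ψNat
  ω := ω
  ψNat_natural := ψNat_natural
  ψNat_comp := ψNat_comp
  ψNat_id X Y := by
    refine IsIdentity.unique ?_ ?_
    · exact (hψid _ _ (.id X) (.id Y)).comp
        (.comp (.whiskerRight (hS'.unit X Y) _) (.leftUnitor_hom _))
    · exact .comp (.whiskerLeft _ (hS.unit X Y)) (.rightUnitor_hom _)
  ω_natural f g h :=
    (omega_natural_iff hS' ha haN haN' hψ ψNat hψNat ω hω f g h).2 (hBar f g h)
  ω_coherence X Y Z T := by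
    -- Here ψ̂ is evaluated only at pairs made of a and identity 1-cells, where `hψid` applies, and
    -- the tensorators likewise. The relation therefore puts no further condition on ψ̂.
    apply IsIdentity.unique
    all_goals repeat' first
      | exact haN _ _ _
      | exact haN' _ _ _
      | exact hp _ _ _ _
      | exact hp' _ _ _ _
      | exact ha _ _ _
      | exact hψ _ _
      | exact hω _ _ _
      | exact .id _
      | exact hS.unit _ _
      | exact hS'.unit _ _
      | apply hψid
      | apply IsIdentity.inv
      | apply hS'.square
      | apply hS'.compL₃
      | apply hS'.compR₃
      | apply hS'.map
      | apply IsIdentity.map₂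
      | apply IsIdentity.bicategoricalComp
      | apply IsIdentity.whiskerLeft
      | apply IsIdentity.whiskerRight
      | apply IsIdentity.comp

end IdentityPsi

theorem add_eq_add_iff_sub_add_sub_eq_zero {A : Type*} [AddCommGroup A] (a b c d : A) :
    a + c = d + b ↔ a - b + c - d = 0 := by
  rw [← sub_eq_zero]
  refine Eq.congr_left ?_
  abel

/-! ### First order expansion of ψ-equivalences -/

section PsiEquivalence

open ScalarExt

theorem ScalarExt.isIdentity_as {K R : Type*} {C : Type u} [Bicategory.{w, v} C]
    {X Y : ScalarExt K R C} {f : X ⟶ Y}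
    (hf : IsIdentity f) : IsIdentity f.as := by
  cases hf; exact .id _

variable {K : Type*} [CommRing K] {C : Type u} [Bicategory.{w, v} C]
  [∀ X Y : C, Preadditive (X ⟶ Y)] [∀ X Y : C, Linear K (X ⟶ Y)]
  [LinearBicategory K C] {P : TensorCore C} [P.IsLinear K] {S : SemigroupalStructure P}

/-- On a pair of identities the leading term ⊗̂ is an identity and the special cochain φ vanishes.
-/
theorem TensorPseudofunctor.isUnitary_of_isDual (hS : S.IsGray) {φ : Cochain₂ P}
    (hφ : φ ∈ SemigroupalStructure.special₂ K P)
    (T : TensorPseudofunctor (P.ext K (DualNumber K)))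
    (hu : ∀ X Y, IsDual (T.unit X Y).hom (S.unit X.as Y.as).hom 0)
    (hT : ∀ {X X' X'' Y Y' Y'' : ScalarExt K (DualNumber K) C} (f : X ⟶ X') (g : Y ⟶ Y')
      (f' : X' ⟶ X'') (g' : Y' ⟶ Y''), IsDual (T.tensorator f g f' g').hom
        (S.tensorator f.as g.as f'.as g'.as).hom (φ _ _ _ _ _ _ f.as g.as f'.as g'.as)) :
    T.IsUnitary where
  unit X Y := (hu X Y).isIdentity rfl (hS.unit _ _)
  left {_ _ _ _ _ _ f g} f' g' hf hg := (hT f g f' g').isIdentity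
    (SemigroupalStructure.special₂_left hφ _ _ (isIdentity_as hf) (isIdentity_as hg))
    (hS.isUnitary.left _ _ (isIdentity_as hf) (isIdentity_as hg))
  right f g f' g' hf hg := (hT f g f' g').isIdentity
    (SemigroupalStructure.special₂_right hφ _ _ (isIdentity_as hf) (isIdentity_as hg))
    (hS.isUnitary.right _ _ (isIdentity_as hf) (isIdentity_as hg))

theorem SemigroupalStructure.IsGray.isIdentity_ext_a (hS : S.IsGray)
    (X Y Z : ScalarExt K (DualNumber K) C) : IsIdentity ((P.ext K (DualNumber K)).a X Y Z) :=
  isIdentity_mk (hS.a X.as Y.as Z.as)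

namespace FirstOrderDeformation

theorem isUnitary (hS : S.IsGray) (D : FirstOrderDeformation K S) :
    D.toTensorPseudofunctor.IsUnitary :=
  TensorPseudofunctor.isUnitary_of_isDual hS (cocycle_mem D).1.1 _ (isDual_unit D)
    (isDual_tensorator D)

theorem isIdentity_aNat (hS : S.IsGray) (D : FirstOrderDeformation K S)
    {X X' Y Y' Z Z' : ScalarExt K (DualNumber K) C} (f : X ⟶ X') (g : Y ⟶ Y') (h : Z ⟶ Z') :
    IsIdentity (D.aNat f g h).hom :=
  (isDual_aNat D f g h).isIdentity rfl (hS.aNat _ _ _)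

theorem isIdentity_pent (hS : S.IsGray) (D : FirstOrderDeformation K S)
    (X Y Z T : ScalarExt K (DualNumber K) C) : IsIdentity (D.pent X Y Z T).hom := by
  rw [D.pent_eq]; exact isIdentity_incl (hS.pent _ _ _ _)

variable [Bicategory.Strict C]

/-- The deformation with tensorator `⊗̂ + φ ε`. -/
def ofCocycle (hS : S.IsGray) {φ : Cochain₂ P} (hφ : φ ∈ S.Z2tens K) :
    FirstOrderDeformation K S where
  toSemigroupalStructure := TensorPseudofunctor.IsUnitary.semigroupalStructure
    (dualPseudofunctor S hφ)
    (TensorPseudofunctor.isUnitary_of_isDual hS hφ.1.1 _ (fun _ _ => .incl _)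
      (fun _ _ _ _ => rfl))
    hS.isIdentity_ext_a
    (fun f g h => inclIso (S.aNat f.as g.as h.as))
    (fun f g h => isIdentity_incl (hS.aNat f.as g.as h.as))
    (fun X Y Z T => inclIso (S.pent X.as Y.as Z.as T.as))
    (fun X Y Z T => isIdentity_incl (hS.pent X.as Y.as Z.as T.as))
    (fun τ σ η => aNat_natural_ext S τ σ η (.incl _) (.incl _))
    (fun f g h f' g' h' => (aNat_comp_iff S _ (fun _ _ _ _ => rfl) _ (fun _ _ _ => .incl _)
      f g h f' g' h').2 (by rw [LinearMap.mem_ker.1 hφ.1.2]; rfl))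
  tensorator_mod f g f' g' := sub_incl_mem_iff.2 ⟨_, rfl⟩
  unit_eq _ _ := rfl
  aNat_eq _ _ _ := rfl
  pent_eq _ _ _ _ := rfl

theorem cocycle_ofCocycle (hS : S.IsGray) {φ : Cochain₂ P} (hφ : φ ∈ S.Z2tens K) :
    cocycle (ofCocycle hS hφ) = φ := by
  funext X X' X'' Y Y' Y'' f g f' g'
  exact coeff_snd_dualCell _ _

end FirstOrderDeformation

section

variable {χ : Cochain₁ P}
  {ψ : ∀ {X X' Y Y' : ScalarExt K (DualNumber K) C} (f : X ⟶ X') (g : Y ⟶ Y'),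
    𝟙 ((P.ext K (DualNumber K)).obj X Y) ≫ (P.ext K (DualNumber K)).map f g ⟶
      (P.ext K (DualNumber K)).map f g ≫ 𝟙 ((P.ext K (DualNumber K)).obj X' Y')}
  {ψBar : ∀ {X X' Y Y' : ScalarExt K (DualNumber K) C} (f : X ⟶ X') (g : Y ⟶ Y'),
    (P.ext K (DualNumber K)).map f g ⟶ (P.ext K (DualNumber K)).map f g}
  (hBar : ∀ {X X' Y Y' : ScalarExt K (DualNumber K) C} (f : X ⟶ X') (g : Y ⟶ Y'),
    IsDual (ψBar f g) (𝟙 (P.map f.as g.as)) (χ _ _ _ _ f.as g.as))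
  (hψ : ∀ {X X' Y Y' : ScalarExt K (DualNumber K) C} (f : X ⟶ X') (g : Y ⟶ Y'),
    CellEq (ψ f g) (ψBar f g))

include hBar in
-- The leading coefficient of ψ̄ is the identity, so the ε-parts of the 2-cells appear unchanged on
-- both sides and cancel.
theorem psiBar_natural_iff {X X' Y Y' : ScalarExt K (DualNumber K) C}
    {f₁ f₂ : X ⟶ X'} {g₁ g₂ : Y ⟶ Y'} {τ : f₁ ⟶ f₂} {σ : g₁ ⟶ g₂} {a a' : f₁.as ⟶ f₂.as}
    {b b' : g₁.as ⟶ g₂.as} (hτ : IsDual τ a a') (hσ : IsDual σ b b') :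
    ψBar f₁ g₁ ≫ (P.ext K (DualNumber K)).map₂ τ σ =
        (P.ext K (DualNumber K)).map₂ τ σ ≫ ψBar f₂ g₂ ↔
      χ _ _ _ _ f₁.as g₁.as ≫ P.map₂ a b = P.map₂ a b ≫ χ _ _ _ _ f₂.as g₂.as := by
  have hL := (hBar f₁ g₁).comp (.map₂ P hτ hσ)
  have hR := (IsDual.map₂ P hτ hσ).comp (hBar f₂ g₂)
  refine (hL.eq_iff hR).trans ((and_iff_right
    ((Category.id_comp _).trans (Category.comp_id _).symm)).trans ?_)
  change 𝟙 (P.map f₁.as g₁.as) ≫ (P.map₂ a b' + P.map₂ a' b) + χ _ _ _ _ f₁.as g₁.as ≫ P.map₂ a b =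
    P.map₂ a b ≫ χ _ _ _ _ f₂.as g₂.as + (P.map₂ a b' + P.map₂ a' b) ≫ 𝟙 (P.map f₂.as g₂.as) ↔ _
  rw [Category.id_comp, Category.comp_id, add_comm, add_left_inj]

include hBar in
-- To first order the equation is φ + ⊗̂·χ(f'f, g'g) = φ' + ⊗̂·(1 ∘ χ(f',g')) + ⊗̂·(χ(f,g) whiskered
-- by f' ⊗ g'). Isolating φ - φ' leaves the three terms of δ_h χ.
theorem psiBar_comp_iff {φ φ' : Cochain₂ P}
    {T T' : ∀ {X X' X'' Y Y' Y'' : ScalarExt K (DualNumber K) C} (f : X ⟶ X') (g : Y ⟶ Y')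
      (f' : X' ⟶ X'') (g' : Y' ⟶ Y''),
      (P.ext K (DualNumber K)).map f g ≫ (P.ext K (DualNumber K)).map f' g' ⟶
        (P.ext K (DualNumber K)).map (f ≫ f') (g ≫ g')}
    (hT : ∀ {X X' X'' Y Y' Y'' : ScalarExt K (DualNumber K) C} (f : X ⟶ X') (g : Y ⟶ Y')
      (f' : X' ⟶ X'') (g' : Y' ⟶ Y''), IsDual (T f g f' g')
        (S.tensorator f.as g.as f'.as g'.as).hom (φ _ _ _ _ _ _ f.as g.as f'.as g'.as))
    (hT' : ∀ {X X' X'' Y Y' Y'' : ScalarExt K (DualNumber K) C} (f : X ⟶ X') (g : Y ⟶ Y')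
      (f' : X' ⟶ X'') (g' : Y' ⟶ Y''), IsDual (T' f g f' g')
        (S.tensorator f.as g.as f'.as g'.as).hom (φ' _ _ _ _ _ _ f.as g.as f'.as g'.as))
    {X X' X'' Y Y' Y'' : ScalarExt K (DualNumber K) C} (f : X ⟶ X') (g : Y ⟶ Y')
    (f' : X' ⟶ X'') (g' : Y' ⟶ Y'') :
    T f g f' g' ≫ ψBar (f ≫ f') (g ≫ g') =
        ψBar f g ▷ (P.ext K (DualNumber K)).map f' g' ≫
          (P.ext K (DualNumber K)).map f g ◁ ψBar f' g' ≫ T' f g f' g' ↔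
      S.deltaH₁ K χ _ _ _ _ _ _ f.as g.as f'.as g'.as =
        (φ - φ') _ _ _ _ _ _ f.as g.as f'.as g'.as := by
  have hL := (hT f g f' g').comp (hBar (f ≫ f') (g ≫ g'))
  have hR := ((hBar f g).whiskerRight ((P.ext K (DualNumber K)).map f' g')).comp
    (((hBar f' g').whiskerLeft ((P.ext K (DualNumber K)).map f g)).comp (hT' f g f' g'))
  refine (hL.eq_iff hR).trans ((and_iff_right ?_).trans ?_)
  · change (S.tensorator f.as g.as f'.as g'.as).hom ≫ 𝟙 _ =
      𝟙 (P.map f.as g.as) ▷ P.map f'.as g'.as ≫ P.map f.as g.as ◁ 𝟙 (P.map f'.as g'.as) ≫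
        (S.tensorator f.as g.as f'.as g'.as).hom
    simp
  · change (S.tensorator f.as g.as f'.as g'.as).hom ≫ χ _ _ _ _ (f.as ≫ f'.as) (g.as ≫ g'.as) +
          φ _ _ _ _ _ _ f.as g.as f'.as g'.as ≫ 𝟙 (P.map (f.as ≫ f'.as) (g.as ≫ g'.as)) =
        𝟙 (P.map f.as g.as) ▷ P.map f'.as g'.as ≫
            (P.map f.as g.as ◁ 𝟙 (P.map f'.as g'.as) ≫ φ' _ _ _ _ _ _ f.as g.as f'.as g'.as +
              P.map f.as g.as ◁ χ _ _ _ _ f'.as g'.as ≫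
                (S.tensorator f.as g.as f'.as g'.as).hom) +
          χ _ _ _ _ f.as g.as ▷ P.map f'.as g'.as ≫
            P.map f.as g.as ◁ 𝟙 (P.map f'.as g'.as) ≫
              (S.tensorator f.as g.as f'.as g'.as).hom ↔
      χ _ _ _ _ f.as g.as ▷ P.map f'.as g'.as ≫ (S.tensorator f.as g.as f'.as g'.as).hom -
          (S.tensorator f.as g.as f'.as g'.as).hom ≫ χ _ _ _ _ (f.as ≫ f'.as) (g.as ≫ g'.as) +
          P.map f.as g.as ◁ χ _ _ _ _ f'.as g'.as ≫ (S.tensorator f.as g.as f'.as g'.as).hom =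
        φ _ _ _ _ _ _ f.as g.as f'.as g'.as - φ' _ _ _ _ _ _ f.as g.as f'.as g'.as
    simp only [Bicategory.whiskerLeft_id, Bicategory.id_whiskerRight, Category.id_comp,
      Category.comp_id]
    rw [eq_comm, ← sub_eq_zero, ← sub_eq_zero (b := _ - _)]
    refine Eq.congr_left ?_
    abel

include hBar in
-- The leading coefficients are the identities of f ⊗ (g ⊗ h) and (f ⊗ g) ⊗ h, which are the same
-- 1-cell in a Gray semigroup. The ε-coefficients are two sums of two terms whose difference is δ_v
-- χ, once â and a are stripped from the latter.
theorem psiBar_aNat_iff (hS : S.IsGray) [Bicategory.Strict C]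
    {X X' Y Y' Z Z' : ScalarExt K (DualNumber K) C} (f : X ⟶ X') (g : Y ⟶ Y') (h : Z ⟶ Z') :
    CellEq (ψBar f ((P.ext K (DualNumber K)).map g h) ≫
          (P.ext K (DualNumber K)).map₂ (𝟙 f) (ψBar g h))
        (ψBar ((P.ext K (DualNumber K)).map f g) h ≫
          (P.ext K (DualNumber K)).map₂ (ψBar f g) (𝟙 h)) ↔
      S.deltaV₁ K χ _ _ _ _ _ _ f.as g.as h.as = 0 := by
  have hL : IsDual (ψBar f ((P.ext K (DualNumber K)).map g h) ≫
      (P.ext K (DualNumber K)).map₂ (𝟙 f) (ψBar g h)) (𝟙 (P.map f.as (P.map g.as h.as)))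
      (P.map₂ (𝟙 f.as) (χ _ _ _ _ g.as h.as) + χ _ _ _ _ f.as (P.map g.as h.as)) := by
    have := (hBar f ((P.ext K (DualNumber K)).map g h)).comp
      (IsDual.map₂_left P (.id f) (hBar g h))
    refine (this.eq_iff rfl).2 ⟨?_, ?_⟩
    · change 𝟙 (P.map f.as (P.map g.as h.as)) ≫ P.map₂ (𝟙 f.as) (𝟙 (P.map g.as h.as)) = 𝟙 _
      rw [P.map₂_id, Category.comp_id]
    · change 𝟙 (P.map f.as (P.map g.as h.as)) ≫ P.map₂ (𝟙 f.as) (χ _ _ _ _ g.as h.as) +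
        χ _ _ _ _ f.as (P.map g.as h.as) ≫ P.map₂ (𝟙 f.as) (𝟙 (P.map g.as h.as)) = _
      rw [P.map₂_id, Category.comp_id, Category.id_comp]
  have hR : IsDual (ψBar ((P.ext K (DualNumber K)).map f g) h ≫
      (P.ext K (DualNumber K)).map₂ (ψBar f g) (𝟙 h)) (𝟙 (P.map (P.map f.as g.as) h.as))
      (P.map₂ (χ _ _ _ _ f.as g.as) (𝟙 h.as) + χ _ _ _ _ (P.map f.as g.as) h.as) := by
    have := (hBar ((P.ext K (DualNumber K)).map f g) h).comp
      (IsDual.map₂_right P (hBar f g) (.id h))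
    refine (this.eq_iff rfl).2 ⟨?_, ?_⟩
    · change 𝟙 (P.map (P.map f.as g.as) h.as) ≫ P.map₂ (𝟙 (P.map f.as g.as)) (𝟙 h.as) = 𝟙 _
      rw [P.map₂_id, Category.comp_id]
    · change 𝟙 (P.map (P.map f.as g.as) h.as) ≫ P.map₂ (χ _ _ _ _ f.as g.as) (𝟙 h.as) +
        χ _ _ _ _ (P.map f.as g.as) h.as ≫ P.map₂ (𝟙 (P.map f.as g.as)) (𝟙 h.as) = _
      rw [P.map₂_id, Category.comp_id, Category.id_comp]
  have hα := hS.aNat f.as g.as h.as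
  have ha := hS.a X.as Y.as Z.as
  have ha' := hS.a X'.as Y'.as Z'.as
  -- Since â and a are identities, the identity 2-cell of either bracketing can be compared with â.
  -- This is how the two boundaries are identified.
  have h₁ : CellEq (S.aNat f.as g.as h.as).hom (𝟙 (P.map (P.map f.as g.as) h.as)) := by
    refine (CellEq.of_isIdentity hα).trans ?_
    rw [← Bicategory.whiskerLeft_id]
    exact .of_whiskerLeft ha (.refl _)
  have h₂ : CellEq (S.aNat f.as g.as h.as).hom (𝟙 (P.map f.as (P.map g.as h.as))) := by
    refine (CellEq.of_isIdentity' hα).trans ?_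
    rw [← Bicategory.id_whiskerRight]
    exact .of_whiskerRight ha' (.refl _)
  have hid := h₂.symm.trans h₁
  rw [hL, hR]
  refine (CellEq.dualCell_iff hid).trans ?_
  -- Each summand of δ_v χ loses its â and its whiskering by a, which returns the four bare terms.
  have e₁ : CellEq ((S.aNat f.as g.as h.as).hom ≫
      P.map₂ (𝟙 f.as) (χ _ _ _ _ g.as h.as) ▷ P.a X'.as Y'.as Z'.as) _ :=
    .of_comp_left hα (.of_whiskerRight ha' (.refl _))
  have e₂ : CellEq (P.a X.as Y.as Z.as ◁ χ _ _ Z.as Z'.as (P.map f.as g.as) h.as ≫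
      (S.aNat f.as g.as h.as).hom) _ :=
    .of_comp_right hα (.of_whiskerLeft ha (.refl _))
  have e₃ : CellEq ((S.aNat f.as g.as h.as).hom ≫
      χ X.as X'.as _ _ f.as (P.map g.as h.as) ▷ P.a X'.as Y'.as Z'.as) _ :=
    .of_comp_left hα (.of_whiskerRight ha' (.refl _))
  have e₄ : CellEq (P.a X.as Y.as Z.as ◁ P.map₂ (χ _ _ _ _ f.as g.as) (𝟙 h.as) ≫
      (S.aNat f.as g.as h.as).hom) _ :=
    .of_comp_right hα (.of_whiskerLeft ha (.refl _))
  refine (CellEq.eq_iff_cellEq (e₁.add e₃) (e₄.add e₂)).symm.trans ?_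
  exact add_eq_add_iff_sub_add_sub_eq_zero _ _ _ _

end

end PsiEquivalence

/-! ### ψ-equivalent deformations have cohomologous cocycles, and conversely -/

section Main

open ScalarExt FirstOrderDeformation

variable {K : Type*} [CommRing K] {C : Type u} [Bicategory.{w, v} C]
  [∀ X Y : C, Preadditive (X ⟶ Y)] [∀ X Y : C, Linear K (X ⟶ Y)]
  [LinearBicategory K C]

theorem isDual_idComm {X Y : ScalarExt K (DualNumber K) C} (f : X ⟶ Y) :
    IsDual (idComm f).hom (idComm f.as).hom 0 :=
  (IsDual.leftUnitor_hom f).comp_zero (.rightUnitor_inv f)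

theorem CellEq.psi_natural_iff {D : Type u} [Bicategory.{w, v} D] [Bicategory.Strict D]
    {X Y : D} {f g : X ⟶ Y} {ψ₁ : 𝟙 X ≫ f ⟶ f ≫ 𝟙 Y} {ψ₂ : 𝟙 X ≫ g ⟶ g ≫ 𝟙 Y} {η₁ : f ⟶ f}
    {η₂ : g ⟶ g} (h₁ : CellEq ψ₁ η₁) (h₂ : CellEq ψ₂ η₂) (τ : f ⟶ g) :
    ψ₁ ≫ τ ▷ 𝟙 Y = 𝟙 X ◁ τ ≫ ψ₂ ↔ η₁ ≫ τ = τ ≫ η₂ :=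
  CellEq.eq_iff (h₁.comp (.of_whiskerRight (.id Y) (.refl τ)))
    (.comp (.of_whiskerLeft (.id X) (.refl τ)) h₂)

/-- Whiskerings by identity 1-cells and associators are removed, so the composition axiom for ψ̂
becomes an equation between cells on f, g and h alone. -/
theorem CellEq.psi_comp_iff {D : Type u} [Bicategory.{w, v} D] [Bicategory.Strict D]
    {X Y Z : D} {f : X ⟶ Y} {g : Y ⟶ Z} {h : X ⟶ Z} {ψ₁ : 𝟙 X ≫ f ⟶ f ≫ 𝟙 Y}
    {ψ₂ : 𝟙 Y ≫ g ⟶ g ≫ 𝟙 Z} {ψ₃ : 𝟙 X ≫ h ⟶ h ≫ 𝟙 Z} {η₁ : f ⟶ f}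
    {η₂ : g ⟶ g} {η₃ : h ⟶ h} (h₁ : CellEq ψ₁ η₁) (h₂ : CellEq ψ₂ η₂) (h₃ : CellEq ψ₃ η₃)
    (τ τ' : f ≫ g ⟶ h) :
    𝟙 X ◁ τ ≫ ψ₃ = (α_ _ _ _).inv ≫ ψ₁ ▷ g ≫ (α_ _ _ _).hom ≫ f ◁ ψ₂ ≫ (α_ _ _ _).inv ≫
        τ' ▷ 𝟙 Z ↔
      τ ≫ η₃ = η₁ ▷ g ≫ f ◁ η₂ ≫ τ' :=
  CellEq.eq_iff (.comp (.of_whiskerLeft (.id X) (.refl τ)) h₃)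
    (.of_comp_left (IsIdentity.associator_hom _ _ _).inv (.comp (.whiskerRight h₁ g)
      (.of_comp_left (.associator_hom _ _ _) (.comp (.whiskerLeft f h₂)
        (.of_comp_left (IsIdentity.associator_hom _ _ _).inv
          (.of_whiskerRight (.id Z) (.refl τ')))))))

variable [Bicategory.Strict C] {P : TensorCore C} [P.IsLinear K] {S : SemigroupalStructure P}

namespace FirstOrderDeformation

/-- The cochain χ is the ε-coefficient of ψ̂. The axioms of ψ-equivalence then give naturality,
vanishing on identities, δ_v χ = 0 and δ_h χ, one each. -/
theorem exists_of_psiEquivalent (hS : S.IsGray) {D D' : FirstOrderDeformation K S}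
    (h : PsiEquivalent D D') :
    ∃ χ ∈ S.Xtens₁ K, S.deltaH₁ K χ = cocycle D - cocycle D' := by
  obtain ⟨E, hE, hω⟩ := h
  -- The unitors turn the ε-coefficient, a cell 𝟙 ≫ (f ⊗ g) ⟹ (f ⊗ g) ≫ 𝟙, into an endomorphism of f
  -- ⊗ g.
  let χ : Cochain₁ P := fun X X' Y Y' f g => (λ_ (P.map f g)).inv ≫
    coeff (TrivSqZeroExt.sndHom K K) (E.ψNat (X := ⟨X⟩) (X' := ⟨X'⟩) (Y := ⟨Y⟩) (Y' := ⟨Y'⟩)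
      ⟨f⟩ ⟨g⟩).hom ≫ (ρ_ (P.map f g)).hom
  have hBar : ∀ {X X' Y Y' : ScalarExt K (DualNumber K) C} (f : X ⟶ X') (g : Y ⟶ Y'),
      IsDual ((λ_ ((P.ext K (DualNumber K)).map f g)).inv ≫ (E.ψNat f g).hom ≫
        (ρ_ ((P.ext K (DualNumber K)).map f g)).hom) (𝟙 (P.map f.as g.as))
        (χ _ _ _ _ f.as g.as) := by
    intro X X' Y Y' f g
    have hm := hE f g
    rw [isDual_idComm, ← incl_eq_dualCell] at hm
    obtain ⟨b, hb⟩ := sub_incl_mem_iff.1 hm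
    have hχ : χ _ _ _ _ f.as g.as = (λ_ (P.map f.as g.as)).inv ≫ b ≫
        (ρ_ (P.map f.as g.as)).hom :=
      congrArg (fun x => (λ_ (P.map f.as g.as)).inv ≫ x ≫ (ρ_ (P.map f.as g.as)).hom)
        ((congrArg (coeff (TrivSqZeroExt.sndHom K K)) hb).trans (coeff_snd_dualCell _ _))
    have hd := (IsDual.leftUnitor_inv ((P.ext K (DualNumber K)).map f g)).comp_left
      ((show IsDual (E.ψNat f g).hom _ _ from hb).comp_right
        (.rightUnitor_hom ((P.ext K (DualNumber K)).map f g)))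
    refine (hd.eq_iff rfl).2 ⟨?_, hχ.symm⟩
    change (λ_ (P.map f.as g.as)).inv ≫ ((λ_ (P.map f.as g.as)).hom ≫
      (ρ_ (P.map f.as g.as)).inv) ≫ (ρ_ (P.map f.as g.as)).hom = 𝟙 _
    simp
  have hψ : ∀ {X X' Y Y' : ScalarExt K (DualNumber K) C} (f : X ⟶ X') (g : Y ⟶ Y'),
      CellEq (E.ψNat f g).hom ((λ_ ((P.ext K (DualNumber K)).map f g)).inv ≫ (E.ψNat f g).hom ≫
        (ρ_ ((P.ext K (DualNumber K)).map f g)).hom) := fun f g =>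
    (CellEq.of_comp_left (IsIdentity.leftUnitor_hom _).inv
      (.of_comp_right (.rightUnitor_hom _) (.refl _))).symm
  have hD' := isUnitary hS D'
  have hD := isUnitary hS D
  refine ⟨χ, ⟨⟨?_, ?_⟩, ?_⟩, ?_⟩
  · intro X X' Y Y' f₁ f₂ g₁ g₂ τ σ
    exact (psiBar_natural_iff (X := ⟨X⟩) (X' := ⟨X'⟩) (Y := ⟨Y⟩) (Y' := ⟨Y'⟩) (f₁ := ⟨f₁⟩)
      (f₂ := ⟨f₂⟩) (g₁ := ⟨g₁⟩) (g₂ := ⟨g₂⟩) hBar (.incl τ) (.incl σ)).1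
      ((CellEq.psi_natural_iff (hψ _ _) (hψ _ _) _).1 (E.ψNat_natural _ _))
  · intro X Y
    have hid := E.ψNat_id ⟨X⟩ ⟨Y⟩
    have hu := hD.unit ⟨X⟩ ⟨Y⟩
    have hr := IsIdentity.comp (.whiskerLeft (𝟙 ((P.ext K (DualNumber K)).obj ⟨X⟩ ⟨Y⟩)) hu)
      (.rightUnitor_hom _)
    have e : CellEq ((E.ψNat (𝟙 (⟨X⟩ : ScalarExt K (DualNumber K) C))
        (𝟙 (⟨Y⟩ : ScalarExt K (DualNumber K) C))).hom ≫
          (D'.unit ⟨X⟩ ⟨Y⟩).hom ▷ 𝟙 ((P.ext K (DualNumber K)).obj ⟨X⟩ ⟨Y⟩) ≫ (λ_ _).hom) _ :=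
      .of_comp_right (.comp (.whiskerRight (hD'.unit _ _) _) (.leftUnitor_hom _)) (hψ _ _)
    -- The unit axiom makes ψ̄(id, id) the identity on the 1-cell of X ⊗ Y. Passing through ⊗₀
    -- returns to the boundary id ⊗ id, where coefficients can be compared with those of an
    -- identity.
    have e' := (e.symm.trans (.of_eq hid)).trans ((CellEq.of_isIdentity' hr).trans
      ((CellEq.of_isIdentity' hu).symm.trans (.of_isIdentity hu)))
    exact (((hBar _ _).eq_iff (.id _)).1 e'.eq).2
  · refine LinearMap.mem_ker.2 ?_
    funext X X' Y Y' Z Z' f g h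
    refine (psiBar_aNat_iff (X := ⟨X⟩) (X' := ⟨X'⟩) (Y := ⟨Y⟩) (Y' := ⟨Y'⟩) (Z := ⟨Z⟩)
      (Z' := ⟨Z'⟩) hBar hS ⟨f⟩ ⟨g⟩ ⟨h⟩).1 ?_
    refine (omega_natural_iff hD' hS.isIdentity_ext_a (isIdentity_aNat hS D)
      (isIdentity_aNat hS D') (fun _ _ => .id _) E.ψNat hψ E.ω ?_ _ _ _).1 (E.ω_natural _ _ _)
    intro X Y Z
    rw [hω]
    exact .bicategoricalComp (.whiskerRight (hD'.unit _ _) _)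
      (.whiskerLeft _ (.whiskerRight (hD'.unit _ _).inv _))
  · funext X X' X'' Y Y' Y'' f g f' g'
    exact (psiBar_comp_iff (X := ⟨X⟩) (X' := ⟨X'⟩) (X'' := ⟨X''⟩) (Y := ⟨Y⟩) (Y' := ⟨Y'⟩)
      (Y'' := ⟨Y''⟩) hBar (isDual_tensorator D) (isDual_tensorator D') ⟨f⟩ ⟨g⟩ ⟨f'⟩ ⟨g'⟩).1
      ((CellEq.psi_comp_iff (hψ _ _) (hψ _ _) (hψ _ _) _ _).1 (E.ψNat_comp _ _ _ _))

/-- The cell 1 + χε, completed by unitors, serves as ψ̂, and the same first order equivalences are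
used in the other direction. -/
theorem psiEquivalent_of_deltaH₁_eq (hS : S.IsGray) {D D' : FirstOrderDeformation K S}
    {χ : Cochain₁ P} (hχ : χ ∈ S.Xtens₁ K) (h : S.deltaH₁ K χ = cocycle D - cocycle D') :
    PsiEquivalent D D' := by
  let ψBar : ∀ {X X' Y Y' : ScalarExt K (DualNumber K) C} (f : X ⟶ X') (g : Y ⟶ Y'),
      (P.ext K (DualNumber K)).map f g ≅ (P.ext K (DualNumber K)).map f g := fun f g =>
    dualIso (f := (P.ext K (DualNumber K)).map f g) (g := (P.ext K (DualNumber K)).map f g)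
      (Iso.refl _) (χ _ _ _ _ f.as g.as)
  let ψNat : ∀ {X X' Y Y' : ScalarExt K (DualNumber K) C} (f : X ⟶ X') (g : Y ⟶ Y'),
      𝟙 ((P.ext K (DualNumber K)).obj X Y) ≫ (P.ext K (DualNumber K)).map f g ≅
        (P.ext K (DualNumber K)).map f g ≫ 𝟙 ((P.ext K (DualNumber K)).obj X' Y') := fun f g =>
    λ_ _ ≪≫ ψBar f g ≪≫ (ρ_ _).symm
  have hBar : ∀ {X X' Y Y' : ScalarExt K (DualNumber K) C} (f : X ⟶ X') (g : Y ⟶ Y'),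
      IsDual (ψBar f g).hom (𝟙 (P.map f.as g.as)) (χ _ _ _ _ f.as g.as) := fun f g => rfl
  have hψ : ∀ {X X' Y Y' : ScalarExt K (DualNumber K) C} (f : X ⟶ X') (g : Y ⟶ Y'),
      CellEq (ψNat f g).hom (ψBar f g).hom := fun f g =>
    CellEq.of_comp_left (IsIdentity.leftUnitor_hom _)
      (.of_comp_right (IsIdentity.rightUnitor_hom _).inv (.refl _))
  have hD' := isUnitary hS D'
  have hD := isUnitary hS D
  -- The prescribed ω, written as an isomorphism by the same formula so that the last condition of
  -- ψ-equivalence holds by `rfl`.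
  let ω : ∀ X Y Z : ScalarExt K (DualNumber K) C,
      (P.ext K (DualNumber K)).map (𝟙 X) (𝟙 ((P.ext K (DualNumber K)).obj Y Z)) ≫ 𝟙 _ ≫
          (P.ext K (DualNumber K)).a X Y Z ≅
        (P.ext K (DualNumber K)).a X Y Z ≫
          (P.ext K (DualNumber K)).map (𝟙 ((P.ext K (DualNumber K)).obj X Y)) (𝟙 Z) ≫ 𝟙 _ :=
    fun X Y Z => whiskerRightIso (D'.unit X ((P.ext K (DualNumber K)).obj Y Z)) _ ≪⊗≫
      whiskerLeftIso ((P.ext K (DualNumber K)).a X Y Z)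
        (whiskerRightIso (D'.unit ((P.ext K (DualNumber K)).obj X Y) Z).symm (𝟙 _))
  have hω : ∀ X Y Z, IsIdentity (ω X Y Z).hom := fun X Y Z =>
    .bicategoricalComp (.whiskerRight (hD'.unit _ _) _)
      (.whiskerLeft _ (.whiskerRight (hD'.unit _ _).inv _))
  refine ⟨idSemigroupalStructure (ψ := fun X Y => 𝟙 ((P.ext K (DualNumber K)).obj X Y))
    hD' hS.isIdentity_ext_a (isIdentity_aNat hS D)
    (isIdentity_aNat hS D') (fun _ _ => .id _) ψNat hψ ω hω hD (isIdentity_pent hS D)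
    (isIdentity_pent hS D') ?_ ?_ ?_ ?_, ?_, fun X Y Z => rfl⟩
  · intro X X' Y Y' f g hf hg
    refine .comp (.leftUnitor_hom _) (.comp ?_ (IsIdentity.rightUnitor_hom _).inv)
    cases hf
    cases hg
    exact (hBar _ _).isIdentity (hχ.1.2 _ _) (.id _)
  · intro X X' Y Y' f₁ f₂ g₁ g₂ τ σ
    obtain ⟨a, a', hτ⟩ := exists_dualCell τ
    obtain ⟨b, b', hσ⟩ := exists_dualCell σ
    exact (CellEq.psi_natural_iff (hψ _ _) (hψ _ _) _).2
      ((psiBar_natural_iff hBar hτ hσ).2 (hχ.1.1 a b))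
  · intro X X' X'' Y Y' Y'' f g f' g'
    exact (CellEq.psi_comp_iff (hψ _ _) (hψ _ _) (hψ _ _) _ _).2
      ((psiBar_comp_iff hBar (isDual_tensorator D) (isDual_tensorator D') f g f' g').2
        (by rw [h]))
  · intro X X' Y Y' Z Z' f g k
    exact (psiBar_aNat_iff hBar hS f g k).2 (by rw [LinearMap.mem_ker.1 hχ.2]; rfl)
  · intro X X' Y Y' f g
    rw [isDual_idComm, ← incl_eq_dualCell]
    have hd := (IsDual.leftUnitor_hom ((P.ext K (DualNumber K)).map f g)).comp_left
      ((hBar f g).comp_right (.rightUnitor_inv _))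
    have e : (λ_ (P.map f.as g.as)).hom ≫ 𝟙 _ ≫ (ρ_ (P.map f.as g.as)).inv =
        (idComm (P.map f.as g.as)).hom :=
      congrArg (fun x => (λ_ (P.map f.as g.as)).hom ≫ x) (Category.id_comp _)
    exact sub_incl_mem_iff.2 ⟨(λ_ (P.map f.as g.as)).hom ≫ χ _ _ _ _ f.as g.as ≫
      (ρ_ (P.map f.as g.as)).inv, hd.trans (congrArg (fun x => dualCell x _) e)⟩

/-- Membership in the coboundaries unfolds to the existence of the cochain χ exchanged by the two
preceding theorems. -/
theorem psiEquivalent_iff (hS : S.IsGray) {D D' : FirstOrderDeformation K S} :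
    PsiEquivalent D D' ↔ cocycle D - cocycle D' ∈ S.B2tens K :=
  ⟨exists_of_psiEquivalent hS, fun ⟨_, hχ, h⟩ => psiEquivalent_of_deltaH₁_eq hS hχ h⟩

end FirstOrderDeformation

end Main

theorem mainTheorem7 {K : Type*} [CommRing K] {C : Type u} [Bicategory.{w, v} C]
    [Bicategory.Strict C] [∀ X Y : C, Preadditive (X ⟶ Y)] [∀ X Y : C, Linear K (X ⟶ Y)]
    [LinearBicategory K C] (P : TensorCore C) [P.IsLinear K] (S : SemigroupalStructure P)
    (hS : S.IsGray) :
    Equivalence (PsiEquivalent : FirstOrderDeformation K S → FirstOrderDeformation K S → Prop) ∧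
    ∃ e : Quot (PsiEquivalent : FirstOrderDeformation K S → FirstOrderDeformation K S → Prop) ≃
        S.H2tens K,
      ∀ D : FirstOrderDeformation K S, ∃ z : S.Z2tens K,
        (∀ {X X' X'' Y Y' Y'' : C} (f : X ⟶ X') (g : Y ⟶ Y') (f' : X' ⟶ X'') (g' : Y' ⟶ Y''),
          (D.tensorator (X := ⟨X⟩) (X' := ⟨X'⟩) (X'' := ⟨X''⟩) (Y := ⟨Y⟩) (Y' := ⟨Y'⟩)
              (Y'' := ⟨Y''⟩) ⟨f⟩ ⟨g⟩ ⟨f'⟩ ⟨g'⟩).hom =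
            ScalarExt.cell 1 (S.tensorator f g f' g').hom +
              ScalarExt.cell DualNumber.eps (z.1 X X' X'' Y Y' Y'' f g f' g')) ∧
        e (Quot.mk _ D) = Submodule.Quotient.mk z := by
  let c : FirstOrderDeformation K S → S.H2tens K := fun D =>
    Submodule.Quotient.mk ⟨FirstOrderDeformation.cocycle D, FirstOrderDeformation.cocycle_mem D⟩
  have hc : ∀ D D' : FirstOrderDeformation K S, PsiEquivalent D D' ↔ c D = c D' := fun D D' =>
    (FirstOrderDeformation.psiEquivalent_iff hS).trans
      (Submodule.Quotient.eq ((S.B2tens K).submoduleOf (S.Z2tens K))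
        (x := ⟨_, FirstOrderDeformation.cocycle_mem D⟩)
        (y := ⟨_, FirstOrderDeformation.cocycle_mem D'⟩)).symm
  -- By `hc` the relation is the kernel of a map to H², so reflexivity, symmetry and transitivity
  -- come from equality and no semigroupal 2-functor has to be composed or inverted.
  refine ⟨⟨fun D => (hc D D).2 rfl, fun h => (hc _ _).2 ((hc _ _).1 h).symm,
    fun h h' => (hc _ _).2 (((hc _ _).1 h).trans ((hc _ _).1 h'))⟩,
    Equiv.ofBijective (Quot.lift c fun D D' h => (hc D D').1 h) ⟨?_, ?_⟩, fun D =>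
      ⟨⟨FirstOrderDeformation.cocycle D, FirstOrderDeformation.cocycle_mem D⟩,
        fun f g f' g' => FirstOrderDeformation.isDual_tensorator D _ _ _ _, rfl⟩⟩
  · rintro ⟨D⟩ ⟨D'⟩ h
    exact Quot.sound ((hc D D').2 h)
  · intro x
    obtain ⟨⟨φ, hφ⟩, rfl⟩ := Submodule.Quotient.mk_surjective _ x
    -- Any cocycle representing the class integrates to a deformation: first order deformations with
    -- these cells are unobstructed by anything beyond the cocycle conditions.
    refine ⟨Quot.mk _ (FirstOrderDeformation.ofCocycle hS hφ), ?_⟩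
    exact congrArg Submodule.Quotient.mk
      (Subtype.ext (FirstOrderDeformation.cocycle_ofCocycle hS hφ))
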